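/- **Setting.** Let $\mathcal H=H^{1/2}(S^1,\mathbb C)/\mathbb C$ be the complex Hilbert space of functions $u=\sum_{n\in\mathbb Z}u_ne^{inx}$ with $u_0=0$ and $\sum|n||u_n|^2<\infty$, with inner product $\langle u,v\rangle=\sum|n|u_n\overline{v_n}$, and let $\mathcal V\subset\mathcal H$ be the real Hilbert space of real-valued functions. Let $J(\sum u_ne^{inx})=i\sum\operatorname{sgn}(n)u_ne^{inx}$, let $\Omega(u,v)=\langle u,Jv\rangle$ on $\mathcal V$, and denote also by $\Omega$ its complex bilinear extension to $\mathcal H$, that is $\Omega(u,v)=-i\sum n\,u_nv_{-n}$. Let $\mathcal H_+$ (resp. $\mathcal H_-$) be the closed subspace of those $u$ with $u_n=0$ for $n\le 0$ (resp. $n\ge 0$), let $p_\pm$ be the orthogonal projection onto $\mathcal H_\pm$, and let $d=i(p_+-p_-)$. $L^2(E,F)$ denotes the Hilbert space of Hilbert–Schmidt operators $E\to F$, and for an operator $A$ between two of these spaces $\bar A(u)=\overline{A(\bar u)}$. The restricted Siegel disc is $$\mathfrak D_{\rm res}(\mathcal H)=\{Z\in L^2(\mathcal H_-,\mathcal H_+)\mid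 \Omega(Zu,v)=\Omega(Zv,u)\ \forall u,v\in\mathcal H_-,\ \ \langle (I-Z\bar Z)u,u\rangle>0\ \forall u\in\mathcal H_+\setminus\{0\}\}.$$ The restricted symplectic group $\operatorname{Sp}_{\rm res}(\mathcal V,\Omega)$ is the group of the $a\in\operatorname{GL}(\mathcal V)$ that preserve $\Omega$ and whose complex linear extension to $\mathcal H$, still denoted by $a$, satisfies $[d,a]\in L^2(\mathcal H,\mathcal H)$. With respect to $\mathcal H=\mathcal H_+\oplus\mathcal H_-$ such an extension has the form $a=\begin{pmatrix}g&h\\ \bar h&\bar g\end{pmatrix}$. The group carries the topology and the smooth structure of a submanifold given by $a\mapsto(a,[d,a])$, with values in the Banach space $B(\mathcal H)\times L^2(\mathcal H,\mathcal H)$ (that is, those defined by the norm $\|a\|+\|[d,a]\|_{2}$). **Proposition.** 1. The formula $(a,Z)\mapsto (gZ+h)(\bar hZ+\bar g)^{-1}$ is well defined ($\bar hZ+\bar g$ is invertible in $B(\mathcal H_-)$ and the result lies in $\mathfrak D_{\rm res}(\mathcal H)$) and defines a transitive action of $\operatorname{Sp}_{\rm res}(\mathcal V,\Omega)$ on $\mathfrak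 D_{\rm res}(\mathcal H)$. 2. The isotropy group of $0$ is the unitary group $\operatorname U(\mathcal H_+)$, with its norm topology, embedded in $\operatorname{Sp}_{\rm res}(\mathcal V,\Omega)$ by $u\mapsto\begin{pmatrix}u&0\\0&\bar u\end{pmatrix}$. 3. $\mathfrak D_{\rm res}(\mathcal H)$ is open in the Hilbert space of those $Z\in L^2(\mathcal H_-,\mathcal H_+)$ with $\Omega(Zu,v)=\Omega(Zv,u)$ for all $u,v\in\mathcal H_-$. The group $\operatorname{Sp}_{\rm res}(\mathcal V,\Omega)$ is a Banach Lie group, smoothly embedded as a submanifold of $B(\mathcal H)\times L^2(\mathcal H,\mathcal H)$. The quotient $\operatorname{Sp}_{\rm res}(\mathcal V,\Omega)/\operatorname U(\mathcal H_+)$ has a structure of smooth Hilbert manifold (inducing the quotient topology) for which the projection from $\operatorname{Sp}_{\rm res}(\mathcal V,\Omega)$ is a smooth submersion, and for every such structure the orbit map $a\operatorname U(\mathcal H_+)\mapsto a\cdot 0$ is a (real) smooth diffeomorphism onto $\mathfrak D_{\rm res}(\mathcal H)$. -/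

import Mathlib

set_option linter.unusedSectionVars false

noncomputable section

namespace SiegelDisc

open scoped ENNReal ComplexConjugate InnerProductSpace Manifold ContDiff

section HilbertSchmidt

theorem enorm_sq_eq_tsum {E : Type} [NormedAddCommGroup E] [InnerProductSpace ℂ E] {ι : Type*}
    (b : HilbertBasis ι ℂ E) (x : E) : ‖x‖ₑ ^ 2 = ∑' i, ‖⟪b i, x⟫_ℂ‖ₑ ^ 2 := by
  have h : HasSum (fun i => ‖⟪b i, x⟫_ℂ‖ ^ 2) (‖x‖ ^ 2) := by
    have := lp.hasSum_norm (p := 2) (by norm_num) (b.repr x)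
    simpa [HilbertBasis.repr_apply_apply] using this
  have h2 := ENNReal.ofReal_tsum_of_nonneg (fun i => by positivity) h.summable
  rw [h.tsum_eq] at h2
  simpa [ENNReal.ofReal_pow, ofReal_norm] using h2

variable {E F G : Type} [NormedAddCommGroup E] [InnerProductSpace ℂ E] [CompleteSpace E]
  [NormedAddCommGroup F] [InnerProductSpace ℂ F] [CompleteSpace F]
  [NormedAddCommGroup G] [InnerProductSpace ℂ G] [CompleteSpace G]

theorem tsum_enorm_adjoint {ι κ : Type*} (b : HilbertBasis ι ℂ E) (c : HilbertBasis κ ℂ F)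
    (A : E →L[ℂ] F) :
    ∑' i, ‖A (b i)‖ₑ ^ 2 = ∑' j, ‖ContinuousLinearMap.adjoint A (c j)‖ₑ ^ 2 := by
  simp_rw [enorm_sq_eq_tsum c, enorm_sq_eq_tsum b]
  rw [ENNReal.tsum_comm]
  refine tsum_congr fun j => tsum_congr fun i => ?_
  rw [ContinuousLinearMap.adjoint_inner_right, ← inner_conj_symm]
  simp [enorm_eq_nnnorm, nnnorm, norm_inner_symm]

theorem summable_iff_tsum_enorm {ι : Type*} (f : ι → F) :
    Summable (fun i => ‖f i‖ ^ 2) ↔ ∑' i, ‖f i‖ₑ ^ 2 ≠ ⊤ := by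
  have h : (fun i => ‖f i‖ₑ ^ 2) = fun i => ((‖f i‖₊ ^ 2 : NNReal) : ℝ≥0∞) := by
    ext i; simp [enorm_eq_nnnorm]
  rw [h, ENNReal.tsum_coe_ne_top_iff_summable, ← NNReal.summable_coe]
  simp

variable (E) in
/-- The index set of a chosen Hilbert basis of `E`. -/
def basisSet : Set E := (exists_hilbertBasis ℂ E).choose

variable (E) in
/-- A chosen Hilbert basis (complete orthonormal family) of `E`. -/
def stdBasis : HilbertBasis (basisSet E) ℂ E := (exists_hilbertBasis ℂ E).choose_spec.choose

/-- `A` is a Hilbert-Schmidt operator: `∑ ‖A eᵢ‖² < ∞` for a Hilbert basis `(eᵢ)`.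
By `isHilbertSchmidt_iff` this does not depend on the basis. -/
def IsHilbertSchmidt (A : E →L[ℂ] F) : Prop :=
  Summable fun i => ‖A (stdBasis E i)‖ ^ 2

theorem isHilbertSchmidt_iff {ι : Type*} (b : HilbertBasis ι ℂ E) (A : E →L[ℂ] F) :
    IsHilbertSchmidt A ↔ Summable fun i => ‖A (b i)‖ ^ 2 := by
  rw [IsHilbertSchmidt, summable_iff_tsum_enorm, summable_iff_tsum_enorm,
    tsum_enorm_adjoint _ (stdBasis F), tsum_enorm_adjoint _ (stdBasis F)]

theorem isHilbertSchmidt_adjoint {A : E →L[ℂ] F} (hA : IsHilbertSchmidt A) :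
    IsHilbertSchmidt (ContinuousLinearMap.adjoint A) := by
  rw [IsHilbertSchmidt, summable_iff_tsum_enorm] at hA ⊢
  rwa [← tsum_enorm_adjoint (stdBasis E)]

theorem IsHilbertSchmidt.comp_left {A : E →L[ℂ] F} (hA : IsHilbertSchmidt A) (B : F →L[ℂ] G) :
    IsHilbertSchmidt (B ∘L A) := by
  refine Summable.of_nonneg_of_le (fun i => by positivity) (fun i => ?_)
    (Summable.mul_left (‖B‖ ^ 2) hA)
  rw [← mul_pow]
  exact pow_le_pow_left₀ (norm_nonneg _) (B.le_opNorm _) 2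

theorem IsHilbertSchmidt.comp_right {A : F →L[ℂ] G} (hA : IsHilbertSchmidt A) (B : E →L[ℂ] F) :
    IsHilbertSchmidt (A ∘L B) := by
  have h := isHilbertSchmidt_adjoint
    ((isHilbertSchmidt_adjoint hA).comp_left (ContinuousLinearMap.adjoint B))
  rwa [← ContinuousLinearMap.adjoint_comp, ContinuousLinearMap.adjoint_adjoint] at h

theorem isHilbertSchmidt_iff_memℓp (A : E →L[ℂ] F) :
    IsHilbertSchmidt A ↔ Memℓp (fun i => A (stdBasis E i)) 2 := by
  rw [memℓp_gen_iff (by norm_num), IsHilbertSchmidt]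
  simp

variable (E F) in
/-- The subspace of Hilbert-Schmidt operators. -/
def hilbertSchmidtSubmodule : Submodule ℂ (E →L[ℂ] F) where
  carrier := {A | IsHilbertSchmidt A}
  add_mem' {A B} hA hB := by
    simp only [Set.mem_ofPred_eq, isHilbertSchmidt_iff_memℓp] at *
    exact hA.add hB
  zero_mem' := by simp [IsHilbertSchmidt, summable_zero]
  smul_mem' c A hA := by
    simp only [Set.mem_ofPred_eq, isHilbertSchmidt_iff_memℓp] at *
    exact hA.const_smul c

variable (E F) in
/-- The space `L²(E, F)` of Hilbert-Schmidt operators. Below it gets the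
Hilbert-Schmidt inner product (not the operator norm). -/
def HS : Type := hilbertSchmidtSubmodule E F

namespace HS

instance : AddCommGroup (HS E F) := inferInstanceAs (AddCommGroup (hilbertSchmidtSubmodule E F))
instance : Module ℂ (HS E F) := inferInstanceAs (Module ℂ (hilbertSchmidtSubmodule E F))

/-- The underlying bounded operator of a Hilbert-Schmidt operator. -/
def toCLM : HS E F →ₗ[ℂ] (E →L[ℂ] F) := (hilbertSchmidtSubmodule E F).subtype

theorem toCLM_injective : Function.Injective (toCLM : HS E F → (E →L[ℂ] F)) :=
  Subtype.val_injective

theorem isHilbertSchmidt (A : HS E F) : IsHilbertSchmidt (toCLM A) := A.2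

/-- A Hilbert-Schmidt operator, as an element of `HS E F`. -/
def mk (A : E →L[ℂ] F) (hA : IsHilbertSchmidt A) : HS E F := ⟨A, hA⟩

@[simp] theorem toCLM_mk (A : E →L[ℂ] F) (hA : IsHilbertSchmidt A) : toCLM (mk A hA) = A := rfl

/-- `A ↦ (A eᵢ)ᵢ`. -/
def toLp : HS E F →ₗ[ℂ] lp (fun _ : basisSet E => F) 2 where
  toFun A := ⟨fun i => toCLM A (stdBasis E i), (isHilbertSchmidt_iff_memℓp _).1 A.isHilbertSchmidt⟩
  map_add' A B := by ext i; simp; rfl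
  map_smul' c A := by ext i; simp

theorem toLp_injective : Function.Injective (toLp : HS E F → _) := by
  intro A B h
  apply toCLM_injective
  apply ContinuousLinearMap.ext_on (s := Set.range (stdBasis E))
  · exact (Submodule.dense_iff_topologicalClosure_eq_top).2 (stdBasis E).dense_span
  · rintro _ ⟨i, rfl⟩
    exact congrFun (congrArg Subtype.val h) i

/-- The Hilbert-Schmidt norm `‖A‖₂ = (∑ ‖A eᵢ‖²)^(1/2)`. -/
instance : NormedAddCommGroup (HS E F) := NormedAddCommGroup.induced _ _ toLp toLp_injective

/-- The Hilbert-Schmidt inner product `∑ ⟪A eᵢ, B eᵢ⟫ = Tr (A* B)`. -/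
instance : InnerProductSpace ℂ (HS E F) where
  norm_smul_le c A := by
    change ‖toLp (c • A)‖ ≤ ‖c‖ * ‖toLp A‖
    rw [map_smul]; exact norm_smul_le _ _
  inner A B := ⟪toLp A, toLp B⟫_ℂ
  norm_sq_eq_re_inner A := norm_sq_eq_re_inner (toLp A)
  conj_inner_symm A B := inner_conj_symm _ _
  add_left A B C := by rw [map_add]; exact inner_add_left _ _ _
  smul_left A B c := by rw [map_smul]; exact inner_smul_left _ _ _

theorem inner_eq_tsum (A B : HS E F) :
    ⟪A, B⟫_ℂ = ∑' i, ⟪toCLM A (stdBasis E i), toCLM B (stdBasis E i)⟫_ℂ := rfl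

theorem summable_and_bound (a : lp (fun _ : basisSet E => F) 2) (u : E) :
    (Summable fun i => ‖(stdBasis E).repr u i • a i‖) ∧
      ‖∑' i, (stdBasis E).repr u i • a i‖ ≤ ‖a‖ * ‖u‖ := by
  let c : lp (fun _ : basisSet E => ℝ) 2 :=
    ⟨fun i => ‖(stdBasis E).repr u i‖, (memℓp_gen_iff (by norm_num)).2 <| by
      simpa using (memℓp_gen_iff (p := 2) (by norm_num)).1 (lp.memℓp ((stdBasis E).repr u))⟩
  let d : lp (fun _ : basisSet E => ℝ) 2 :=
    ⟨fun i => ‖a i‖, (memℓp_gen_iff (by norm_num)).2 <| by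
      simpa using (memℓp_gen_iff (p := 2) (by norm_num)).1 (lp.memℓp a)⟩
  have hc : ‖c‖ = ‖u‖ := by
    rw [← (stdBasis E).repr.norm_map u, lp.norm_eq_tsum_rpow (by norm_num),
      lp.norm_eq_tsum_rpow (by norm_num)]
    simp [c]
  have hd : ‖d‖ = ‖a‖ := by
    rw [lp.norm_eq_tsum_rpow (by norm_num), lp.norm_eq_tsum_rpow (by norm_num)]
    simp [d]
  have hs : Summable fun i => ‖(stdBasis E).repr u i • a i‖ := by
    have := lp.summable_inner (𝕜 := ℝ) c d
    simpa [c, d, norm_smul, mul_comm] using this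
  refine ⟨hs, (norm_tsum_le_tsum_norm hs).trans ?_⟩
  have h1 := real_inner_le_norm c d
  rw [lp.inner_eq_tsum, hc, hd, mul_comm] at h1
  simpa [c, d, norm_smul, mul_comm] using h1

theorem norm_apply_le (A : HS E F) (u : E) : ‖toCLM A u‖ ≤ ‖A‖ * ‖u‖ := by
  have h := ((stdBasis E).hasSum_repr u).mapL (toCLM A)
  have h2 := (summable_and_bound (toLp A) u).2
  have h3 : ∑' i, (stdBasis E).repr u i • toLp A i = toCLM A u := by
    rw [← h.tsum_eq]
    refine tsum_congr fun i => ?_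
    rw [map_smul]; rfl
  rw [h3] at h2
  exact h2

theorem toLp_surjective : Function.Surjective (toLp : HS E F → _) := by
  intro a
  have hs := fun u => (summable_and_bound a u).1
  let L : E →ₗ[ℂ] F :=
    { toFun := fun u => ∑' i, (stdBasis E).repr u i • a i
      map_add' := fun u v => by
        rw [← (hs u).of_norm.tsum_add (hs v).of_norm]
        simp [add_smul]
      map_smul' := fun k u => by
        simp [mul_smul, ((hs u).of_norm).tsum_const_smul] }
  have hL : ∀ i, L (stdBasis E i) = a i := fun i => by
    classical
    change ∑' j, (stdBasis E).repr (stdBasis E i) j • a j = a i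
    rw [HilbertBasis.repr_self, tsum_eq_single i]
    · simp
    · intro j hj; simp [hj]
  have hL' : IsHilbertSchmidt (L.mkContinuous ‖a‖ fun u => (summable_and_bound a u).2) := by
    rw [isHilbertSchmidt_iff_memℓp]
    simp only [LinearMap.mkContinuous_apply, hL]
    exact lp.memℓp a
  exact ⟨mk _ hL', by ext i; exact hL i⟩

instance : CompleteSpace (HS E F) := by
  let e : HS E F ≃ₗᵢ[ℂ] lp (fun _ : basisSet E => F) 2 :=
    { LinearEquiv.ofBijective toLp ⟨toLp_injective, toLp_surjective⟩ with
      norm_map' := fun _ => rfl }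
  exact (completeSpace_congr (e := e.toEquiv) e.isometry.isUniformEmbedding).2 inferInstance

end HS
end HilbertSchmidt

section SobolevSpace
open MeasureTheory AddCircle

instance factTwoPiPos : Fact (0 < 2 * Real.pi) := ⟨Real.two_pi_pos⟩

/-- `L²(S¹, ℂ)`, where `S¹ = ℝ / 2πℤ` and the measure is normalized. The `n`-th Fourier coefficient
`fourierCoeff u n` is the coefficient of `e^{inx}`. -/
abbrev L2Circle : Type := Lp ℂ 2 (haarAddCircle (T := 2 * Real.pi))

theorem fourierCoeff_add' (u v : L2Circle) (n : ℤ) :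
    fourierCoeff (u + v : L2Circle) n = fourierCoeff u n + fourierCoeff v n := by
  simp only [← fourierBasis_repr, map_add]; rfl

theorem fourierCoeff_smul' (c : ℂ) (u : L2Circle) (n : ℤ) :
    fourierCoeff (c • u : L2Circle) n = c * fourierCoeff u n := by
  simp only [← fourierBasis_repr, map_smul]; rfl

theorem fourierCoeff_star (u : L2Circle) (n : ℤ) :
    fourierCoeff (star u : L2Circle) n = conj (fourierCoeff u (-n)) := by
  rw [fourierCoeff, fourierCoeff, ← integral_conj]
  apply integral_congr_ae
  filter_upwards [Lp.coeFn_star u] with x hx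
  simp [hx]

/-- The mean-zero functions in `H^{1/2}(S¹, ℂ)`, that is `u = ∑ uₙ e^{inx}` with `u₀ = 0` and
`∑ |n| |uₙ|² < ∞`. -/
def halfSobolev : Submodule ℂ L2Circle where
  carrier := {u | fourierCoeff u 0 = 0 ∧ Summable fun n : ℤ => |(n : ℝ)| * ‖fourierCoeff u n‖ ^ 2}
  add_mem' {u v} hu hv := by
    refine ⟨by rw [fourierCoeff_add', hu.1, hv.1, add_zero], ?_⟩
    refine Summable.of_nonneg_of_le (fun n => by positivity) (fun n => ?_)
      ((hu.2.add hv.2).mul_left 2)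
    rw [fourierCoeff_add']
    have h1 := norm_add_le (fourierCoeff u n) (fourierCoeff v n)
    have h2 : ‖fourierCoeff u n + fourierCoeff v n‖ ^ 2
        ≤ 2 * (‖fourierCoeff u n‖ ^ 2 + ‖fourierCoeff v n‖ ^ 2) := by
      nlinarith [sq_nonneg (‖fourierCoeff u n‖ - ‖fourierCoeff v n‖),
        norm_nonneg (fourierCoeff u n + fourierCoeff v n)]
    nlinarith [mul_le_mul_of_nonneg_left h2 (abs_nonneg (n : ℝ))]
  zero_mem' := by
    have h : ∀ n, fourierCoeff (0 : L2Circle) n = 0 := fun n => by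
      rw [← fourierBasis_repr, map_zero]; rfl
    exact ⟨h 0, by simp only [h]; simp [summable_zero]⟩
  smul_mem' c u hu := by
    refine ⟨by rw [fourierCoeff_smul', hu.1, mul_zero], ?_⟩
    simp only [fourierCoeff_smul', norm_mul, mul_pow]
    exact (hu.2.mul_left (‖c‖ ^ 2)).congr fun n => by ring

/-- The complex Hilbert space `𝓗 = H^{1/2}(S¹, ℂ) / ℂ`, realized by functions of mean zero.
It carries the inner product `∑ |n| uₙ v̄ₙ` (not the one of `L²`). -/
def Hilb : Type := halfSobolev

namespace Hilb

instance : AddCommGroup Hilb := inferInstanceAs (AddCommGroup halfSobolev)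
instance : Module ℂ Hilb := inferInstanceAs (Module ℂ halfSobolev)

/-- The function (class in `L²`) underlying an element of `𝓗`. -/
def toL2 : Hilb →ₗ[ℂ] L2Circle := halfSobolev.subtype

/-- The `n`-th Fourier coefficient `uₙ` of `u ∈ 𝓗`. -/
def coeff (n : ℤ) : Hilb →ₗ[ℂ] ℂ where
  toFun u := fourierCoeff (toL2 u) n
  map_add' u v := by rw [map_add, fourierCoeff_add']
  map_smul' c u := by rw [map_smul, fourierCoeff_smul']; rfl

@[simp] theorem coeff_zero_index (u : Hilb) : coeff 0 u = 0 := u.2.1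

theorem summable_coeff (u : Hilb) : Summable fun n : ℤ => |(n : ℝ)| * ‖coeff n u‖ ^ 2 := u.2.2

theorem ext_coeff {u v : Hilb} (h : ∀ n, coeff n u = coeff n v) : u = v := by
  apply Subtype.val_injective
  apply (fourierBasis (T := 2 * Real.pi)).repr.injective
  ext n
  rw [fourierBasis_repr, fourierBasis_repr]
  exact h n

/-- Every admissible sequence of Fourier coefficients comes from an element of `𝓗`. -/
theorem exists_coeff (a : ℤ → ℂ) (h0 : a 0 = 0) (h : Summable fun n : ℤ => |(n : ℝ)| * ‖a n‖ ^ 2) :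
    ∃ u : Hilb, ∀ n, coeff n u = a n := by
  have h2 : Memℓp a 2 := by
    rw [memℓp_gen_iff (by norm_num)]
    refine Summable.of_nonneg_of_le (fun n => by positivity) (fun n => ?_) h
    by_cases hn : n = 0
    · simp [hn, h0]
    · have : (1 : ℝ) ≤ |(n : ℝ)| := by exact_mod_cast Int.one_le_abs hn
      simpa using le_mul_of_one_le_left (sq_nonneg ‖a n‖) this
  have key : ∀ n, fourierCoeff ((fourierBasis (T := 2 * Real.pi)).repr.symm ⟨a, h2⟩ : L2Circle) n
      = a n := fun n => by
    rw [← fourierBasis_repr, LinearIsometryEquiv.apply_symm_apply]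
  exact ⟨⟨fourierBasis.repr.symm ⟨a, h2⟩, by rw [key, h0], by simpa only [key] using h⟩, key⟩

/-- `u ↦ (|n|^{1/2} uₙ)ₙ`. -/
def toLp : Hilb →ₗ[ℂ] lp (fun _ : ℤ => ℂ) 2 where
  toFun u := ⟨fun n => (√|(n : ℝ)| : ℂ) * coeff n u, by
    refine (memℓp_gen_iff (by norm_num)).2 ?_
    refine u.summable_coeff.congr fun n => ?_
    simp [mul_pow, abs_of_nonneg (Real.sqrt_nonneg _)]⟩
  map_add' u v := by ext n; simp [mul_add]; rfl
  map_smul' c u := by ext n; simp [mul_left_comm]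

theorem toLp_apply (u : Hilb) (n : ℤ) : toLp u n = (√|(n : ℝ)| : ℂ) * coeff n u := rfl

theorem toLp_injective : Function.Injective toLp := by
  intro u v h
  refine ext_coeff fun n => ?_
  by_cases hn : n = 0
  · simp [hn]
  · have h1 : toLp u n = toLp v n := by rw [h]
    rw [toLp_apply, toLp_apply] at h1
    have : (√|(n : ℝ)| : ℂ) ≠ 0 := by
      simp [hn]
    exact mul_left_cancel₀ this h1

instance : NormedAddCommGroup Hilb := NormedAddCommGroup.induced _ _ toLp toLp_injective

/-- The Hilbert inner product of `𝓗`. Mathlib's inner products are conjugate linear in the first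
variable: `⟪v, u⟫` is `∑ |n| uₙ v̄ₙ`. -/
instance : InnerProductSpace ℂ Hilb where
  norm_smul_le c A := by
    change ‖toLp (c • A)‖ ≤ ‖c‖ * ‖toLp A‖
    rw [map_smul]; exact norm_smul_le _ _
  inner A B := ⟪toLp A, toLp B⟫_ℂ
  norm_sq_eq_re_inner A := norm_sq_eq_re_inner (toLp A)
  conj_inner_symm A B := inner_conj_symm _ _
  add_left A B C := by rw [map_add]; exact inner_add_left _ _ _
  smul_left A B c := by rw [map_smul]; exact inner_smul_left _ _ _

theorem inner_eq_tsum (u v : Hilb) :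
    ⟪v, u⟫_ℂ = ∑' n : ℤ, ((|(n : ℝ)| : ℝ) : ℂ) * coeff n u * conj (coeff n v) := by
  change ⟪toLp v, toLp u⟫_ℂ = _
  rw [lp.inner_eq_tsum]
  refine tsum_congr fun n => ?_
  have : (√|(n : ℝ)| : ℂ) * (√|(n : ℝ)| : ℂ) = ((|(n : ℝ)| : ℝ) : ℂ) := by
    rw [← Complex.ofReal_mul, Real.mul_self_sqrt (abs_nonneg _)]
  rw [toLp_apply, toLp_apply, RCLike.inner_apply, map_mul, Complex.conj_ofReal, ← this]
  ring

theorem norm_sq_eq_tsum (u : Hilb) : ‖u‖ ^ 2 = ∑' n : ℤ, |(n : ℝ)| * ‖coeff n u‖ ^ 2 := by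
  change ‖toLp u‖ ^ 2 = _
  have := lp.norm_rpow_eq_tsum (p := 2) (by norm_num) (toLp u)
  simp only [ENNReal.toReal_ofNat, Real.rpow_ofNat] at this
  rw [this]
  refine tsum_congr fun n => ?_
  simp [toLp_apply, mul_pow, abs_of_nonneg (Real.sqrt_nonneg _)]

theorem norm_coeff_le (n : ℤ) (u : Hilb) : ‖coeff n u‖ ≤ ‖u‖ := by
  by_cases hn : n = 0
  · simp [hn]
  · have h1 : |(n : ℝ)| * ‖coeff n u‖ ^ 2 ≤ ‖u‖ ^ 2 := by
      rw [norm_sq_eq_tsum]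
      exact u.summable_coeff.le_tsum n (fun _ _ => by positivity)
    have : (1 : ℝ) ≤ |(n : ℝ)| := by exact_mod_cast Int.one_le_abs hn
    exact le_of_sq_le_sq (by nlinarith [sq_nonneg ‖coeff n u‖]) (norm_nonneg _)

theorem continuous_coeff (n : ℤ) : Continuous (coeff n) :=
  ((coeff n).mkContinuous 1 fun u => by simpa using norm_coeff_le n u).continuous

theorem range_toLp : Set.range toLp = {a | a 0 = 0} := by
  ext a
  constructor
  · rintro ⟨u, rfl⟩
    simp [toLp_apply]
  · intro ha
    have hne : ∀ n : ℤ, n ≠ 0 → (√|(n : ℝ)| : ℂ) ≠ 0 := fun n hn => by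
      simp [hn]
    obtain ⟨u, hu⟩ := exists_coeff (fun n => (√|(n : ℝ)| : ℂ)⁻¹ * a n) (by simp) (by
      have := (memℓp_gen_iff (p := 2) (by norm_num)).1 (lp.memℓp a)
      refine this.congr fun n => ?_
      by_cases hn : n = 0
      · subst hn
        simpa using ha
      · simp [mul_pow, abs_of_nonneg (Real.sqrt_nonneg _), hn])
    refine ⟨u, ?_⟩
    ext n
    rw [toLp_apply, hu]
    by_cases hn : n = 0
    · subst hn
      simpa using ha.symm
    · exact mul_inv_cancel_left₀ (hne n hn) _

instance : CompleteSpace Hilb := by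
  have hi : Isometry toLp := AddMonoidHomClass.isometry_of_norm toLp fun _ => rfl
  have hc : IsClosed (Set.range toLp) := by
    rw [range_toLp]
    have := (continuous_apply (0 : ℤ)).comp
      (lp.uniformContinuous_coe (E := fun _ : ℤ => ℂ) (p := 2)).continuous
    exact isClosed_eq this continuous_const
  exact (completeSpace_iff_isComplete_range hi.isUniformInducing).2 hc.isComplete

end Hilb

/-- The conjugate function `ū`. -/
def conjFun (u : Hilb) : Hilb :=
  (⟨star (Hilb.toL2 u), by
    refine ⟨?_, ?_⟩
    · rw [fourierCoeff_star, neg_zero, show fourierCoeff (Hilb.toL2 u) 0 = 0 from u.2.1, map_zero]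
    · simp only [fourierCoeff_star, RCLike.norm_conj]
      refine ((Equiv.neg ℤ).summable_iff.2 u.summable_coeff).congr fun n => ?_
      simp [Hilb.coeff]⟩ : halfSobolev)

theorem coeff_conjFun (u : Hilb) (n : ℤ) :
    Hilb.coeff n (conjFun u) = conj (Hilb.coeff (-n) u) :=
  fourierCoeff_star _ _

/-- Complex conjugation `u ↦ ū` of functions, on `𝓗`. -/
def conjugation : Hilb →L⋆[ℂ] Hilb :=
  LinearMap.mkContinuous
    { toFun := conjFun
      map_add' := fun u v => Hilb.ext_coeff fun n => by simp [coeff_conjFun]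
      map_smul' := fun c u => Hilb.ext_coeff fun n => by simp [coeff_conjFun] } 1
    (fun u => by
      rw [one_mul]
      apply le_of_sq_le_sq _ (norm_nonneg _)
      rw [Hilb.norm_sq_eq_tsum, Hilb.norm_sq_eq_tsum, ← (Equiv.neg ℤ).tsum_eq]
      refine le_of_eq (tsum_congr fun n => ?_)
      simp [coeff_conjFun])

theorem coeff_conjugation (u : Hilb) (n : ℤ) :
    Hilb.coeff n (conjugation u) = conj (Hilb.coeff (-n) u) :=
  coeff_conjFun u n

theorem conjugation_conjugation (u : Hilb) : conjugation (conjugation u) = u :=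
  Hilb.ext_coeff fun n => by simp [coeff_conjugation]

theorem exists_hilbertTransform (u : Hilb) :
    ∃ v : Hilb, ∀ n, Hilb.coeff n v = Complex.I * (n.sign : ℂ) * Hilb.coeff n u := by
  refine Hilb.exists_coeff _ (by simp) ?_
  refine Summable.of_nonneg_of_le (fun n => by positivity) (fun n => ?_) u.summable_coeff
  rcases lt_trichotomy n 0 with h | h | h
  · simp [Int.sign_eq_neg_one_of_neg h]
  · simp [h]
  · simp [Int.sign_eq_one_of_pos h]

/-- The Hilbert transform `J (∑ uₙ e^{inx}) = i ∑ sgn(n) uₙ e^{inx}`. -/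
def J : Hilb →L[ℂ] Hilb :=
  LinearMap.mkContinuous
    { toFun := fun u => (exists_hilbertTransform u).choose
      map_add' := fun u v => Hilb.ext_coeff fun n => by
        rw [map_add, (exists_hilbertTransform _).choose_spec,
          (exists_hilbertTransform _).choose_spec, (exists_hilbertTransform _).choose_spec,
          map_add, mul_add]
      map_smul' := fun c u => Hilb.ext_coeff fun n => by
        rw [map_smul, (exists_hilbertTransform _).choose_spec,
          (exists_hilbertTransform _).choose_spec, map_smul]
        simp only [smul_eq_mul, RingHom.id_apply]
        ring } 1
    (fun u => by
      rw [one_mul]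
      apply le_of_sq_le_sq _ (norm_nonneg _)
      rw [Hilb.norm_sq_eq_tsum, Hilb.norm_sq_eq_tsum]
      refine le_of_eq (tsum_congr fun n => ?_)
      simp only [LinearMap.coe_mk, AddHom.coe_mk]
      rw [(exists_hilbertTransform _).choose_spec]
      rcases lt_trichotomy n 0 with h | h | h
      · simp [Int.sign_eq_neg_one_of_neg h]
      · simp [h]
      · simp [Int.sign_eq_one_of_pos h])

theorem coeff_J (u : Hilb) (n : ℤ) :
    Hilb.coeff n (J u) = Complex.I * (n.sign : ℂ) * Hilb.coeff n u :=
  (exists_hilbertTransform u).choose_spec n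

/-- The complex bilinear extension to `𝓗` of the symplectic form `Ω(u, v) = ⟨u, J v⟩` of the space
of real valued functions (where `J v` is real, so that the conjugation does nothing). -/
def Omega (u v : Hilb) : ℂ := ⟪conjugation (J v), u⟫_ℂ

theorem Omega_eq_tsum (u v : Hilb) :
    Omega u v = -Complex.I * ∑' n : ℤ, (n : ℂ) * Hilb.coeff n u * Hilb.coeff (-n) v := by
  rw [Omega, Hilb.inner_eq_tsum, ← tsum_mul_left]
  refine tsum_congr fun n => ?_
  have h : ((|(n : ℝ)| : ℝ) : ℂ) * (n.sign : ℂ) = n := by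
    have := Int.sign_mul_abs n
    rw [mul_comm]
    exact_mod_cast congrArg (Int.cast : ℤ → ℂ) this
  rw [coeff_conjugation, coeff_J, Complex.conj_conj, Int.sign_neg, ← h]
  push_cast
  ring

/-- The subspace `𝓗₊` of the functions `∑_{n ≥ 1} uₙ e^{inx}`. -/
def Hplus : Submodule ℂ Hilb where
  carrier := {u | ∀ n ≤ 0, Hilb.coeff n u = 0}
  add_mem' {u v} hu hv n hn := by rw [map_add, hu n hn, hv n hn, add_zero]
  zero_mem' n _ := map_zero _
  smul_mem' c u hu n hn := by rw [map_smul, hu n hn, smul_zero]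

/-- The subspace `𝓗₋` of the functions `∑_{n ≤ -1} uₙ e^{inx}`. -/
def Hminus : Submodule ℂ Hilb where
  carrier := {u | ∀ n ≥ 0, Hilb.coeff n u = 0}
  add_mem' {u v} hu hv n hn := by rw [map_add, hu n hn, hv n hn, add_zero]
  zero_mem' n _ := map_zero _
  smul_mem' c u hu n hn := by rw [map_smul, hu n hn, smul_zero]

instance : CompleteSpace Hplus := by
  refine IsClosed.completeSpace_coe (s := (Hplus : Set Hilb)) (hs := ?_)
  have : (Hplus : Set Hilb) = ⋂ n : ℤ, ⋂ _ : n ≤ 0, {u | Hilb.coeff n u = 0} := by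
    ext u; simp [Hplus]
  rw [this]
  exact isClosed_iInter fun n => isClosed_iInter fun _ =>
    isClosed_eq (Hilb.continuous_coeff n) continuous_const

instance : CompleteSpace Hminus := by
  refine IsClosed.completeSpace_coe (s := (Hminus : Set Hilb)) (hs := ?_)
  have : (Hminus : Set Hilb) = ⋂ n : ℤ, ⋂ _ : n ≥ 0, {u | Hilb.coeff n u = 0} := by
    ext u; simp [Hminus]
  rw [this]
  exact isClosed_iInter fun n => isClosed_iInter fun _ =>
    isClosed_eq (Hilb.continuous_coeff n) continuous_const

/-- Conjugation as a map `𝓗₊ → 𝓗₋`. -/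
def conjPlus : Hplus →L⋆[ℂ] Hminus :=
  (conjugation.comp Hplus.subtypeL).codRestrict Hminus fun u n hn => by
    have h := u.2 (-n) (by omega)
    simp [coeff_conjugation, h]

/-- Conjugation as a map `𝓗₋ → 𝓗₊`. -/
def conjMinus : Hminus →L⋆[ℂ] Hplus :=
  (conjugation.comp Hminus.subtypeL).codRestrict Hplus fun u n hn => by
    have h := u.2 (-n) (by omega)
    simp [coeff_conjugation, h]

/-- For `Z : 𝓗₋ → 𝓗₊`, the operator `Z̄ : 𝓗₊ → 𝓗₋`, `Z̄ u` being the conjugate of `Z ū`. -/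
def barMP (Z : Hminus →L[ℂ] Hplus) : Hplus →L[ℂ] Hminus := conjPlus.comp (Z.comp conjPlus)

/-- For `g : 𝓗₊ → 𝓗₊`, the operator `ḡ : 𝓗₋ → 𝓗₋`, `ḡ u` being the conjugate of `g ū`. -/
def barPP (g : Hplus →L[ℂ] Hplus) : Hminus →L[ℂ] Hminus := conjPlus.comp (g.comp conjMinus)

/-- The Siegel disc `𝔇(𝓗)`: the operators `Z : 𝓗₋ → 𝓗₊` with `Ω(Zu, v) = Ω(Zv, u)` and
`I - Z Z̄ > 0`. (Because of the symmetry, `I - Z Z̄ = I - Z Z*` is self-adjoint, so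
`⟨(I - Z Z̄) u, u⟩` is real.) -/
def siegelDisc : Set (Hminus →L[ℂ] Hplus) :=
  {Z | (∀ u v : Hminus, Omega (Z u) v = Omega (Z v) u) ∧
    ∀ u : Hplus, u ≠ 0 → 0 < (⟪u, u - Z (barMP Z u)⟫_ℂ).re}

/-- The Hilbert space of symmetric Hilbert-Schmidt operators `𝓗₋ → 𝓗₊`. -/
def symHS : Submodule ℂ (HS Hminus Hplus) where
  carrier := {Z | ∀ u v : Hminus, Omega (HS.toCLM Z u) v = Omega (HS.toCLM Z v) u}
  add_mem' {Y Z} hY hZ u v := by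
    have h1 := hY u v
    have h2 := hZ u v
    simp only [Omega] at *
    simp [h1, h2]
  zero_mem' u v := by simp [Omega]
  smul_mem' c Z hZ u v := by
    have h := hZ u v
    simp only [Omega] at *
    simp [h]

instance : CompleteSpace symHS := by
  refine IsClosed.completeSpace_coe (s := (symHS : Set (HS Hminus Hplus))) (hs := ?_)
  have hcont : ∀ u : Hminus, Continuous fun Z : HS Hminus Hplus => HS.toCLM Z u := fun u =>
    (((LinearMap.applyₗ u).comp
      ((ContinuousLinearMap.coeLM ℂ).comp HS.toCLM)).mkContinuous ‖u‖ fun Z => by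
        simpa [mul_comm] using HS.norm_apply_le Z u).continuous
  have : (symHS : Set (HS Hminus Hplus)) = ⋂ u : Hminus, ⋂ v : Hminus,
      {Z : HS Hminus Hplus | Omega (HS.toCLM Z u) v = Omega (HS.toCLM Z v) u} := by
    ext u; simp [symHS]
  rw [this]
  refine isClosed_iInter fun u => isClosed_iInter fun v => isClosed_eq ?_ ?_
  · exact continuous_const.inner (continuous_subtype_val.comp (hcont u))
  · exact continuous_const.inner (continuous_subtype_val.comp (hcont v))

/-- The restricted Siegel disc: the Hilbert-Schmidt operators in `𝔇(𝓗)`, as a subset of the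
Hilbert space of symmetric Hilbert-Schmidt operators. -/
def restrictedSiegelDisc : Set symHS :=
  {Z | HS.toCLM (Z : HS Hminus Hplus) ∈ siegelDisc}

/-- The real Hilbert space `𝓥` of the real valued functions in `𝓗`. -/
def V : Submodule ℝ Hilb where
  carrier := {u | conjugation u = u}
  add_mem' {u v} hu hv := by
    simp only [Set.mem_ofPred_eq] at *
    rw [map_add, hu, hv]
  zero_mem' := map_zero _
  smul_mem' c u hu := by
    simp only [Set.mem_ofPred_eq] at *
    rw [← Complex.coe_smul, map_smulₛₗ, hu, Complex.conj_ofReal]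

/-- The real part `Re u = (u + ū) / 2`. -/
def realPart : Hilb →L[ℝ] V :=
  ContinuousLinearMap.codRestrict
    { toFun := fun u => (1 / 2 : ℝ) • (u + conjugation u)
      map_add' := fun u v => by rw [map_add, ← smul_add]; congr 1; abel
      map_smul' := fun c u => by
        have : conjugation (c • u) = c • conjugation u := by
          rw [← Complex.coe_smul, map_smulₛₗ, Complex.conj_ofReal, Complex.coe_smul]
        rw [this, ← smul_add, smul_comm, RingHom.id_apply]
      cont := (continuous_id.add conjugation.continuous).const_smul _ }
    V fun u => by
      change conjugation ((1 / 2 : ℝ) • (u + conjugation u)) = (1 / 2 : ℝ) • (u + conjugation u)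
      rw [← Complex.coe_smul, map_smulₛₗ, Complex.conj_ofReal, map_add, conjugation_conjugation, add_comm]

theorem coe_realPart (u : Hilb) : (realPart u : Hilb) = (1 / 2 : ℝ) • (u + conjugation u) := rfl

theorem realPart_of_mem (v : V) : realPart v = v := by
  apply Subtype.ext
  have h : conjugation (v : Hilb) = v := v.2
  rw [coe_realPart, h, ← two_smul ℝ (v : Hilb), smul_smul]
  norm_num

theorem realPart_I_smul_of_mem (v : V) : realPart (Complex.I • (v : Hilb)) = 0 := by
  apply Subtype.ext
  have h : conjugation (v : Hilb) = v := v.2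
  rw [coe_realPart, map_smulₛₗ, h]
  simp

/-- The imaginary part `Im u = Re (-i u)`. -/
def imagPart : Hilb →L[ℝ] V :=
  realPart ∘L ((-Complex.I) • ContinuousLinearMap.id ℂ Hilb).restrictScalars ℝ

theorem imagPart_apply (u : Hilb) : imagPart u = realPart (-Complex.I • u) := rfl

theorem realPart_add_imagPart (u : Hilb) :
    (realPart u : Hilb) + Complex.I • (imagPart u : Hilb) = u := by
  rw [imagPart_apply, coe_realPart, coe_realPart, map_smulₛₗ, ← Complex.coe_smul,
    ← Complex.coe_smul]
  simp only [map_neg, Complex.conj_I, neg_neg, smul_add, smul_smul]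
  have h : Complex.I * ((1 / 2 : ℝ) * -Complex.I) = ((1 / 2 : ℝ) : ℂ) := by
    linear_combination (-(1 / 2 : ℝ) : ℂ) * Complex.I_mul_I
  have h' : Complex.I * ((1 / 2 : ℝ) * Complex.I) = -((1 / 2 : ℝ) : ℂ) := by
    linear_combination ((1 / 2 : ℝ) : ℂ) * Complex.I_mul_I
  have h2 : ((1 / 2 : ℝ) : ℂ) + ((1 / 2 : ℝ) : ℂ) = 1 := by push_cast; norm_num
  rw [h, h', neg_smul, add_add_add_comm, add_neg_cancel, add_zero, ← add_smul, h2, one_smul]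

theorem realPart_I_smul (u : Hilb) : realPart (Complex.I • u) = -imagPart u := by
  rw [imagPart_apply, neg_smul, map_neg, neg_neg]

theorem imagPart_I_smul (u : Hilb) : imagPart (Complex.I • u) = realPart u := by
  rw [imagPart_apply, smul_smul]
  simp

/-- The complex linear extension of an operator on `𝓥`, as a function. -/
def complexifyFun (a : V →L[ℝ] V) (u : Hilb) : Hilb :=
  (a (realPart u) : Hilb) + Complex.I • (a (imagPart u) : Hilb)

theorem complexifyFun_I_smul (a : V →L[ℝ] V) (u : Hilb) :
    complexifyFun a (Complex.I • u) = Complex.I • complexifyFun a u := by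
  rw [complexifyFun, complexifyFun, realPart_I_smul, imagPart_I_smul, map_neg, smul_add,
    smul_smul, Complex.I_mul_I]
  simp [add_comm]

theorem complexifyFun_add (a : V →L[ℝ] V) (u v : Hilb) :
    complexifyFun a (u + v) = complexifyFun a u + complexifyFun a v := by
  simp only [complexifyFun, map_add, Submodule.coe_add, smul_add]
  abel

theorem complexifyFun_real_smul (a : V →L[ℝ] V) (c : ℝ) (u : Hilb) :
    complexifyFun a (c • u) = c • complexifyFun a u := by
  simp only [complexifyFun, map_smul, Submodule.coe_smul, smul_add]
  rw [smul_comm]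

/-- The complex linear extension to `𝓗` of a bounded real linear operator `a` on `𝓥`:
`u + i v ↦ a u + i a v` for `u, v ∈ 𝓥`. -/
def complexifyCLM (a : V →L[ℝ] V) : Hilb →L[ℂ] Hilb where
  toFun := complexifyFun a
  map_add' := complexifyFun_add a
  map_smul' c u := by
    have h : c • u = c.re • u + c.im • (Complex.I • u) := by
      rw [← Complex.coe_smul, ← Complex.coe_smul, smul_smul, ← add_smul, Complex.re_add_im]
    rw [h, complexifyFun_add, complexifyFun_real_smul, complexifyFun_real_smul,
      complexifyFun_I_smul, RingHom.id_apply, ← Complex.coe_smul, ← Complex.coe_smul, smul_smul,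
      ← add_smul, Complex.re_add_im]
  cont := by
    have h1 : Continuous fun u => (a (realPart u) : Hilb) :=
      continuous_subtype_val.comp (a.continuous.comp realPart.continuous)
    have h2 : Continuous fun u => (a (imagPart u) : Hilb) :=
      continuous_subtype_val.comp (a.continuous.comp imagPart.continuous)
    exact h1.add (h2.const_smul Complex.I)

theorem complexifyCLM_apply (a : V →L[ℝ] V) (u : Hilb) :
    complexifyCLM a u = (a (realPart u) : Hilb) + Complex.I • (a (imagPart u) : Hilb) := rfl

@[simp] theorem complexifyCLM_coe (a : V →L[ℝ] V) (v : V) : complexifyCLM a v = a v := by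
  have h : imagPart (v : Hilb) = 0 := by
    rw [imagPart_apply, neg_smul, map_neg, realPart_I_smul_of_mem, neg_zero]
  rw [complexifyCLM_apply, realPart_of_mem, h]
  simp

/-- Complexification as a homomorphism of monoids. -/
def complexify : (V →L[ℝ] V) →* (Hilb →L[ℂ] Hilb) where
  toFun := complexifyCLM
  map_one' := by
    ext1 u
    exact realPart_add_imagPart u
  map_mul' a b := by
    ext1 u
    change _ = complexifyCLM a (complexifyCLM b u)
    rw [complexifyCLM_apply b u, map_add, map_smul, complexifyCLM_coe, complexifyCLM_coe]
    rfl

/-- The symplectic group `Sp(𝓥, Ω)`, in the group `GL(𝓥)` of bounded invertible real linear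
operators. -/
def Sp : Subgroup (V →L[ℝ] V)ˣ where
  carrier := {a | ∀ u v : V, Omega (a.1 u : V) (a.1 v : V) = Omega u v}
  mul_mem' {a b} ha hb u v := (ha _ _).trans (hb u v)
  one_mem' u v := rfl
  inv_mem' {a} ha u v := by
    have h : ∀ w : V, a.1 (a⁻¹.1 w) = w := fun w => by
      change (a.1 * a⁻¹.1) w = w
      rw [Units.mul_inv]; rfl
    rw [← ha, h, h]

/-- The operator `d = i (p₊ - p₋)`, with `p₊`, `p₋` the orthogonal projections onto `𝓗₊`, `𝓗₋`. -/
def dOp : Hilb →L[ℂ] Hilb := Complex.I • (Hplus.starProjection - Hminus.starProjection)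

/-- The restricted general linear group `GL_res(𝓗, 𝓗₊)`: the bounded invertible operators `g` with
`[d, g]` Hilbert-Schmidt. -/
def GLres : Subgroup (Hilb →L[ℂ] Hilb)ˣ where
  carrier := {g | IsHilbertSchmidt (⁅dOp, g.1⁆ : Hilb →L[ℂ] Hilb)}
  mul_mem' {a b} ha hb := by
    have h : (⁅dOp, a.1 * b.1⁆ : Hilb →L[ℂ] Hilb) = ⁅dOp, a.1⁆ ∘L b.1 + a.1 ∘L ⁅dOp, b.1⁆ := by
      change _ = ⁅dOp, a.1⁆ * b.1 + a.1 * ⁅dOp, b.1⁆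
      simp only [Ring.lie_def]
      noncomm_ring
    change IsHilbertSchmidt (⁅dOp, a.1 * b.1⁆ : Hilb →L[ℂ] Hilb)
    rw [h]
    exact (hilbertSchmidtSubmodule Hilb Hilb).add_mem (ha.comp_right _) (hb.comp_left _)
  one_mem' := by
    have h : (⁅dOp, (1 : (Hilb →L[ℂ] Hilb)ˣ).1⁆ : Hilb →L[ℂ] Hilb) = 0 := by
      simp [Ring.lie_def]
    change IsHilbertSchmidt _
    rw [h]
    exact (hilbertSchmidtSubmodule Hilb Hilb).zero_mem
  inv_mem' {a} ha := by
    have h : (⁅dOp, a⁻¹.1⁆ : Hilb →L[ℂ] Hilb) = (-a⁻¹.1) ∘L (⁅dOp, a.1⁆ ∘L a⁻¹.1) := by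
      change _ = (-a⁻¹.1) * (⁅dOp, a.1⁆ * a⁻¹.1)
      simp only [Ring.lie_def, sub_mul, mul_sub, neg_mul, mul_assoc, Units.mul_inv, mul_one]
      rw [← mul_assoc a⁻¹.1 a.1, Units.inv_mul, one_mul]
      abel
    change IsHilbertSchmidt _
    rw [h]
    exact (ha.comp_right _).comp_left _

/-- The restricted symplectic group as a subgroup of `GL(𝓥)`: the symplectic operators whose complex
linear extension lies in `GL_res(𝓗, 𝓗₊)`. -/
def spResSubgroup : Subgroup (V →L[ℝ] V)ˣ := Sp ⊓ GLres.comap (Units.map complexify)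

/-- The restricted symplectic group `Sp_res(𝓥, Ω)`. It is a type of its own because it gets the
topology of `GL_res(𝓗, 𝓗₊)`, not the one of the operator norm. -/
def SpRes : Type := spResSubgroup

namespace SpRes

instance : Group SpRes := inferInstanceAs (Group spResSubgroup)

/-- The complex linear extension to `𝓗` of an element of `Sp_res(𝓥, Ω)`. -/
def op (a : SpRes) : Hilb →L[ℂ] Hilb := complexify a.1.1

theorem isHilbertSchmidt_lie (a : SpRes) : IsHilbertSchmidt (⁅dOp, a.op⁆ : Hilb →L[ℂ] Hilb) :=
  a.2.2

/-- The block `g : 𝓗₊ → 𝓗₊` of `a`. -/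
def g (a : SpRes) : Hplus →L[ℂ] Hplus :=
  Hplus.orthogonalProjectionOnto ∘L a.op ∘L Hplus.subtypeL

/-- The block `h : 𝓗₋ → 𝓗₊` of `a`. -/
def h (a : SpRes) : Hminus →L[ℂ] Hplus :=
  Hplus.orthogonalProjectionOnto ∘L a.op ∘L Hminus.subtypeL

/-- The inclusion `a ↦ (a, [d, a])` of `Sp_res(𝓥, Ω)` into the Banach space
`B(𝓗) × L²(𝓗)`. The norm `‖a‖ + ‖[d, a]‖₂` defines the topology of `GL_res(𝓗, 𝓗₊)`. -/
def incl (a : SpRes) : (Hilb →L[ℂ] Hilb) × HS Hilb Hilb := (a.op, HS.mk _ a.isHilbertSchmidt_lie)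

instance : TopologicalSpace SpRes := TopologicalSpace.induced incl inferInstance

end SpRes

theorem inner_eq_zero_of_mem {u v : Hilb} (hu : u ∈ Hplus) (hv : v ∈ Hminus) : ⟪v, u⟫_ℂ = 0 := by
  rw [Hilb.inner_eq_tsum]
  convert tsum_zero with n
  rcases le_total n 0 with h | h
  · simp [hu n h]
  · simp [hv n h]

theorem exists_decomp (u : Hilb) : ∃ v ∈ Hplus, ∃ w ∈ Hminus, u = v + w := by
  have h : ∀ P : ℤ → Prop, [DecidablePred P] →
      ∃ v : Hilb, ∀ n, Hilb.coeff n v = if P n then Hilb.coeff n u else 0 := fun P _ => by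
    refine Hilb.exists_coeff _ (by simp) ?_
    refine Summable.of_nonneg_of_le (fun n => by positivity) (fun n => ?_) u.summable_coeff
    split_ifs
    · exact le_rfl
    · simp; positivity
  obtain ⟨v, hv⟩ := h (fun n => 0 < n)
  obtain ⟨w, hw⟩ := h (fun n => n < 0)
  refine ⟨v, fun n hn => by simp [hv, not_lt.2 hn], w, fun n hn => by simp [hw, not_lt.2 hn], ?_⟩
  refine Hilb.ext_coeff fun n => ?_
  rw [map_add, hv, hw]
  rcases lt_trichotomy n 0 with h | h | h
  · simp [h, not_lt.2 h.le]
  · simp [h]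
  · simp [h, not_lt.2 h.le]

theorem starProjection_plus {v w : Hilb} (hv : v ∈ Hplus) (hw : w ∈ Hminus) :
    Hplus.starProjection (v + w) = v :=
  Submodule.eq_starProjection_of_mem_of_inner_eq_zero hv fun x hx => by
    rw [add_sub_cancel_left]; exact inner_eq_zero_of_mem hx hw

theorem starProjection_minus {v w : Hilb} (hv : v ∈ Hplus) (hw : w ∈ Hminus) :
    Hminus.starProjection (v + w) = w :=
  Submodule.eq_starProjection_of_mem_of_inner_eq_zero hw fun x hx => by
    rw [add_sub_cancel_right]; exact inner_eq_zero_symm.1 (inner_eq_zero_of_mem hv hx)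

theorem dOp_eq_J : dOp = J := by
  ext1 u
  obtain ⟨v, hv, w, hw, rfl⟩ := exists_decomp u
  change Complex.I • (Hplus.starProjection (v + w) - Hminus.starProjection (v + w)) = _
  rw [starProjection_plus hv hw, starProjection_minus hv hw]
  refine Hilb.ext_coeff fun n => ?_
  rw [coeff_J, map_smul, map_sub, map_add]
  rcases lt_trichotomy n 0 with h | h | h
  · simp [Int.sign_eq_neg_one_of_neg h, hv n h.le]
  · simp [h]
  · simp [Int.sign_eq_one_of_pos h, hw n h.le]

theorem complexifyCLM_conjugation (a : V →L[ℝ] V) (u : Hilb) :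
    complexifyCLM a (conjugation u) = conjugation (complexifyCLM a u) := by
  have hr : realPart (conjugation u) = realPart u := by
    apply Subtype.ext
    rw [coe_realPart, coe_realPart, conjugation_conjugation, add_comm]
  have hi : imagPart (conjugation u) = -imagPart u := by
    apply Subtype.ext
    rw [imagPart_apply, imagPart_apply, Submodule.coe_neg, coe_realPart, coe_realPart,
      map_smulₛₗ, map_smulₛₗ, conjugation_conjugation]
    simp
  have h1 : ∀ v : V, conjugation (v : Hilb) = v := fun v => v.2
  rw [complexifyCLM_apply, complexifyCLM_apply, hr, hi, map_add, map_smulₛₗ, h1, h1]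
  simp

/-- The block decomposition of `a ∈ Sp_res` is `(g, h; h̄, ḡ)`. -/
theorem SpRes.op_add (a : SpRes) (u : Hplus) (w : Hminus) :
    a.op (u + w) = ((a.g u + a.h w : Hplus) : Hilb)
      + ((barMP a.h u + barPP a.g w : Hminus) : Hilb) := by
  have hp : ∀ x : Hilb, conjugation (Hplus.starProjection x)
      = Hminus.starProjection (conjugation x) := fun x => by
    obtain ⟨v, hv, w, hw, rfl⟩ := exists_decomp x
    rw [starProjection_plus hv hw, map_add, add_comm]
    exact (starProjection_minus (conjMinus ⟨w, hw⟩).2 (conjPlus ⟨v, hv⟩).2).symm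
  have hs : ∀ x : Hilb, Hplus.starProjection x + Hminus.starProjection x = x := fun x => by
    obtain ⟨v, hv, w, hw, rfl⟩ := exists_decomp x
    rw [starProjection_plus hv hw, starProjection_minus hv hw]
  have e1 : ((barMP a.h u : Hminus) : Hilb) = Hminus.starProjection (a.op u) := by
    change conjugation (Hplus.starProjection (a.op (conjugation u))) = _
    rw [hp, SpRes.op]
    change Hminus.starProjection (conjugation (complexifyCLM a.1.1 (conjugation u))) = _
    rw [complexifyCLM_conjugation, conjugation_conjugation]
    rfl
  have e2 : ((barPP a.g w : Hminus) : Hilb) = Hminus.starProjection (a.op w) := by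
    change conjugation (Hplus.starProjection (a.op (conjugation w))) = _
    rw [hp, SpRes.op]
    change Hminus.starProjection (conjugation (complexifyCLM a.1.1 (conjugation w))) = _
    rw [complexifyCLM_conjugation, conjugation_conjugation]
    rfl
  rw [Submodule.coe_add, Submodule.coe_add, e1, e2, map_add]
  conv_lhs => rw [← hs (a.op u), ← hs (a.op w)]
  change _ = (Hplus.starProjection (a.op u) + Hplus.starProjection (a.op w)) + _
  abel

theorem zero_mem_restrictedSiegelDisc : (0 : symHS) ∈ restrictedSiegelDisc := by
  refine ⟨fun u v => by simp [Omega], fun u hu => ?_⟩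
  have h : 0 < (⟪u, u⟫_ℂ).re := by
    have := norm_sq_eq_re_inner (𝕜 := ℂ) u
    rw [RCLike.re_eq_complex_re] at this
    rw [← this]
    positivity
  simpa only [Submodule.coe_zero, map_zero, zero_apply, sub_zero] using h

/-- The centre of the restricted Siegel disc. -/
def origin : restrictedSiegelDisc := ⟨0, zero_mem_restrictedSiegelDisc⟩

/-- The structure of homogeneous space of `Sp_res(𝓥, Ω) / K`, for a subgroup `K`:
* `Sp_res(𝓥, Ω)` is a Banach Lie group, as a smooth submanifold of `B(𝓗) × L²(𝓗)`;
* the quotient (with the quotient topology) is a smooth manifold such that the projection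
  `Sp_res(𝓥, Ω) → Sp_res(𝓥, Ω) / K` is a smooth submersion.
Each of the two smooth structures is determined by these properties. -/
structure IsHomogeneousSpace (K : Subgroup SpRes) (B E : Type)
    [NormedAddCommGroup B] [NormedSpace ℝ B] [NormedAddCommGroup E] [NormedSpace ℝ E]
    [ChartedSpace B SpRes] [ChartedSpace E (SpRes ⧸ K)] : Prop where
  isManifold : IsManifold 𝓘(ℝ, B) ∞ SpRes
  isSmoothEmbedding : Manifold.IsSmoothEmbedding 𝓘(ℝ, B)
    𝓘(ℝ, (Hilb →L[ℂ] Hilb) × HS Hilb Hilb) ∞ SpRes.incl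
  lieGroup : LieGroup 𝓘(ℝ, B) ∞ SpRes
  isManifold_quotient : IsManifold 𝓘(ℝ, E) ∞ (SpRes ⧸ K)
  isSubmersion : Manifold.IsSubmersion 𝓘(ℝ, B) 𝓘(ℝ, E) ∞ (QuotientGroup.mk : SpRes → SpRes ⧸ K)

end SobolevSpace

end SiegelDisc

end

open SiegelDisc
open scoped Manifold ContDiff

/-! An operator `Z` is studied through its graph `{Z u + u}` in `𝓗`. Complexified group elements are
invertible operators `a` that commute with conjugation and satisfy `a* d a = d`, with `[d, a]`
Hilbert-Schmidt. They preserve a bilinear form proportional to `Ω`, for which the graph of `Z` is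
isotropic exactly when `Z` is symmetric, and also the form `‖p₋ x‖² - ‖p₊ x‖²`, which is positive on
graphs of strict contractions. Symmetry gives `Z̄ = Z*`, and Hilbert-Schmidt operators are compact,
so the pointwise condition `I - Z Z̄ > 0` amounts to `‖Z‖ < 1` (`mem_restrictedSiegelDisc_iff`); the
disc is therefore open. The invariant Hermitian form bounds `h̄ Z + ḡ` and its adjoint from below
(`SpRes.isUnit_den`), so `a` carries the graph of `Z` onto the graph of the Moebius transform. The
axioms of an action hold because a graph determines its operator.

Transitivity is explicit. For `X = (0, Z; Z*, 0)` the operator `T_Z = (1 + X)(1 - X²)^(-1/2)` lies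
in the group and takes `0` to `Z`; the square root is a power series, so `T_Z` depends smoothly on
`Z`. This is a global smooth section of the orbit map. The stabilizer of `0` consists of the
elements with `h = 0`, that is of the block diagonal operators with unitary `g`.

For the Lie group structure, `a ↦ (a, [d, a])` is multiplicative into the Banach algebra `B(𝓗) ⊕
L²(𝓗)`, a trivial square-zero extension, by the Leibniz rule. The Cayley transform turns the
quadratic equation `a* d a = d` into the linear equation `x* d + d x = 0`, so left translates of the
Cayley transform straighten the group onto a complemented real linear subspace. `CayleyModel`
derives the charts, the smooth embedding and the Lie group axioms from this.

The section identifies the quotient with the disc topologically, and the quotient receives the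
resulting single chart. The decomposition `a = T_{a·0} k`, with `k` unitary, combined with Cayley
charts of the unitary group, gives charts in which the projection is `(Z, Y) ↦ Z`; hence it is a
submersion. For an arbitrary structure with the stated properties, the orbit map is smooth because
submersions have smooth local sections, and its inverse is smooth because it is `Z ↦ [T_Z]`. -/

noncomputable section

namespace SiegelDisc

open scoped ENNReal ComplexConjugate InnerProductSpace Manifold ContDiff Topology
open Topology

/-! ### The Cayley transform in a Banach algebra -/

section Cayley

variable {𝔸 : Type} [NormedRing 𝔸] [NormedAlgebra ℝ 𝔸]

/-- The Cayley transform `(x - 1) (1 + x)⁻¹`. -/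
def cayleyFun (x : 𝔸) : 𝔸 := (x - 1) * Ring.inverse (1 + x)

/-- The inverse Cayley transform `(1 + x) (1 - x)⁻¹`. -/
def cayleyInvFun (x : 𝔸) : 𝔸 := (1 + x) * Ring.inverse (1 - x)

theorem isUnit_two' : IsUnit (2 : 𝔸) := by
  have h := (isUnit_iff_ne_zero.2 (two_ne_zero (α := ℝ))).map (algebraMap ℝ 𝔸)
  rwa [map_ofNat] at h

/-- Over the denominator `1 + x` the numerator is `(1 + x) - (x - 1) = 2`. As 2 is invertible, the
transform lands in the domain of the inverse transform; the next three identities play the same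
role. -/
theorem one_sub_cayleyFun {x : 𝔸} (hx : IsUnit (1 + x)) :
    1 - cayleyFun x = 2 * Ring.inverse (1 + x) := by
  have h := Ring.mul_inverse_cancel _ hx
  rw [cayleyFun]
  nth_rw 1 [← h]
  rw [← sub_mul]
  congr 1
  rw [← one_add_one_eq_two]
  abel

theorem one_add_cayleyFun {x : 𝔸} (hx : IsUnit (1 + x)) :
    1 + cayleyFun x = 2 * x * Ring.inverse (1 + x) := by
  have h := Ring.mul_inverse_cancel _ hx
  rw [cayleyFun]
  nth_rw 1 [← h]
  rw [← add_mul]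
  congr 1
  rw [two_mul]
  abel

theorem one_add_cayleyInvFun {x : 𝔸} (hx : IsUnit (1 - x)) :
    1 + cayleyInvFun x = 2 * Ring.inverse (1 - x) := by
  have h := Ring.mul_inverse_cancel _ hx
  rw [cayleyInvFun]
  nth_rw 1 [← h]
  rw [← add_mul]
  congr 1
  rw [← one_add_one_eq_two]
  abel

theorem cayleyInvFun_sub_one {x : 𝔸} (hx : IsUnit (1 - x)) :
    cayleyInvFun x - 1 = 2 * x * Ring.inverse (1 - x) := by
  have h : 2 * x * Ring.inverse (1 - x) + (1 - x) * Ring.inverse (1 - x)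
      = (1 + x) * Ring.inverse (1 - x) := by
    rw [← add_mul]
    congr 1
    rw [two_mul]
    abel
  rw [cayleyInvFun, sub_eq_iff_eq_add, ← h, Ring.mul_inverse_cancel _ hx]

theorem isUnit_one_sub_cayleyFun {x : 𝔸} (hx : IsUnit (1 + x)) : IsUnit (1 - cayleyFun x) := by
  rw [one_sub_cayleyFun hx]
  exact isUnit_two'.mul hx.ringInverse

theorem isUnit_one_add_cayleyInvFun {x : 𝔸} (hx : IsUnit (1 - x)) :
    IsUnit (1 + cayleyInvFun x) := by
  rw [one_add_cayleyInvFun hx]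
  exact isUnit_two'.mul hx.ringInverse

theorem cayleyInvFun_cayleyFun {x : 𝔸} (hx : IsUnit (1 + x)) :
    cayleyInvFun (cayleyFun x) = x := by
  have hu := isUnit_one_sub_cayleyFun hx
  apply hu.mul_right_cancel
  rw [cayleyInvFun, mul_assoc, Ring.inverse_mul_cancel _ hu, mul_one, one_add_cayleyFun hx,
    one_sub_cayleyFun hx, ← mul_assoc, two_mul, mul_two]

theorem cayleyFun_cayleyInvFun {x : 𝔸} (hx : IsUnit (1 - x)) :
    cayleyFun (cayleyInvFun x) = x := by
  have hu := isUnit_one_add_cayleyInvFun hx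
  apply hu.mul_right_cancel
  rw [cayleyFun, mul_assoc, Ring.inverse_mul_cancel _ hu, mul_one, cayleyInvFun_sub_one hx,
    one_add_cayleyInvFun hx, ← mul_assoc, two_mul, mul_two]

variable [CompleteSpace 𝔸]

theorem contDiffAt_inverse {x : 𝔸} (hx : IsUnit x) : ContDiffAt ℝ ∞ Ring.inverse x := by
  obtain ⟨u, rfl⟩ := hx
  exact contDiffAt_ringInverse ℝ u

theorem contDiffAt_cayleyFun {x : 𝔸} (hx : IsUnit (1 + x)) : ContDiffAt ℝ ∞ cayleyFun x :=
  (contDiffAt_id.sub contDiffAt_const).mul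
    (ContDiffAt.comp x (contDiffAt_inverse hx) (contDiffAt_const.add contDiffAt_id))

theorem contDiffAt_cayleyInvFun {x : 𝔸} (hx : IsUnit (1 - x)) : ContDiffAt ℝ ∞ cayleyInvFun x :=
  (contDiffAt_const.add contDiffAt_id).mul
    (ContDiffAt.comp x (contDiffAt_inverse hx) (contDiffAt_const.sub contDiffAt_id))

theorem isOpen_isUnit : IsOpen {x : 𝔸 | IsUnit x} := Units.isOpen

/-- The Cayley transform after left translation by `b⁻¹`, where `b' = b⁻¹`. -/
def cayleyChart (b b' : 𝔸) (h : b * b' = 1) (h' : b' * b = 1) : OpenPartialHomeomorph 𝔸 𝔸 where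
  toFun x := cayleyFun (b' * x)
  invFun x := b * cayleyInvFun x
  source := {x | IsUnit (1 + b' * x)}
  target := {x | IsUnit (1 - x)}
  map_source' _ hx := isUnit_one_sub_cayleyFun hx
  map_target' x hx := by
    change IsUnit (1 + b' * (b * cayleyInvFun x))
    rw [← mul_assoc, h', one_mul]
    exact isUnit_one_add_cayleyInvFun hx
  left_inv' x hx := by
    rw [cayleyInvFun_cayleyFun hx, ← mul_assoc, h, one_mul]
  right_inv' x hx := by
    rw [← mul_assoc b', h', one_mul, cayleyFun_cayleyInvFun hx]
  open_source := isOpen_isUnit.preimage (by fun_prop : Continuous fun x : 𝔸 => 1 + b' * x)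
  open_target := isOpen_isUnit.preimage (by fun_prop : Continuous fun x : 𝔸 => 1 - x)
  continuousOn_toFun x hx := by
    have h1 : ContinuousAt cayleyFun (b' * x) := (contDiffAt_cayleyFun hx).continuousAt
    exact (h1.comp (by fun_prop : ContinuousAt (fun x => b' * x) x)).continuousWithinAt
  continuousOn_invFun x hx :=
    (continuousAt_const.mul (contDiffAt_cayleyInvFun hx).continuousAt).continuousWithinAt

theorem mem_maximalAtlas_of_contDiffOn {E : Type*} [NormedAddCommGroup E] [NormedSpace ℝ E]
    (φ : OpenPartialHomeomorph E E) (h : ContDiffOn ℝ ∞ φ φ.source)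
    (h' : ContDiffOn ℝ ∞ φ.symm φ.target) : φ ∈ IsManifold.maximalAtlas 𝓘(ℝ, E) ∞ E :=
  φ.mem_maximalAtlas_of_contMDiffOn h.contMDiffOn h'.contMDiffOn

end Cayley

/-! ### Lie groups straightened by the Cayley transform -/

/-- A topological group embedded in a normed algebra in such a way that the Cayley transform maps it
onto a complemented linear subspace `lie.range`. -/
structure CayleyModel (G 𝔸 B : Type) [Group G] [TopologicalSpace G] [NormedRing 𝔸]
    [NormedAlgebra ℝ 𝔸] [NormedAddCommGroup B] [NormedSpace ℝ B] where
  toHom : G →* 𝔸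
  isEmbedding : IsEmbedding toHom
  lie : B →L[ℝ] 𝔸
  proj : 𝔸 →L[ℝ] B
  proj_lie : ∀ x, proj (lie x) = x
  cayley_mem : ∀ g, IsUnit (1 + toHom g) → lie (proj (cayleyFun (toHom g))) = cayleyFun (toHom g)
  cayleyInv_mem : ∀ x, IsUnit (1 - lie x) → ∃ g, toHom g = cayleyInvFun (lie x)

namespace CayleyModel

variable {G 𝔸 B : Type} [Group G] [TopologicalSpace G] [NormedRing 𝔸] [NormedAlgebra ℝ 𝔸]
  [CompleteSpace 𝔸] [NormedAddCommGroup B] [NormedSpace ℝ B] (D : CayleyModel G 𝔸 B)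

theorem isUnit_toHom (g : G) : IsUnit (D.toHom g) := (Group.isUnit g).map D.toHom

theorem toHom_inv (g : G) : D.toHom g⁻¹ = Ring.inverse (D.toHom g) := by
  apply (D.isUnit_toHom g).mul_left_cancel
  rw [Ring.mul_inverse_cancel _ (D.isUnit_toHom g), ← map_mul, mul_inv_cancel, map_one]

theorem isTopologicalGroup (D : CayleyModel G 𝔸 B) : IsTopologicalGroup G where
  continuous_mul := by
    rw [D.isEmbedding.continuous_iff]
    have : (D.toHom ∘ fun p : G × G => p.1 * p.2) = fun p => D.toHom p.1 * D.toHom p.2 := by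
      ext p; simp
    rw [this]
    exact (D.isEmbedding.continuous.comp continuous_fst).mul
      (D.isEmbedding.continuous.comp continuous_snd)
  continuous_inv := by
    rw [D.isEmbedding.continuous_iff]
    have : (D.toHom ∘ fun g : G => g⁻¹) = fun g => Ring.inverse (D.toHom g) := by
      ext g; exact D.toHom_inv g
    rw [this, continuous_iff_continuousAt]
    intro g
    have h1 : ContinuousAt Ring.inverse (D.toHom g) :=
      (contDiffAt_inverse (D.isUnit_toHom g)).continuousAt
    exact h1.comp D.isEmbedding.continuous.continuousAt

/-- A right inverse of `cayleyFun ∘ toHom`. -/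
def lift (x : B) : G := open scoped Classical in
  if h : IsUnit (1 - D.lie x) then (D.cayleyInv_mem x h).choose else 1

theorem toHom_lift {x : B} (h : IsUnit (1 - D.lie x)) :
    D.toHom (D.lift x) = cayleyInvFun (D.lie x) := by
  rw [lift, dif_pos h]
  exact (D.cayleyInv_mem x h).choose_spec

/-- The Cayley chart around `b`. -/
def chart (b : G) : OpenPartialHomeomorph G B where
  toFun g := D.proj (cayleyFun (D.toHom (b⁻¹ * g)))
  invFun x := b * D.lift x
  source := {g | IsUnit (1 + D.toHom (b⁻¹ * g))}
  target := {x | IsUnit (1 - D.lie x)}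
  map_source' g hg := by
    change IsUnit (1 - D.lie (D.proj _))
    rw [D.cayley_mem _ hg]
    exact isUnit_one_sub_cayleyFun hg
  map_target' x hx := by
    change IsUnit (1 + D.toHom (b⁻¹ * (b * D.lift x)))
    rw [inv_mul_cancel_left, D.toHom_lift hx]
    exact isUnit_one_add_cayleyInvFun hx
  left_inv' g hg := by
    have h : IsUnit (1 - D.lie (D.proj (cayleyFun (D.toHom (b⁻¹ * g))))) := by
      rw [D.cayley_mem _ hg]
      exact isUnit_one_sub_cayleyFun hg
    apply D.isEmbedding.injective
    rw [map_mul, D.toHom_lift h, D.cayley_mem _ hg, cayleyInvFun_cayleyFun hg, ← map_mul,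
      mul_inv_cancel_left]
  right_inv' x hx := by
    rw [inv_mul_cancel_left, D.toHom_lift hx, cayleyFun_cayleyInvFun hx, D.proj_lie]
  open_source := by
    have := D.isTopologicalGroup
    exact isOpen_isUnit.preimage (continuous_const.add
      (D.isEmbedding.continuous.comp (continuous_const_mul b⁻¹)))
  open_target := isOpen_isUnit.preimage (continuous_const.sub D.lie.continuous)
  continuousOn_toFun g hg := by
    have := D.isTopologicalGroup
    have h1 : ContinuousAt cayleyFun (D.toHom (b⁻¹ * g)) := (contDiffAt_cayleyFun hg).continuousAt
    have h2 : ContinuousAt (fun g => D.toHom (b⁻¹ * g)) g :=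
      (D.isEmbedding.continuous.comp (continuous_const_mul b⁻¹)).continuousAt
    exact (D.proj.continuous.continuousAt.comp
      (ContinuousAt.comp (f := fun g => D.toHom (b⁻¹ * g)) h1 h2)).continuousWithinAt
  continuousOn_invFun := by
    have := D.isTopologicalGroup
    refine continuousOn_const.mul ?_
    rw [D.isEmbedding.isInducing.continuousOn_iff]
    have h : ContinuousOn (fun x => cayleyInvFun (D.lie x)) {x | IsUnit (1 - D.lie x)} :=
      fun x hx => by
        have h1 : ContinuousAt cayleyInvFun (D.lie x) := (contDiffAt_cayleyInvFun hx).continuousAt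
        exact (h1.comp D.lie.continuous.continuousAt).continuousWithinAt
    exact h.congr fun x hx => D.toHom_lift hx

theorem mem_chart_source (b : G) : b ∈ (D.chart b).source := by
  change IsUnit (1 + D.toHom (b⁻¹ * b))
  rw [inv_mul_cancel, map_one, one_add_one_eq_two]
  exact isUnit_two'

/-- The smooth structure defined by the Cayley charts. -/
@[reducible] def chartedSpace : ChartedSpace B G where
  atlas := Set.range D.chart
  chartAt := D.chart
  mem_chart_source := D.mem_chart_source
  chart_mem_atlas b := ⟨b, rfl⟩

theorem contDiffOn_lift (b : G) :
    ContDiffOn ℝ ∞ (fun x => D.toHom (b * D.lift x)) {x | IsUnit (1 - D.lie x)} := by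
  have h : ContDiffOn ℝ ∞ (fun x => D.toHom b * cayleyInvFun (D.lie x))
      {x | IsUnit (1 - D.lie x)} := fun x hx => by
    have h1 := (contDiffAt_cayleyInvFun hx).comp x D.lie.contDiff.contDiffAt
    exact (contDiffAt_const.mul h1).contDiffWithinAt
  exact h.congr fun x hx => by rw [map_mul, D.toHom_lift hx]

/-- A change of charts is `x ↦ proj (cayleyFun (c⁻¹ b · cayleyInvFun (lie x)))`, computed entirely
in the algebra, where inversion is smooth at units. -/
theorem isManifold : @IsManifold ℝ _ B _ _ B _ 𝓘(ℝ, B) ∞ G _ D.chartedSpace := by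
  let _ := D.chartedSpace
  apply isManifold_of_contDiffOn
  rintro _ _ ⟨b, rfl⟩ ⟨c, rfl⟩
  intro x hx
  have hx1 : IsUnit (1 - D.lie x) := hx.1.1
  have hx2 : IsUnit (1 + D.toHom (c⁻¹ * (b * D.lift x))) := hx.1.2
  have h1 : ContDiffAt ℝ ∞ (fun x => D.toHom (c⁻¹ * (b * D.lift x))) x := by
    simp_rw [← mul_assoc]
    exact (D.contDiffOn_lift (c⁻¹ * b)).contDiffAt
      ((isOpen_isUnit.preimage (continuous_const.sub D.lie.continuous)).mem_nhds hx1)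
  have h2 := (contDiffAt_cayleyFun hx2).comp x h1
  exact (D.proj.contDiff.contDiffAt.comp x h2).contDiffWithinAt

variable {E : Type} [NormedAddCommGroup E] [NormedSpace ℝ E] (e : 𝔸 ≃L[ℝ] E)

/-- The ambient Cayley chart around `b`. -/
def ambientChart (b : G) : OpenPartialHomeomorph E E :=
  (e.symm.toHomeomorph.toOpenPartialHomeomorph.trans
    (cayleyChart (D.toHom b) (D.toHom b⁻¹) (by rw [← map_mul, mul_inv_cancel, map_one])
      (by rw [← map_mul, inv_mul_cancel, map_one]))).trans
    e.toHomeomorph.toOpenPartialHomeomorph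

theorem mem_ambientChart_source {b : G} {x : E} :
    x ∈ (D.ambientChart e b).source ↔ IsUnit (1 + D.toHom b⁻¹ * e.symm x) := by
  simp [ambientChart, cayleyChart]

theorem mem_ambientChart_target {b : G} {x : E} :
    x ∈ (D.ambientChart e b).target ↔ IsUnit (1 - e.symm x) := by
  simp [ambientChart, cayleyChart]

theorem ambientChart_apply (b : G) (x : E) :
    D.ambientChart e b x = e (cayleyFun (D.toHom b⁻¹ * e.symm x)) := rfl

theorem ambientChart_mem_maximalAtlas (b : G) :
    D.ambientChart e b ∈ IsManifold.maximalAtlas 𝓘(ℝ, E) ∞ E := by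
  apply mem_maximalAtlas_of_contDiffOn
  · intro x hx
    rw [mem_ambientChart_source] at hx
    have h1 : ContDiffAt ℝ ∞ (fun x => D.toHom b⁻¹ * e.symm x) x :=
      contDiffAt_const.mul e.symm.contDiff.contDiffAt
    exact (e.contDiff.contDiffAt.comp x ((contDiffAt_cayleyFun hx).comp x h1)).contDiffWithinAt
  · intro x hx
    rw [mem_ambientChart_target] at hx
    have h1 := (contDiffAt_cayleyInvFun hx).comp x e.symm.contDiff.contDiffAt
    exact (e.contDiff.contDiffAt.comp x
      (contDiffAt_const (c := D.toHom b) |>.mul h1)).contDiffWithinAt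

/-- The splitting of the ambient space given by the projection onto `lie.range`. -/
def splitting : (B × D.proj.ker) ≃L[ℝ] E :=
  (ContinuousLinearEquiv.equivOfInverse
    ((D.lie.comp (ContinuousLinearMap.fst ℝ B D.proj.ker)) +
      (D.proj.ker.subtypeL.comp (ContinuousLinearMap.snd ℝ B D.proj.ker)))
    (D.proj.prod ((ContinuousLinearMap.id ℝ 𝔸 - D.lie.comp D.proj).codRestrict D.proj.ker
      fun x => by simp [D.proj_lie]))
    (fun x => by
      have h : D.proj (x.2 : 𝔸) = 0 := x.2.2
      ext <;> simp [D.proj_lie, h])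
    (fun x => by simp)).trans e

theorem splitting_apply_zero (x : B) : D.splitting e (x, 0) = e (D.lie x) := by
  simp [splitting]

/-- The ambient chart at `b` restricts on `G` to the chart at `b` followed by `lie`, whose range is
complemented by the kernel of `proj`. In these two charts the inclusion is `x ↦ (x, 0)`. The
equivalence `e` allows the ambient space to be a Banach space carrying no product. -/
theorem isSmoothEmbedding (i : G → E) (hi : ∀ g, i g = e (D.toHom g)) :
    @Manifold.IsSmoothEmbedding ℝ _ B E _ _ _ _ B E _ _ 𝓘(ℝ, B) 𝓘(ℝ, E) G E _ D.chartedSpace _ _ ∞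
      i := by
  let _ := D.chartedSpace
  have := D.isManifold
  obtain rfl : i = e ∘ D.toHom := funext hi
  have hemb : IsEmbedding (e ∘ D.toHom) :=
    e.toHomeomorph.isEmbedding.comp D.isEmbedding
  refine ⟨?_, hemb⟩
  have key : Manifold.IsImmersionOfComplement D.proj.ker 𝓘(ℝ, B) 𝓘(ℝ, E) ∞ (e ∘ D.toHom) := by
    intro b
    refine Manifold.IsImmersionAtOfComplement.mk_of_continuousAt hemb.continuous.continuousAt
      (D.splitting e) (D.chart b) (D.ambientChart e b) (D.mem_chart_source b) ?_
      (IsManifold.subset_maximalAtlas ⟨b, rfl⟩) (D.ambientChart_mem_maximalAtlas e b) ?_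
    · rw [mem_ambientChart_source, Function.comp_apply, ContinuousLinearEquiv.symm_apply_apply,
        ← map_mul]
      exact D.mem_chart_source b
    · intro x hx
      have hx' : IsUnit (1 - D.lie x) := (by simpa using hx : x ∈ (D.chart b).target)
      change D.ambientChart e b (e (D.toHom (b * D.lift x))) = D.splitting e (x, 0)
      rw [splitting_apply_zero, ambientChart_apply, ContinuousLinearEquiv.symm_apply_apply,
        ← map_mul, inv_mul_cancel_left, D.toHom_lift hx', cayleyFun_cayleyInvFun hx']
  exact key.isImmersion

theorem contMDiff_toHom : @ContMDiff ℝ _ B _ _ B _ 𝓘(ℝ, B) G _ D.chartedSpace 𝔸 _ _ 𝔸 _ 𝓘(ℝ, 𝔸) 𝔸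
    _ _ ∞ D.toHom := by
  let _ := D.chartedSpace
  exact (D.isSmoothEmbedding (.refl ℝ 𝔸) D.toHom fun _ => rfl).contMDiff

/-- A continuous map into `G` is smooth as soon as its composite with the immersion is, and in the
algebra the product is bilinear and inversion is smooth at units. -/
theorem lieGroup : @LieGroup ℝ _ B _ B _ _ 𝓘(ℝ, B) ∞ G _ _ D.chartedSpace := by
  let _ := D.chartedSpace
  have := D.isManifold
  have := D.isTopologicalGroup
  have hι := D.contMDiff_toHom
  have himm := (D.isSmoothEmbedding (.refl ℝ 𝔸) D.toHom fun _ => rfl).isImmersion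
  exact
    { contMDiff_mul := by
        rw [ContMDiff.iff_comp_isImmersion himm]
        refine ⟨continuous_mul, ?_⟩
        have : (D.toHom ∘ fun p : G × G => p.1 * p.2) = fun p => D.toHom p.1 * D.toHom p.2 := by
          ext p; simp
        rw [this]
        have hm : ContDiff ℝ ∞ fun p : 𝔸 × 𝔸 => p.1 * p.2 := contDiff_fst.mul contDiff_snd
        exact hm.contMDiff.comp
          ((hι.comp contMDiff_fst).prodMk_space (hι.comp contMDiff_snd))
      contMDiff_inv := by
        rw [ContMDiff.iff_comp_isImmersion himm]
        refine ⟨continuous_inv, ?_⟩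
        have : (D.toHom ∘ fun g : G => g⁻¹) = fun g => Ring.inverse (D.toHom g) := by
          ext g; exact D.toHom_inv g
        rw [this]
        intro g
        exact (contDiffAt_inverse (D.isUnit_toHom g)).contMDiffAt.comp g (hι g) }

end CayleyModel

/-! ### Local sections of submersions -/

/-- A submersion has smooth local sections. -/
theorem exists_section_of_isSubmersionAt {M N F E E' : Type*} [NormedAddCommGroup E]
    [NormedSpace ℝ E] [NormedAddCommGroup E'] [NormedSpace ℝ E'] [NormedAddCommGroup F]
    [NormedSpace ℝ F] [TopologicalSpace M] [ChartedSpace E M] [TopologicalSpace N]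
    [ChartedSpace E' N] [IsManifold 𝓘(ℝ, E) ∞ M] [IsManifold 𝓘(ℝ, E') ∞ N] {p : M → N} {x : M}
    (h : Manifold.IsSubmersionAtOfComplement F 𝓘(ℝ, E) 𝓘(ℝ, E') ∞ p x) :
    ∃ σ : N → M, ContMDiffAt 𝓘(ℝ, E') 𝓘(ℝ, E) ∞ σ (p x) ∧ σ (p x) = x ∧
      ∀ᶠ y in 𝓝 (p x), p (σ y) = y := by
  have hw : ∀ z ∈ h.domChart.target, h.codChart (p (h.domChart.symm z)) = (h.equiv z).1 :=
    fun z hz => h.writtenInCharts (by simpa using hz)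
  have hx := h.mem_domChart_source
  have hp := h.mem_codChart_source
  have hx' : h.domChart x ∈ h.domChart.target := h.domChart.map_source hx
  -- In adapted charts `p` is a product projection; the section freezes the complementary coordinate
  -- at its value `v` at `x`.
  set v := (h.equiv (h.domChart x)).2 with hv
  have h0 : h.equiv.symm (h.codChart (p x), v) = h.domChart x := by
    have := hw _ hx'
    rw [h.domChart.left_inv hx] at this
    rw [this, hv]
    simp
  have hc : ContMDiffAt 𝓘(ℝ, E') 𝓘(ℝ, E') ∞ h.codChart (p x) :=
    contMDiffAt_of_mem_maximalAtlas h.codChart_mem_maximalAtlas hp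
  have hl : ContDiff ℝ ∞ fun z : E' => h.equiv.symm (z, v) :=
    h.equiv.symm.contDiff.comp (contDiff_id.prodMk contDiff_const)
  have hm : ContMDiffAt 𝓘(ℝ, E') 𝓘(ℝ, E) ∞ (fun y => h.equiv.symm (h.codChart y, v)) (p x) :=
    hl.contMDiff.contMDiffAt.comp (p x) hc
  refine ⟨fun y => h.domChart.symm (h.equiv.symm (h.codChart y, v)), ?_, ?_, ?_⟩
  · refine ContMDiffAt.comp (p x) (g := h.domChart.symm) (I' := 𝓘(ℝ, E)) ?_ hm
    refine contMDiffAt_symm_of_mem_maximalAtlas h.domChart_mem_maximalAtlas ?_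
    simpa only [h0] using hx'
  · simp only [h0, h.domChart.left_inv hx]
  · have h1 : ∀ᶠ y in 𝓝 (p x), h.equiv.symm (h.codChart y, v) ∈ h.domChart.target :=
      hm.continuousAt.eventually (h.domChart.open_target.mem_nhds (by simpa only [h0] using hx'))
    have h2 : ∀ᶠ y in 𝓝 (p x), y ∈ h.codChart.source := h.codChart.open_source.mem_nhds hp
    filter_upwards [h1, h2] with y hy1 hy2
    apply h.codChart.injOn (h.source_subset_preimage_source (h.domChart.map_target hy1)) hy2
    rw [hw _ hy1]
    simp

/-- Near `p x` one has `f = (f ∘ p) ∘ σ` for a smooth local section `σ`. -/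
theorem contMDiff_of_comp_isSubmersion {M N P E E' E'' : Type*} [NormedAddCommGroup E]
    [NormedSpace ℝ E] [NormedAddCommGroup E'] [NormedSpace ℝ E'] [NormedAddCommGroup E'']
    [NormedSpace ℝ E''] [TopologicalSpace M] [ChartedSpace E M] [TopologicalSpace N]
    [ChartedSpace E' N] [IsManifold 𝓘(ℝ, E) ∞ M] [IsManifold 𝓘(ℝ, E') ∞ N] [TopologicalSpace P]
    [ChartedSpace E'' P] {p : M → N} (hp : Manifold.IsSubmersion 𝓘(ℝ, E) 𝓘(ℝ, E') ∞ p)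
    (hs : Function.Surjective p) {f : N → P}
    (hf : ContMDiff 𝓘(ℝ, E) 𝓘(ℝ, E'') ∞ (f ∘ p)) : ContMDiff 𝓘(ℝ, E') 𝓘(ℝ, E'') ∞ f := by
  intro y
  obtain ⟨x, rfl⟩ := hs y
  obtain ⟨σ, h1, h2, h3⟩ :=
    exists_section_of_isSubmersionAt (hp.isSubmersionOfComplement_complement x)
  have h4 : ContMDiffAt 𝓘(ℝ, E') 𝓘(ℝ, E'') ∞ ((f ∘ p) ∘ σ) (p x) := (hf _).comp _ h1
  refine h4.congr_of_eventuallyEq ?_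
  filter_upwards [h3] with y hy
  simp [hy]

/-! ### The power series of the inverse square root -/

section InvSqrt

variable {𝔸 : Type} [NormedRing 𝔸] [NormedAlgebra ℝ 𝔸]

/-- The coefficients of the power series of `(1 + x)^(-1/2)`. -/
def invSqrtCoeff (n : ℕ) : ℝ := Ring.choose (-1 / 2 : ℝ) n

theorem summable_invSqrtCoeff {r : ℝ} (h0 : 0 ≤ r) (h1 : r < 1) :
    Summable fun n => ‖invSqrtCoeff n‖ * r ^ n := by
  lift r to NNReal using h0
  have h := binomialSeries_radius_ge_one (𝕂 := ℝ) (𝔸 := ℝ) (a := (-1 / 2 : ℝ))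
  have h2 : (r : ℝ≥0∞) < (binomialSeries ℝ (-1 / 2 : ℝ)).radius :=
    lt_of_lt_of_le (by exact_mod_cast h1) h
  have := (binomialSeries ℝ (-1 / 2 : ℝ)).summable_norm_mul_pow h2
  refine this.congr fun n => ?_
  rw [binomialSeries, FormalMultilinearSeries.ofScalars_norm]
  rfl

variable (𝔸) in
/-- The power series of `(1 + x)^(-1/2)`. -/
def invSqrtSeries : FormalMultilinearSeries ℝ 𝔸 𝔸 := .ofScalars 𝔸 invSqrtCoeff

theorem one_le_radius_invSqrtSeries : 1 ≤ (invSqrtSeries 𝔸).radius := by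
  refine ENNReal.le_of_forall_nnreal_lt fun r hr => ?_
  apply FormalMultilinearSeries.le_radius_of_summable
  have hr' : (r : ℝ) < 1 := by exact_mod_cast hr
  -- The constant term is split off, because `‖1‖` need not be 1 in `𝔸` and the bound on the norm of
  -- the `n`-th term holds for `n > 0` only.
  refine (summable_nat_add_iff 1).1 (Summable.of_nonneg_of_le (fun n => by positivity) (fun n => ?_)
    ((summable_nat_add_iff 1).2 (summable_invSqrtCoeff r.2 hr')))
  exact mul_le_mul_of_nonneg_right
    (FormalMultilinearSeries.ofScalars_norm_le 𝔸 invSqrtCoeff _ n.succ_pos) (by positivity)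

/-- `(1 + x)^(-1/2)` for `‖x‖ < 1`. -/
def invSqrt (x : 𝔸) : 𝔸 := ∑' n, invSqrtCoeff n • x ^ n

variable [CompleteSpace 𝔸]

theorem summable_norm_invSqrt {x : 𝔸} (hx : ‖x‖ < 1) :
    Summable fun n => ‖invSqrtCoeff n • x ^ n‖ := by
  refine (summable_nat_add_iff 1).1 ?_
  refine Summable.of_nonneg_of_le (fun n => norm_nonneg _) (fun n => ?_)
    ((summable_nat_add_iff 1).2 (summable_invSqrtCoeff (norm_nonneg x) hx))
  rw [norm_smul]
  exact mul_le_mul_of_nonneg_left (norm_pow_le' x n.succ_pos) (norm_nonneg _)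

/-- The Vandermonde identity, in the form of multiplicativity of binomial series, makes the
coefficients of the Cauchy square equal to `choose (-1) n = (-1)^n`. The square is thus the
geometric series of `-x`. -/
theorem invSqrt_mul_self {x : 𝔸} (hx : ‖x‖ < 1) : (1 + x) * (invSqrt x * invSqrt x) = 1 := by
  have hc : ∀ n, ∑ kl ∈ Finset.HasAntidiagonal.antidiagonal n, invSqrtCoeff kl.1 * invSqrtCoeff kl.2
      = (-1) ^ n := fun n => by
    have := congrArg (PowerSeries.coeff n)
      (PowerSeries.binomialSeries_add (A := ℝ) (-1 / 2 : ℝ) (-1 / 2 : ℝ))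
    rw [PowerSeries.coeff_mul] at this
    simp only [PowerSeries.binomialSeries_coeff] at this
    have h2 : (-1 / 2 + -1 / 2 : ℝ) = -1 := by norm_num
    rw [h2] at this
    simp only [smul_eq_mul, mul_one] at this
    rw [show (∑ kl ∈ Finset.HasAntidiagonal.antidiagonal n, invSqrtCoeff kl.1 * invSqrtCoeff kl.2) = _ from
      this.symm, Ring.choose_neg, add_sub_cancel_left, Ring.choose_natCast, Nat.choose_self,
      Nat.cast_one]
    simp [Int.negOnePow, Units.smul_def]
  have h1 : invSqrt x * invSqrt x = ∑' n, (-x) ^ n := by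
    rw [invSqrt, tsum_mul_tsum_eq_tsum_sum_antidiagonal_of_summable_norm
      (summable_norm_invSqrt hx) (summable_norm_invSqrt hx)]
    refine tsum_congr fun n => ?_
    have : ∀ kl ∈ Finset.HasAntidiagonal.antidiagonal n, invSqrtCoeff kl.1 • x ^ kl.1 * invSqrtCoeff kl.2 • x ^ kl.2
        = (invSqrtCoeff kl.1 * invSqrtCoeff kl.2) • x ^ n := fun kl hkl => by
      rw [smul_mul_smul_comm, ← pow_add, Finset.HasAntidiagonal.mem_antidiagonal.1 hkl]
    rw [Finset.sum_congr rfl this, ← Finset.sum_smul, hc, ← smul_pow, neg_one_smul]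
  rw [h1]
  have := mul_neg_geom_series (-x) (by rwa [norm_neg])
  rwa [sub_neg_eq_add] at this

theorem contDiffOn_invSqrt : ContDiffOn ℝ ∞ (invSqrt : 𝔸 → 𝔸) (Metric.ball 0 1) := by
  have h : (invSqrt : 𝔸 → 𝔸) = (invSqrtSeries 𝔸).sum := by
    ext x
    simp [invSqrt, invSqrtSeries, FormalMultilinearSeries.sum, FormalMultilinearSeries.ofScalars_apply_eq]
  have h2 : HasFPowerSeriesOnBall (invSqrt : 𝔸 → 𝔸) (invSqrtSeries 𝔸) 0 1 := by
    rw [h]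
    exact ((invSqrtSeries 𝔸).hasFPowerSeriesOnBall
      (lt_of_lt_of_le one_pos one_le_radius_invSqrtSeries)).mono one_pos
        one_le_radius_invSqrtSeries
  have h3 := h2.analyticOnNhd.contDiffOn (n := ∞) (Metric.isOpen_eball.uniqueDiffOn)
  exact h3.mono fun x hx => by
    have : ‖x‖ < 1 := by simpa using hx
    simpa [enorm_eq_nnnorm, ← NNReal.coe_lt_one] using this

/-- Any real linear, continuous property of all powers passes to the sum of the series. It is
applied to reality and to self-adjointness, which are only real linear; hence the real scalars. -/
theorem map_invSqrt_eq {F : Type} [NormedAddCommGroup F] [NormedSpace ℝ F] (f g : 𝔸 →L[ℝ] F)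
    {x : 𝔸} (hx : ‖x‖ < 1) (h : ∀ n, f (x ^ n) = g (x ^ n)) : f (invSqrt x) = g (invSqrt x) := by
  have hs := (summable_norm_invSqrt hx).of_norm
  rw [invSqrt, f.map_tsum hs, g.map_tsum hs]
  simp only [map_smul, h]

theorem commute_invSqrt {x a : 𝔸} (hx : ‖x‖ < 1) (h : Commute x a) : Commute (invSqrt x) a := by
  change invSqrt x * a = a * invSqrt x
  have hs := (summable_norm_invSqrt hx).of_norm
  rw [invSqrt, ← hs.tsum_mul_right, ← hs.tsum_mul_left]
  refine tsum_congr fun n => ?_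
  rw [smul_mul_assoc, mul_smul_comm, (h.pow_left n).eq]

end InvSqrt

/-! ### Hilbert-Schmidt operators as a Banach bimodule, and their compactness -/

namespace HS

variable {E F G : Type} [NormedAddCommGroup E] [InnerProductSpace ℂ E] [CompleteSpace E]
  [NormedAddCommGroup F] [InnerProductSpace ℂ F] [CompleteSpace F]
  [NormedAddCommGroup G] [InnerProductSpace ℂ G] [CompleteSpace G]

theorem norm_toCLM_le (A : HS E F) : ‖toCLM A‖ ≤ ‖A‖ :=
  ContinuousLinearMap.opNorm_le_bound _ (norm_nonneg _) (norm_apply_le A)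

/-- The inclusion of the Hilbert-Schmidt operators into the bounded operators. -/
def toCLML : HS E F →L[ℂ] (E →L[ℂ] F) :=
  toCLM.mkContinuous 1 fun A => by simpa using norm_toCLM_le A

theorem enorm_sq (A : HS E F) : ‖A‖ₑ ^ 2 = ∑' i, ‖toCLM A (stdBasis E i)‖ₑ ^ 2 := by
  have h : HasSum (fun i => ‖toCLM A (stdBasis E i)‖ ^ 2) (‖A‖ ^ 2) := by
    have := lp.hasSum_norm (p := 2) (by norm_num) (toLp A)
    simpa using! this
  have h2 := ENNReal.ofReal_tsum_of_nonneg (fun i => by positivity) h.summable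
  rw [h.tsum_eq] at h2
  simpa [ENNReal.ofReal_pow, ofReal_norm] using h2

theorem norm_sq (A : HS E F) :
    ‖A‖ ^ 2 = ∑' i, ‖toCLM A (stdBasis E i)‖ ^ 2 := by
  have := (lp.hasSum_norm (p := 2) (by norm_num) (toLp A)).tsum_eq
  simpa using! this.symm

theorem norm_mk_comp_left_le (B : F →L[ℂ] G) (A : HS E F) :
    ‖mk _ (A.isHilbertSchmidt.comp_left B)‖ ≤ ‖B‖ * ‖A‖ := by
  apply le_of_sq_le_sq _ (by positivity)
  rw [norm_sq, mul_pow, norm_sq A, ← tsum_mul_left]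
  have hA : Summable fun i => ‖toCLM A (stdBasis E i)‖ ^ 2 := A.isHilbertSchmidt
  refine Summable.tsum_le_tsum (fun i => ?_) (A.isHilbertSchmidt.comp_left B) (hA.mul_left _)
  rw [← mul_pow]
  exact pow_le_pow_left₀ (norm_nonneg _) (B.le_opNorm _) 2

/-- The composition `B ∘ A` with `A` Hilbert-Schmidt. -/
def compLeft : (F →L[ℂ] G) →L[ℂ] HS E F →L[ℂ] HS E G :=
  LinearMap.mkContinuous₂ (LinearMap.mk₂ ℂ (fun B A => mk _ (A.isHilbertSchmidt.comp_left B))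
    (fun _ _ _ => rfl) (fun _ _ _ => rfl) (fun B A A' => toCLM_injective (by ext u; simp))
    (fun c B A => toCLM_injective (by ext u; simp))) 1 (fun B A => by
      rw [one_mul]; exact norm_mk_comp_left_le B A)

@[simp] theorem toCLM_compLeft (B : F →L[ℂ] G) (A : HS E F) :
    toCLM (compLeft B A) = B ∘L toCLM A := rfl

theorem norm_compLeft_le (B : F →L[ℂ] G) (A : HS E F) : ‖compLeft B A‖ ≤ ‖B‖ * ‖A‖ :=
  norm_mk_comp_left_le B A

/-- The adjoint of a Hilbert-Schmidt operator. -/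
def adj : HS E F →L⋆[ℂ] HS F E :=
  LinearMap.mkContinuous
    { toFun := fun A => mk _ (isHilbertSchmidt_adjoint A.isHilbertSchmidt)
      map_add' := fun A B => toCLM_injective (by simp)
      map_smul' := fun c A => toCLM_injective (by simp [map_smulₛₗ]) } 1
    (fun A => by
      have h : ‖mk _ (isHilbertSchmidt_adjoint A.isHilbertSchmidt)‖ₑ ^ 2 = ‖A‖ₑ ^ 2 := by
        rw [enorm_sq, enorm_sq, tsum_enorm_adjoint (stdBasis E) (stdBasis F)]
        rfl
      have h2 := (ENNReal.pow_right_strictMono (two_ne_zero)).injective h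
      rw [one_mul]
      rw [enorm_eq_nnnorm, enorm_eq_nnnorm, ENNReal.coe_inj] at h2
      exact le_of_eq (congrArg NNReal.toReal h2))

@[simp] theorem toCLM_adj (A : HS E F) : toCLM (adj A) = ContinuousLinearMap.adjoint (toCLM A) := rfl

theorem norm_adj_le (A : HS E F) : ‖adj A‖ ≤ ‖A‖ := by
  have := (adj : HS E F →L⋆[ℂ] HS F E).le_of_opNorm_le
    (LinearMap.mkContinuous_norm_le _ zero_le_one _) A
  rwa [one_mul] at this

/-- Since `A B = (B* A*)*` and taking adjoints does not increase the Hilbert-Schmidt norm, this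
reduces to composition on the left. -/
theorem norm_mk_comp_right_le (A : HS F G) (B : E →L[ℂ] F) :
    ‖mk _ (A.isHilbertSchmidt.comp_right B)‖ ≤ ‖A‖ * ‖B‖ := by
  have h : mk _ (A.isHilbertSchmidt.comp_right B)
      = adj (compLeft (ContinuousLinearMap.adjoint B) (adj A)) := toCLM_injective (by
    simp [ContinuousLinearMap.adjoint_comp])
  rw [h, mul_comm]
  refine (norm_adj_le _).trans ((norm_compLeft_le _ _).trans ?_)
  rw [LinearIsometryEquiv.norm_map]
  exact mul_le_mul_of_nonneg_left (norm_adj_le A) (norm_nonneg _)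

/-- The composition `A ∘ B` with `A` Hilbert-Schmidt. -/
def compRight : HS F G →L[ℂ] (E →L[ℂ] F) →L[ℂ] HS E G :=
  LinearMap.mkContinuous₂ (LinearMap.mk₂ ℂ (fun A B => mk _ (A.isHilbertSchmidt.comp_right B))
    (fun _ _ _ => rfl) (fun _ _ _ => rfl) (fun B A A' => toCLM_injective (by ext u; simp))
    (fun c B A => toCLM_injective (by ext u; simp))) 1 (fun B A => by
      rw [one_mul]; exact norm_mk_comp_right_le B A)

@[simp] theorem toCLM_compRight (A : HS F G) (B : E →L[ℂ] F) :
    toCLM (compRight A B) = toCLM A ∘L B := rfl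

theorem norm_compRight_le (A : HS F G) (B : E →L[ℂ] F) : ‖compRight A B‖ ≤ ‖A‖ * ‖B‖ :=
  norm_mk_comp_right_le A B

/-- Together with the right action below, this makes `L²` a bimodule with bounded actions over the
bounded operators, as needed for the square-zero extension `Amb` to be a Banach algebra. -/
instance : Module (E →L[ℂ] E) (HS E E) where
  smul B A := compLeft B A
  one_smul A := toCLM_injective (by ext; rfl)
  mul_smul B C A := toCLM_injective (by ext; rfl)
  smul_zero B := map_zero (compLeft B)
  smul_add B := map_add (compLeft B)
  add_smul B C A := toCLM_injective (by ext; rfl)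
  zero_smul A := toCLM_injective (by ext; rfl)

instance : Module (E →L[ℂ] E)ᵐᵒᵖ (HS E E) where
  smul B A := compRight A B.unop
  one_smul A := toCLM_injective (by ext; rfl)
  mul_smul B C A := toCLM_injective (by ext; rfl)
  smul_zero B := toCLM_injective (by ext; rfl)
  smul_add B A A' := toCLM_injective (by ext; rfl)
  add_smul B C A := map_add (compRight A) B.unop C.unop
  zero_smul A := map_zero (compRight A)

theorem smul_def (B : E →L[ℂ] E) (A : HS E E) : B • A = compLeft B A := rfl

@[simp] theorem toCLM_smul' (B : E →L[ℂ] E) (A : HS E E) : toCLM (B • A) = B * toCLM A := rfl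

@[simp] theorem toCLM_op_smul (B : E →L[ℂ] E) (A : HS E E) :
    toCLM (MulOpposite.op B • A) = toCLM A * B := rfl

instance : SMulCommClass (E →L[ℂ] E) (E →L[ℂ] E)ᵐᵒᵖ (HS E E) :=
  ⟨fun B C A => toCLM_injective (by ext; rfl)⟩

instance : IsBoundedSMul (E →L[ℂ] E) (HS E E) :=
  IsBoundedSMul.of_norm_smul_le norm_compLeft_le

instance : IsBoundedSMul (E →L[ℂ] E)ᵐᵒᵖ (HS E E) :=
  IsBoundedSMul.of_norm_smul_le fun B A => by
    rw [mul_comm]; exact norm_compRight_le A B.unop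

theorem toCLM_real_smul (c : ℝ) (A : HS E F) : toCLM (c • A) = c • toCLM A := by
  rw [← Complex.coe_smul, map_smul, Complex.coe_smul]

instance : IsScalarTower ℝ (E →L[ℂ] E) (HS E E) :=
  ⟨fun c B A => toCLM_injective (by
    rw [toCLM_real_smul, toCLM_smul', toCLM_smul', smul_mul_assoc])⟩

instance : IsScalarTower ℝ (E →L[ℂ] E)ᵐᵒᵖ (HS E E) :=
  ⟨fun c B A => toCLM_injective (by
    obtain ⟨B, rfl⟩ := MulOpposite.op_surjective B
    rw [toCLM_real_smul, ← MulOpposite.op_smul, toCLM_op_smul, toCLM_op_smul, mul_smul_comm])⟩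

/-- Hilbert-Schmidt operators are compact. -/
theorem isCompactOperator (A : HS E F) : IsCompactOperator (toCLM A) := by
  classical
  -- Compactness is closed in operator norm, hence in the finer Hilbert-Schmidt norm. It remains to
  -- approximate `A` by the finite rank operators that keep finitely many of the columns `A eᵢ`.
  have hc : IsClosed {B : HS E F | IsCompactOperator (toCLM B)} :=
    isClosed_setOfPred_isCompactOperator.preimage toCLML.continuous
  let e : HS E F ≃ₗᵢ[ℂ] lp (fun _ : basisSet E => F) 2 :=
    { LinearEquiv.ofBijective toLp ⟨toLp_injective, toLp_surjective⟩ with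
      norm_map' := fun _ => rfl }
  have h1 : HasSum (fun i => lp.single 2 i (toLp A i)) (toLp A) :=
    lp.hasSum_single (by norm_num) _
  have h2 := h1.map e.symm e.symm.continuous
  have h3 : e.symm (toLp A) = A := e.symm_apply_apply A
  rw [h3] at h2
  refine hc.mem_of_tendsto h2 (Filter.Eventually.of_forall fun s => ?_)
  change IsCompactOperator (toCLM (∑ i ∈ s, e.symm (lp.single 2 i (toLp A i))))
  rw [map_sum]
  have h4 : ∀ i, ∀ x : F, toCLM (e.symm (lp.single 2 i x))
      = (innerSL ℂ (stdBasis E i)).smulRight x := fun i x => by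
    apply ContinuousLinearMap.ext_on (s := Set.range (stdBasis E))
    · exact (Submodule.dense_iff_topologicalClosure_eq_top).2 (stdBasis E).dense_span
    · rintro _ ⟨j, rfl⟩
      have : toLp (e.symm (lp.single 2 i x)) j
          = (lp.single 2 i x : lp (fun _ : basisSet E => F) 2) j :=
        congrFun (congrArg Subtype.val (e.apply_symm_apply (lp.single 2 i x))) j
      change toLp (e.symm (lp.single 2 i x)) j = _
      rw [this]
      have ho := orthonormal_iff_ite.1 (stdBasis E).orthonormal i j
      simp only [ContinuousLinearMap.smulRight_apply, innerSL_apply_apply, ho]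
      by_cases hij : i = j
      · subst hij; simp
      · simp [lp.single_apply, hij, Ne.symm hij]
  refine Finset.sum_induction _ (fun T : E →L[ℂ] F => IsCompactOperator T)
    (fun _ _ h h' => h.add h') isCompactOperator_zero fun i _ => ?_
  rw [h4]
  exact (isCompactOperator_of_locallyCompactSpace_dom (innerSL ℂ (stdBasis E i))).clm_comp
    (ContinuousLinearMap.toSpanSingleton ℂ (toLp A i))

end HS

/-! ### Block calculus for `𝓗₊ ⊕ 𝓗₋` and the conjugation -/

/-- The inclusion of `𝓗₊`. -/
abbrev incP : Hplus →L[ℂ] Hilb := Hplus.subtypeL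
/-- The inclusion of `𝓗₋`. -/
abbrev incM : Hminus →L[ℂ] Hilb := Hminus.subtypeL
/-- The orthogonal projection onto `𝓗₊`. -/
abbrev prP : Hilb →L[ℂ] Hplus := Hplus.orthogonalProjectionOnto
/-- The orthogonal projection onto `𝓗₋`. -/
abbrev prM : Hilb →L[ℂ] Hminus := Hminus.orthogonalProjectionOnto

theorem coe_prP (x : Hilb) : (prP x : Hilb) = Hplus.starProjection x := rfl

theorem coe_prM (x : Hilb) : (prM x : Hilb) = Hminus.starProjection x := rfl

theorem prP_incP (u : Hplus) : prP (u : Hilb) = u := by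
  apply Subtype.ext
  simp

theorem prM_incM (u : Hminus) : prM (u : Hilb) = u := by
  apply Subtype.ext
  simp

theorem prM_incP (u : Hplus) : prM (u : Hilb) = 0 := by
  apply Subtype.ext
  rw [coe_prM]
  simpa using starProjection_minus u.2 Hminus.zero_mem

theorem prP_incM (u : Hminus) : prP (u : Hilb) = 0 := by
  apply Subtype.ext
  rw [coe_prP]
  simpa using starProjection_plus Hplus.zero_mem u.2

theorem prP_add_prM (x : Hilb) : (prP x : Hilb) + (prM x : Hilb) = x := by
  obtain ⟨v, hv, w, hw, rfl⟩ := exists_decomp x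
  rw [coe_prP, coe_prM, starProjection_plus hv hw, starProjection_minus hv hw]

theorem hilb_ext {x y : Hilb} (h : prP x = prP y) (h' : prM x = prM y) : x = y := by
  rw [← prP_add_prM x, ← prP_add_prM y, h, h']

theorem clm_ext {E : Type} [NormedAddCommGroup E] [NormedSpace ℂ E] {A B : Hilb →L[ℂ] E}
    (h : ∀ u : Hplus, A u = B u) (h' : ∀ u : Hminus, A u = B u) : A = B := by
  ext1 x
  rw [← prP_add_prM x, map_add, map_add, h, h']

theorem adjoint_incP : ContinuousLinearMap.adjoint incP = prP := Submodule.adjoint_subtypeL _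

theorem adjoint_incM : ContinuousLinearMap.adjoint incM = prM := Submodule.adjoint_subtypeL _

theorem adjoint_prP : ContinuousLinearMap.adjoint prP = incP := by
  rw [← adjoint_incP, ContinuousLinearMap.adjoint_adjoint]

theorem adjoint_prM : ContinuousLinearMap.adjoint prM = incM := by
  rw [← adjoint_incM, ContinuousLinearMap.adjoint_adjoint]

theorem inner_eq_add (x y : Hilb) : ⟪x, y⟫_ℂ = ⟪prP x, prP y⟫_ℂ + ⟪prM x, prM y⟫_ℂ := by
  conv_lhs => rw [← prP_add_prM y, inner_add_right]
  congr 1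
  · exact ((ContinuousLinearMap.adjoint_inner_left incP (prP y) x).symm).trans (by
      rw [adjoint_incP])
  · exact ((ContinuousLinearMap.adjoint_inner_left incM (prM y) x).symm).trans (by
      rw [adjoint_incM])

theorem norm_sq_eq_add (x : Hilb) : ‖x‖ ^ 2 = ‖prP x‖ ^ 2 + ‖prM x‖ ^ 2 := by
  have h := inner_eq_add x x
  rw [inner_self_eq_norm_sq_to_K, inner_self_eq_norm_sq_to_K (prP x),
    inner_self_eq_norm_sq_to_K (prM x)] at h
  exact_mod_cast h

theorem dOp_incP (u : Hplus) : dOp (u : Hilb) = Complex.I • (u : Hilb) := by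
  change Complex.I • (((prP (u : Hilb) : Hplus) : Hilb) - ((prM (u : Hilb) : Hminus) : Hilb)) = _
  rw [prP_incP, prM_incP]
  simp

theorem dOp_incM (u : Hminus) : dOp (u : Hilb) = -Complex.I • (u : Hilb) := by
  change Complex.I • (((prP (u : Hilb) : Hplus) : Hilb) - ((prM (u : Hilb) : Hminus) : Hilb)) = _
  rw [prP_incM, prM_incM]
  simp

theorem dOp_apply (x : Hilb) :
    dOp x = Complex.I • ((prP x : Hilb) - (prM x : Hilb)) := rfl

theorem dOp_mul_dOp : dOp * dOp = -1 := by
  apply clm_ext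
  · intro u
    rw [mul_apply_eq_comp, dOp_incP, map_smul, dOp_incP, smul_smul]
    simp
  · intro u
    rw [mul_apply_eq_comp, dOp_incM, map_smul, dOp_incM, smul_smul]
    simp

theorem star_dOp : star dOp = -dOp := by
  rw [dOp, star_smul, star_sub, (isSelfAdjoint_starProjection _).star_eq,
    (isSelfAdjoint_starProjection _).star_eq, Complex.star_def, Complex.conj_I]
  ext1 x
  simp

theorem prP_dOp (x : Hilb) : prP (dOp x) = Complex.I • prP x := by
  rw [dOp_apply, map_smul, map_sub, prP_incP, prP_incM, sub_zero]

theorem prM_dOp (x : Hilb) : prM (dOp x) = -Complex.I • prM x := by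
  rw [dOp_apply, map_smul, map_sub, prM_incP, prM_incM, zero_sub, smul_neg, neg_smul]

theorem conjMinus_conjPlus (u : Hplus) : conjMinus (conjPlus u) = u :=
  Subtype.ext (conjugation_conjugation _)

theorem conjPlus_conjMinus (u : Hminus) : conjPlus (conjMinus u) = u :=
  Subtype.ext (conjugation_conjugation _)

theorem inner_conjugation (x y : Hilb) : ⟪conjugation x, conjugation y⟫_ℂ = ⟪y, x⟫_ℂ := by
  rw [Hilb.inner_eq_tsum, Hilb.inner_eq_tsum, ← (Equiv.neg ℤ).tsum_eq]
  refine tsum_congr fun n => ?_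
  simp only [Equiv.neg_apply, coeff_conjugation, neg_neg, Complex.conj_conj, Int.cast_neg, abs_neg]
  ring

theorem inner_conjugation_left (x y : Hilb) : ⟪conjugation x, y⟫_ℂ = ⟪conjugation y, x⟫_ℂ := by
  have h := inner_conjugation x (conjugation y)
  rwa [conjugation_conjugation] at h

theorem norm_conjugation (x : Hilb) : ‖conjugation x‖ = ‖x‖ := by
  have h := inner_conjugation x x
  simp only [inner_self_eq_norm_sq_to_K] at h
  have h2 : ‖conjugation x‖ ^ 2 = ‖x‖ ^ 2 := by exact_mod_cast h
  exact (pow_left_inj₀ (norm_nonneg _) (norm_nonneg _) two_ne_zero).1 h2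

theorem conjugation_dOp (x : Hilb) : conjugation (dOp x) = dOp (conjugation x) := by
  rw [dOp_eq_J]
  refine Hilb.ext_coeff fun n => ?_
  rw [coeff_conjugation, coeff_J, coeff_J, coeff_conjugation]
  simp

/-! ### Real operators and the symplectic relations -/

/-- An operator that maps real functions to real functions. -/
def IsReal (A : Hilb →L[ℂ] Hilb) : Prop := ∀ x, conjugation (A x) = A (conjugation x)

namespace IsReal

variable {A B : Hilb →L[ℂ] Hilb}

theorem dOp : IsReal dOp := conjugation_dOp

theorem one : IsReal 1 := fun _ => rfl

theorem mul (hA : IsReal A) (hB : IsReal B) : IsReal (A * B) := fun x => by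
  simp only [mul_apply_eq_comp, hA _, hB _]

theorem add (hA : IsReal A) (hB : IsReal B) : IsReal (A + B) := fun x => by
  simp only [add_apply, map_add, hA _, hB _]

theorem neg (hA : IsReal A) : IsReal (-A) := fun x => by
  simp only [neg_apply, map_neg, hA _]

theorem sub (hA : IsReal A) (hB : IsReal B) : IsReal (A - B) := by
  rw [sub_eq_add_neg]; exact hA.add hB.neg

/-- Conjugation is antiunitary, so commuting with it passes to the adjoint. -/
theorem star (hA : IsReal A) : IsReal (star A) := fun x => by
  refine ext_inner_left ℂ fun y => ?_
  rw [ContinuousLinearMap.star_eq_adjoint, ContinuousLinearMap.adjoint_inner_right,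
    ← inner_conj_symm, inner_conjugation_left, ContinuousLinearMap.adjoint_inner_right, ← hA,
    inner_conjugation_left, inner_conj_symm]

theorem inverse (hA : IsReal A) : IsReal (Ring.inverse A) := by
  by_cases h : IsUnit A
  · intro x
    have h1 : ∀ y, A (Ring.inverse A y) = y := fun y => by
      rw [← mul_apply_eq_comp, Ring.mul_inverse_cancel _ h]; rfl
    have h2 : ∀ y, Ring.inverse A (A y) = y := fun y => by
      rw [← mul_apply_eq_comp, Ring.inverse_mul_cancel _ h]; rfl
    rw [← h2 (conjugation (Ring.inverse A x)), ← hA, h1]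
  · rw [Ring.inverse_non_unit _ h]
    intro x; simp

/-- The restriction of a real operator to `𝓥`. -/
def restrict (hA : IsReal A) : V →L[ℝ] V :=
  ((A.restrictScalars ℝ).comp V.subtypeL).codRestrict V fun u => by
    have h : conjugation (u : Hilb) = u := u.2
    change conjugation (A u) = A u
    rw [hA, h]

theorem coe_restrict (hA : IsReal A) (u : V) : (hA.restrict u : Hilb) = A u := rfl

theorem complexify_restrict (hA : IsReal A) : complexify hA.restrict = A := by
  ext1 u
  change complexifyCLM hA.restrict u = A u
  rw [complexifyCLM_apply, coe_restrict, coe_restrict, ← map_smul, ← map_add,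
    realPart_add_imagPart]

end IsReal

namespace SpRes

theorem ext_op {a b : SpRes} (h : a.op = b.op) : a = b := by
  apply Subtype.ext
  apply Units.ext
  ext1 v
  apply Subtype.ext
  rw [← complexifyCLM_coe a.1.1, ← complexifyCLM_coe b.1.1]
  exact congrFun (congrArg (fun A : Hilb →L[ℂ] Hilb => (A : Hilb → Hilb)) h) v

@[simp] theorem op_mul (a b : SpRes) : (a * b).op = a.op * b.op := map_mul complexify _ _

@[simp] theorem op_one : (1 : SpRes).op = 1 := map_one complexify

theorem isReal_op (a : SpRes) : IsReal a.op := fun x => (complexifyCLM_conjugation _ x).symm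

theorem op_mul_op_inv (a : SpRes) : a.op * a⁻¹.op = 1 := by rw [← op_mul, mul_inv_cancel, op_one]

theorem op_inv_mul_op (a : SpRes) : a⁻¹.op * a.op = 1 := by rw [← op_mul, inv_mul_cancel, op_one]

/-- On real vectors `d A v` is real, so the conjugation built into `Omega` disappears. This converts
invariance of `Ω` into an identity between operators. -/
theorem Omega_eq_inner {A : Hilb →L[ℂ] Hilb} (hA : IsReal A) (u v : V) :
    Omega (A u) (A v) = ⟪(star A * dOp * A) (v : Hilb), (u : Hilb)⟫_ℂ := by
  have hv : conjugation (v : Hilb) = v := v.2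
  rw [Omega, ← dOp_eq_J, conjugation_dOp, hA, hv, mul_apply_eq_comp,
    mul_apply_eq_comp, ContinuousLinearMap.star_eq_adjoint,
    ContinuousLinearMap.adjoint_inner_left]

/-- Invariance of `Ω` gives the identity tested on pairs of real vectors, and `𝓥` spans `𝓗` over `ℂ`
in both variables. -/
theorem star_op_mul (a : SpRes) : star a.op * dOp * a.op = dOp := by
  have h : ∀ u v : V, ⟪(star a.op * dOp * a.op) (v : Hilb), (u : Hilb)⟫_ℂ
      = ⟪dOp (v : Hilb), (u : Hilb)⟫_ℂ := fun u v => by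
    have h1 : Omega (a.op u) (a.op v) = Omega u v := by
      rw [op]
      change Omega (complexifyCLM _ _) (complexifyCLM _ _) = _
      rw [complexifyCLM_coe, complexifyCLM_coe]
      exact a.2.1 u v
    have h2 := Omega_eq_inner IsReal.one u v
    rw [← Omega_eq_inner a.isReal_op, h1]
    simpa using h2
  have h2 : ∀ v : V, (star a.op * dOp * a.op) (v : Hilb) = dOp (v : Hilb) := fun v => by
    refine ext_inner_right ℂ fun x => ?_
    rw [← realPart_add_imagPart x, inner_add_right, inner_add_right, inner_smul_right,
      inner_smul_right, h, h]
  ext1 x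
  rw [← realPart_add_imagPart x, map_add, map_add, map_smul, map_smul, h2, h2]

/-- As `d² = -1`, the relation `a* d a = d` says that `-d a* d` is a left inverse of `a`. Since `a`
is invertible, it is also a right inverse. -/
theorem op_mul_star (a : SpRes) : a.op * dOp * star a.op = dOp := by
  have h1 : -dOp * star a.op * dOp = a⁻¹.op := by
    calc -dOp * star a.op * dOp = -dOp * (star a.op * dOp * a.op) * a⁻¹.op := by
          simp only [mul_assoc, op_mul_op_inv, mul_one]
      _ = a⁻¹.op := by rw [star_op_mul, neg_mul, dOp_mul_dOp, neg_neg, one_mul]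
  have h2 := a.op_mul_op_inv
  rw [← h1] at h2
  calc a.op * dOp * star a.op = a.op * (-dOp * star a.op * dOp) * dOp := by
        simp only [neg_mul, mul_neg, mul_assoc, dOp_mul_dOp, mul_one, neg_neg]
    _ = dOp := by rw [h2, one_mul]

/-- The element of `Sp_res(𝓥, Ω)` defined by a real operator. -/
def ofOp (A : Hilb →L[ℂ] Hilb) (hA : IsReal A) (h1 : star A * dOp * A = dOp)
    (h2 : A * dOp * star A = dOp) (h3 : IsHilbertSchmidt (⁅dOp, A⁆ : Hilb →L[ℂ] Hilb)) : SpRes :=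
  -- The two relations exhibit `-d A* d` as the inverse of `A`; being real, it restricts to `𝓥`.
  have hr : IsReal (-dOp * star A * dOp) := (IsReal.dOp.neg.mul hA.star).mul IsReal.dOp
  have e1 : A * (-dOp * star A * dOp) = 1 := by
    have : A * (-dOp * star A * dOp) = -(A * dOp * star A) * dOp := by noncomm_ring
    rw [this, h2, neg_mul, dOp_mul_dOp, neg_neg]
  have e2 : (-dOp * star A * dOp) * A = 1 := by
    have : (-dOp * star A * dOp) * A = -dOp * (star A * dOp * A) := by noncomm_ring
    rw [this, h1, neg_mul, dOp_mul_dOp, neg_neg]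
  have hu : ∀ x, A ((-dOp * star A * dOp) x) = x := fun x => congrFun (congrArg (fun B : Hilb →L[ℂ] Hilb => (B : Hilb → Hilb)) e1) x
  have hu' : ∀ x, (-dOp * star A * dOp) (A x) = x := fun x => congrFun (congrArg (fun B : Hilb →L[ℂ] Hilb => (B : Hilb → Hilb)) e2) x
  (⟨⟨hA.restrict, hr.restrict, by
      ext1 v; exact Subtype.ext (hu v), by
      ext1 v; exact Subtype.ext (hu' v)⟩, by
    refine ⟨fun u v => ?_, ?_⟩
    · change Omega (A u) (A v) = _
      rw [Omega_eq_inner hA, h1]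
      have := Omega_eq_inner IsReal.one u v
      simpa using this.symm
    · change IsHilbertSchmidt (⁅dOp, complexify hA.restrict⁆ : Hilb →L[ℂ] Hilb)
      rwa [hA.complexify_restrict]⟩ : spResSubgroup)

@[simp] theorem op_ofOp (A : Hilb →L[ℂ] Hilb) (hA : IsReal A) (h1 : star A * dOp * A = dOp)
    (h2 : A * dOp * star A = dOp) (h3 : IsHilbertSchmidt (⁅dOp, A⁆ : Hilb →L[ℂ] Hilb)) :
    (ofOp A hA h1 h2 h3).op = A := hA.complexify_restrict

end SpRes

/-! ### The disc as the set of symmetric strict contractions -/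

theorem Omega_incP_incM (x : Hplus) (v : Hminus) :
    Omega x v = Complex.I * 0 + -Complex.I * ⟪conjugation (v : Hilb), (x : Hilb)⟫_ℂ := by
  rw [Omega, ← dOp_eq_J, dOp_incM, map_smulₛₗ, inner_smul_left]
  simp

/-- Symmetry of `Z` with respect to the bilinear form `⟨·, conj ·⟩`. -/
theorem inner_symm_of_mem {Z : HS Hminus Hplus} (hZ : Z ∈ symHS) (u v : Hminus) :
    ⟪conjugation (v : Hilb), (HS.toCLM Z u : Hilb)⟫_ℂ
      = ⟪conjugation (u : Hilb), (HS.toCLM Z v : Hilb)⟫_ℂ := by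
  have h := hZ u v
  rw [Omega_incP_incM, Omega_incP_incM] at h
  simpa using h

/-- Between `𝓗₋` and `𝓗₊`, `Ω` is a multiple of the bilinear form `⟪v̄, x⟫`, and symmetry for that
form is the identity `Z̄ = Z*`. The positivity condition of the disc then reads `‖Z* u‖ < ‖u‖`. -/
theorem barMP_eq_adjoint {Z : HS Hminus Hplus} (hZ : Z ∈ symHS) :
    barMP (HS.toCLM Z) = ContinuousLinearMap.adjoint (HS.toCLM Z) := by
  ext1 w
  refine ext_inner_right ℂ fun u => ?_
  rw [ContinuousLinearMap.adjoint_inner_left]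
  change ⟪conjugation (HS.toCLM Z (conjPlus w) : Hilb), (u : Hilb)⟫_ℂ
    = ⟪(w : Hilb), (HS.toCLM Z u : Hilb)⟫_ℂ
  rw [inner_conjugation_left, inner_symm_of_mem hZ]
  change ⟪conjugation (conjugation (w : Hilb)), _⟫_ℂ = _
  rw [conjugation_conjugation]

theorem conjugation_adjoint {Z : HS Hminus Hplus} (hZ : Z ∈ symHS) (w : Hplus) :
    conjugation (ContinuousLinearMap.adjoint (HS.toCLM Z) w : Hilb) = HS.toCLM Z (conjPlus w) := by
  rw [← barMP_eq_adjoint hZ]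
  exact conjugation_conjugation _

theorem mem_symHS_of_inner {Z : HS Hminus Hplus}
    (h : ∀ u v : Hminus, ⟪conjugation (v : Hilb), (HS.toCLM Z u : Hilb)⟫_ℂ
      = ⟪conjugation (u : Hilb), (HS.toCLM Z v : Hilb)⟫_ℂ) : Z ∈ symHS := fun u v => by
  rw [Omega_incP_incM, Omega_incP_incM, h]

theorem re_inner_sub {T : Hminus →L[ℂ] Hplus} (u : Hplus) :
    (⟪u, u - T (ContinuousLinearMap.adjoint T u)⟫_ℂ).re
      = ‖u‖ ^ 2 - ‖ContinuousLinearMap.adjoint T u‖ ^ 2 := by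
  rw [inner_sub_right, ← ContinuousLinearMap.adjoint_inner_left, inner_self_eq_norm_sq_to_K,
    inner_self_eq_norm_sq_to_K, Complex.sub_re]
  norm_cast

/-- A compact operator `T` between Hilbert spaces with `‖T u‖ < ‖u‖` for all `u ≠ 0` has norm less
than `1`. -/
theorem opNorm_lt_one_of_isCompactOperator {E F : Type} [NormedAddCommGroup E]
    [InnerProductSpace ℂ E] [CompleteSpace E] [NormedAddCommGroup F] [InnerProductSpace ℂ F]
    [CompleteSpace F] {T : E →L[ℂ] F} (hT : IsCompactOperator T)
    (h : ∀ u, u ≠ 0 → ‖T u‖ < ‖u‖) : ‖T‖ < 1 := by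
  have hle : ‖T‖ ≤ 1 := T.opNorm_le_bound zero_le_one fun u => by
    rcases eq_or_ne u 0 with rfl | hu
    · simp
    · rw [one_mul]; exact (h u hu).le
  refine lt_of_le_of_ne hle fun h1 => ?_
  set S : E →L[ℂ] E := ContinuousLinearMap.adjoint T ∘L T with hS
  have hSc : IsCompactOperator S := hT.clm_comp (ContinuousLinearMap.adjoint T)
  -- A vector with `T* T u = u` would have `‖T u‖ = ‖u‖`.
  have hne : ¬ Module.End.HasEigenvalue (S : Module.End ℂ E) 1 := fun he => by
    obtain ⟨u, hu⟩ := he.exists_hasEigenvector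
    have h2 : S u = u := by simpa using hu.apply_eq_smul
    have h3 : ‖T u‖ ^ 2 = ‖u‖ ^ 2 := by
      have : ⟪S u, u⟫_ℂ = ⟪T u, T u⟫_ℂ := ContinuousLinearMap.adjoint_inner_left T u (T u)
      rw [h2] at this
      rw [@norm_sq_eq_re_inner ℂ, @norm_sq_eq_re_inner ℂ, this]
    have h4 := h u hu.2
    rw [(pow_left_inj₀ (norm_nonneg _) (norm_nonneg _) two_ne_zero).1 h3] at h4
    exact lt_irrefl _ h4
  -- By compactness of `S`, the absence of the eigenvalue 1 makes `S - 1` bounded below.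
  obtain ⟨K, hK⟩ := hSc.antilipschitz_of_not_hasEigenvalue one_ne_zero hne
  obtain ⟨K, hK0, hK⟩ := antilipschitzWith_iff_exists_mul_le_norm.1 ⟨K, hK⟩
  -- Expand `‖S u - u‖² = ‖S u‖² - 2‖T u‖² + ‖u‖²` and use `‖S u‖ ≤ ‖T u‖ ≤ ‖u‖`, valid since `‖T‖ =
  -- 1`. The resulting bound `‖T u‖² ≤ (1 - K²/2) ‖u‖²` contradicts `‖T‖ = 1`.
  have key : ∀ u, K ^ 2 * ‖u‖ ^ 2 ≤ 2 * (‖u‖ ^ 2 - ‖T u‖ ^ 2) := fun u => by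
    have h2 := hK u
    have h3 : ‖(S - (1 : ℂ) • 1 : E →L[ℂ] E) u‖ ^ 2 = ‖S u‖ ^ 2 - 2 * ‖T u‖ ^ 2 + ‖u‖ ^ 2 := by
      have e : (S - (1 : ℂ) • 1 : E →L[ℂ] E) u = S u - u := by simp
      have e2 : ⟪S u, u⟫_ℂ = ⟪T u, T u⟫_ℂ := ContinuousLinearMap.adjoint_inner_left T u (T u)
      rw [e, norm_sub_sq (𝕜 := ℂ), e2, ← @norm_sq_eq_re_inner ℂ]
    have h4 : ‖S u‖ ≤ ‖T u‖ := by
      refine ((ContinuousLinearMap.adjoint T).le_opNorm (T u)).trans ?_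
      rw [LinearIsometryEquiv.norm_map, h1, one_mul]
    have h5 : ‖T u‖ ≤ ‖u‖ := by simpa [h1] using T.le_opNorm u
    have h6 := pow_le_pow_left₀ (norm_nonneg _) h4 2
    have h7 := pow_le_pow_left₀ (by positivity) h2 2
    rw [h3, mul_pow] at h7
    nlinarith
  have hlt : ‖T‖ ≤ Real.sqrt (1 - K ^ 2 / 2) := by
    refine T.opNorm_le_bound (Real.sqrt_nonneg _) fun u => ?_
    rcases eq_or_ne u 0 with rfl | hu
    · simp
    · have hu' : 0 < ‖u‖ ^ 2 := by positivity
      have hk := key u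
      have h0 : 0 ≤ 1 - K ^ 2 / 2 := by
        by_contra hc
        nlinarith [sq_nonneg ‖T u‖]
      apply le_of_sq_le_sq _ (by positivity)
      rw [mul_pow, Real.sq_sqrt h0]
      nlinarith
  rw [h1, Real.le_sqrt' one_pos] at hlt
  nlinarith [sq_pos_of_pos hK0]

/-- With `Z̄ = Z*`, positivity of `I - Z Z̄` is a strict pointwise bound on the compact operator
`Z*`, which compactness makes uniform. -/
theorem mem_restrictedSiegelDisc_iff (Z : symHS) :
    Z ∈ restrictedSiegelDisc ↔ ‖HS.toCLM (Z : HS Hminus Hplus)‖ < 1 := by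
  have hn : ‖HS.toCLM (Z : HS Hminus Hplus)‖
      = ‖ContinuousLinearMap.adjoint (HS.toCLM (Z : HS Hminus Hplus))‖ := by
    rw [LinearIsometryEquiv.norm_map]
  constructor
  · intro h
    rw [hn]
    refine opNorm_lt_one_of_isCompactOperator (HS.isCompactOperator (HS.adj Z.1)) fun u hu => ?_
    have := h.2 u hu
    rw [barMP_eq_adjoint Z.2, re_inner_sub] at this
    exact lt_of_pow_lt_pow_left₀ 2 (norm_nonneg _) (by simpa using this)
  · intro h
    refine ⟨Z.2, fun u hu => ?_⟩
    rw [barMP_eq_adjoint Z.2, re_inner_sub]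
    have h1 := (ContinuousLinearMap.adjoint (HS.toCLM (Z : HS Hminus Hplus))).le_opNorm u
    rw [← hn] at h1
    have h2 : 0 < ‖u‖ := norm_pos_iff.2 hu
    have h3 : ‖ContinuousLinearMap.adjoint (HS.toCLM (Z : HS Hminus Hplus)) u‖ < ‖u‖ :=
      h1.trans_lt (by nlinarith)
    have := pow_lt_pow_left₀ h3 (norm_nonneg _) two_ne_zero
    linarith

theorem isOpen_restrictedSiegelDisc : IsOpen restrictedSiegelDisc := by
  have : restrictedSiegelDisc = {Z : symHS | ‖HS.toCLML (Z : HS Hminus Hplus)‖ < 1} := by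
    ext Z; exact mem_restrictedSiegelDisc_iff Z
  rw [this]
  exact isOpen_lt (HS.toCLML.continuous.comp continuous_subtype_val).norm continuous_const

/-! ### Moebius transformations through graphs -/

/-- An operator that is bounded below and whose adjoint is bounded below is invertible. -/
theorem isUnit_of_bounded_below {E : Type} [NormedAddCommGroup E] [InnerProductSpace ℂ E]
    [CompleteSpace E] {T : E →L[ℂ] E} {c c' : ℝ} (hc : 0 < c) (hc' : 0 < c')
    (h : ∀ u, c * ‖u‖ ≤ ‖T u‖) (h' : ∀ u, c' * ‖u‖ ≤ ‖ContinuousLinearMap.adjoint T u‖) :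
    IsUnit T := by
  obtain ⟨K, hK⟩ := antilipschitzWith_iff_exists_mul_le_norm.2 ⟨c, hc, h⟩
  rw [ContinuousLinearMap.isUnit_iff_bijective]
  refine ⟨hK.injective, ?_⟩
  have hcl : IsClosed (Set.range T) := hK.isClosed_range T.uniformContinuous
  have hker : (ContinuousLinearMap.adjoint T).ker = ⊥ := by
    rw [eq_bot_iff]
    intro u hu
    have h1 := h' u
    have h2 : ContinuousLinearMap.adjoint T u = 0 := hu
    rw [h2, norm_zero] at h1
    exact norm_le_zero_iff.1 (nonpos_of_mul_nonpos_right h1 hc')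
  have hd : T.range.topologicalClosure = ⊤ := by
    rw [Submodule.topologicalClosure_eq_top_iff, ContinuousLinearMap.orthogonal_range, hker]
  rw [IsClosed.submodule_topologicalClosure_eq (by exact hcl)] at hd
  exact LinearMap.range_eq_top.1 hd

/-- The parametrization `u ↦ Z u + u` of the graph of `Z`. -/
def graph (Z : Hminus →L[ℂ] Hplus) : Hminus →L[ℂ] Hilb := incP ∘L Z + incM

theorem graph_apply (Z : Hminus →L[ℂ] Hplus) (u : Hminus) : graph Z u = (Z u : Hilb) + u := rfl

@[simp] theorem prP_graph (Z : Hminus →L[ℂ] Hplus) (u : Hminus) : prP (graph Z u) = Z u := by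
  rw [graph_apply, map_add, prP_incP, prP_incM, add_zero]

@[simp] theorem prM_graph (Z : Hminus →L[ℂ] Hplus) (u : Hminus) : prM (graph Z u) = u := by
  rw [graph_apply, map_add, prM_incP, prM_incM, zero_add]

/-- The bilinear form `⟪conj x, d y⟫`, proportional to `Ω`. -/
def bil (x y : Hilb) : ℂ := ⟪conjugation x, dOp y⟫_ℂ

theorem bil_graph (Z : Hminus →L[ℂ] Hplus) (u v : Hminus) :
    bil (graph Z u) (graph Z v) = Complex.I * (⟪conjugation (u : Hilb), (Z v : Hilb)⟫_ℂ
      - ⟪conjugation (v : Hilb), (Z u : Hilb)⟫_ℂ) := by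
  have h1 : ⟪conjugation (Z u : Hilb), (Z v : Hilb)⟫_ℂ = 0 :=
    inner_eq_zero_of_mem (Z v).2 (conjPlus (Z u)).2
  have h2 : ⟪conjugation (u : Hilb), (v : Hilb)⟫_ℂ = 0 :=
    inner_eq_zero_symm.1 (inner_eq_zero_of_mem (conjMinus u).2 v.2)
  rw [bil, graph_apply, graph_apply, map_add, map_add, dOp_incP, dOp_incM, inner_add_left,
    inner_add_right, inner_add_right, inner_smul_right, inner_smul_right, inner_smul_right,
    inner_smul_right, h1, h2, inner_conjugation_left (Z u : Hilb)]
  ring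

/-- Symmetry becomes isotropy of the graph, a condition that is visibly stable under operators
preserving `bil`. -/
theorem mem_symHS_iff_bil {Z : HS Hminus Hplus} :
    Z ∈ symHS ↔ ∀ u v, bil (graph (HS.toCLM Z) u) (graph (HS.toCLM Z) v) = 0 := by
  constructor
  · intro h u v
    rw [bil_graph, inner_symm_of_mem h, sub_self, mul_zero]
  · intro h
    refine mem_symHS_of_inner fun u v => ?_
    have := h v u
    rw [bil_graph] at this
    exact sub_eq_zero.1 ((mul_eq_zero.1 this).resolve_left Complex.I_ne_zero)

namespace SpRes

theorem bil_op (a : SpRes) (x y : Hilb) : bil (a.op x) (a.op y) = bil x y := by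
  rw [bil, a.isReal_op, ← ContinuousLinearMap.adjoint_inner_right,
    ← ContinuousLinearMap.star_eq_adjoint]
  change ⟪conjugation x, (star a.op * (dOp * a.op)) y⟫_ℂ = _
  rw [← mul_assoc, star_op_mul]
  rfl

/-- Here `⟪y, d y⟫ = i (‖p₊ y‖² - ‖p₋ y‖²)`, and `a* d a = d` makes the left side invariant. -/
theorem norm_sq_sub_op (a : SpRes) (x : Hilb) :
    ‖prM (a.op x)‖ ^ 2 - ‖prP (a.op x)‖ ^ 2 = ‖prM x‖ ^ 2 - ‖prP x‖ ^ 2 := by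
  have h : ∀ y : Hilb, ⟪y, dOp y⟫_ℂ
      = Complex.I * ((‖prP y‖ ^ 2 : ℝ) - (‖prM y‖ ^ 2 : ℝ) : ℂ) := fun y => by
    rw [inner_eq_add, prP_dOp, prM_dOp, inner_smul_right (prP y) (prP y) Complex.I,
      inner_smul_right (prM y) (prM y) (-Complex.I),
      inner_self_eq_norm_sq_to_K (prP y), inner_self_eq_norm_sq_to_K (prM y)]
    push_cast
    simp only [Complex.coe_algebraMap]
    ring
  have h1 : ⟪a.op x, dOp (a.op x)⟫_ℂ = ⟪x, dOp x⟫_ℂ := by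
    rw [← ContinuousLinearMap.adjoint_inner_right, ← ContinuousLinearMap.star_eq_adjoint]
    change ⟪x, (star a.op * (dOp * a.op)) x⟫_ℂ = _
    rw [← mul_assoc, star_op_mul]
  rw [h, h] at h1
  have h2 := mul_left_cancel₀ Complex.I_ne_zero h1
  have h3 : ‖prP (a.op x)‖ ^ 2 - ‖prM (a.op x)‖ ^ 2 = ‖prP x‖ ^ 2 - ‖prM x‖ ^ 2 := by
    exact_mod_cast h2
  linarith

/-- The numerator `g Z + h` of the Moebius transformation. -/
def num (a : SpRes) (Z : Hminus →L[ℂ] Hplus) : Hminus →L[ℂ] Hplus := prP ∘L a.op ∘L graph Z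

/-- The denominator `h̄ Z + ḡ` of the Moebius transformation. -/
def den (a : SpRes) (Z : Hminus →L[ℂ] Hplus) : Hminus →L[ℂ] Hminus := prM ∘L a.op ∘L graph Z

theorem op_graph (a : SpRes) (Z : Hminus →L[ℂ] Hplus) (u : Hminus) :
    a.op (graph Z u) = (a.num Z u : Hilb) + a.den Z u := (prP_add_prM _).symm

theorem num_eq (a : SpRes) (Z : Hminus →L[ℂ] Hplus) : a.num Z = a.g ∘L Z + a.h := by
  ext1 u
  change prP (a.op (Z u + u)) = a.g (Z u) + a.h u
  rw [op_add, map_add, prP_incP, prP_incM, add_zero]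

theorem den_eq (a : SpRes) (Z : Hminus →L[ℂ] Hplus) :
    a.den Z = barMP a.h ∘L Z + barPP a.g := by
  ext1 u
  change prM (a.op (Z u + u)) = barMP a.h (Z u) + barPP a.g u
  rw [op_add, map_add, prM_incP, prM_incM, zero_add]

theorem norm_sq_den (a : SpRes) (Z : Hminus →L[ℂ] Hplus) (u : Hminus) :
    ‖a.den Z u‖ ^ 2 - ‖a.num Z u‖ ^ 2 = ‖u‖ ^ 2 - ‖Z u‖ ^ 2 := by
  have := a.norm_sq_sub_op (graph Z u)
  rwa [prP_graph, prM_graph] at this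

theorem star_op (a : SpRes) : star a.op = -dOp * a⁻¹.op * dOp := by
  have h : dOp * star a.op = a⁻¹.op * dOp := by
    conv_rhs => rw [← a.op_mul_star, ← mul_assoc, ← mul_assoc, op_inv_mul_op, one_mul]
  rw [mul_assoc, ← h, ← mul_assoc, neg_mul, dOp_mul_dOp, neg_neg, one_mul]

/-- Comes from `a* = -d a⁻¹ d` and the scalar action of `d` on both summands. It lets the adjoint be
bounded below by applying `norm_sq_sub_op` to `a⁻¹`. -/
theorem adjoint_den (a : SpRes) (Z : Hminus →L[ℂ] Hplus) (u : Hminus) :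
    ContinuousLinearMap.adjoint (a.den Z) u
      = prM (a⁻¹.op u) - ContinuousLinearMap.adjoint Z (prP (a⁻¹.op u)) := by
  refine ext_inner_right ℂ fun v => ?_
  rw [ContinuousLinearMap.adjoint_inner_left, inner_sub_left,
    ContinuousLinearMap.adjoint_inner_left]
  have h1 : ⟪u, a.den Z v⟫_ℂ = ⟪(u : Hilb), a.op (graph Z v)⟫_ℂ := by
    rw [inner_eq_add, prP_incM, prM_incM, inner_zero_left, zero_add]
    rfl
  have h2 : star a.op u = ((prM (a⁻¹.op u) : Hminus) : Hilb) - (prP (a⁻¹.op u) : Hplus) := by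
    rw [star_op]
    change -(dOp (a⁻¹.op (dOp u))) = _
    rw [dOp_incM, map_smul, map_smul, dOp_apply, smul_smul, ← neg_sub]
    simp
  rw [h1, ← ContinuousLinearMap.adjoint_inner_left, ← ContinuousLinearMap.star_eq_adjoint, h2,
    inner_eq_add, map_sub, map_sub, prP_incM, prM_incM, prP_incP, prM_incP, prP_graph, prM_graph,
    zero_sub, sub_zero, inner_neg_left]
  ring

/-- Both lower bounds have constant `1 - ‖Z‖`. For the denominator, `‖den u‖² ≥ ‖u‖² - ‖Z u‖²`, and
`1 - ‖Z‖²` dominates `(1 - ‖Z‖)²`. For its adjoint, `w = a⁻¹ u` satisfies `‖p₋ w‖² = ‖u‖² + ‖p₊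
w‖²`, so `p₋ w - Z* p₊ w` has norm at least `(1 - ‖Z‖) ‖p₋ w‖ ≥ (1 - ‖Z‖) ‖u‖`. -/
theorem isUnit_den (a : SpRes) {Z : Hminus →L[ℂ] Hplus} (hZ : ‖Z‖ < 1) : IsUnit (a.den Z) := by
  have h0 : 0 < 1 - ‖Z‖ := by linarith
  refine isUnit_of_bounded_below h0 h0 (fun u => ?_) (fun u => ?_)
  · have h1 := a.norm_sq_den Z u
    have h2 := Z.le_opNorm u
    have h3 := pow_le_pow_left₀ (norm_nonneg _) h2 2
    apply le_of_sq_le_sq _ (norm_nonneg _)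
    have h4 : (1 - ‖Z‖) ^ 2 ≤ 1 - ‖Z‖ ^ 2 := by nlinarith [norm_nonneg Z]
    have h5 := mul_le_mul_of_nonneg_right h4 (sq_nonneg ‖u‖)
    rw [mul_pow] at h3 ⊢
    nlinarith [sq_nonneg ‖a.num Z u‖]
  · set w := a⁻¹.op u with hw
    have h1 := a⁻¹.norm_sq_sub_op (u : Hilb)
    rw [prP_incM, prM_incM, norm_zero, ← hw] at h1
    have h2 : ‖prP w‖ ≤ ‖prM w‖ := le_of_sq_le_sq (by nlinarith [sq_nonneg ‖u‖]) (norm_nonneg _)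
    have h3 : ‖u‖ ≤ ‖prM w‖ :=
      le_of_sq_le_sq (by nlinarith [sq_nonneg ‖prP w‖]) (norm_nonneg _)
    rw [adjoint_den, ← hw]
    have h4 := norm_sub_norm_le (prM w) (ContinuousLinearMap.adjoint Z (prP w))
    have h5 := (ContinuousLinearMap.adjoint Z).le_opNorm (prP w)
    rw [LinearIsometryEquiv.norm_map] at h5
    have h6 := mul_le_mul_of_nonneg_left h2 (norm_nonneg Z)
    have h7 := mul_le_mul_of_nonneg_left h3 h0.le
    linarith

/-- The commutator `[d, a]`, as a Hilbert-Schmidt operator. -/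
def lie (a : SpRes) : HS Hilb Hilb := HS.mk _ a.isHilbertSchmidt_lie

@[simp] theorem toCLM_lie (a : SpRes) : HS.toCLM a.lie = dOp * a.op - a.op * dOp := rfl

/-- The upper right block of half the commutator with `d`. -/
def offDiag : HS Hilb Hilb →L[ℂ] HS Hminus Hplus :=
  LinearMap.mkContinuous
    { toFun := fun B => (-Complex.I / 2) • HS.compLeft prP (HS.compRight B incM)
      map_add' := fun B C => by
        rw [map_add, add_apply, map_add, smul_add]
      map_smul' := fun c B => by
        rw [map_smul, smul_apply, map_smul, smul_comm, RingHom.id_apply] }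
    (‖-Complex.I / 2‖ * (‖prP‖ * ‖incM‖)) (fun B => by
      rw [mul_assoc, mul_assoc]
      refine (norm_smul_le _ _).trans (mul_le_mul_of_nonneg_left ?_ (norm_nonneg _))
      refine (HS.norm_compLeft_le _ _).trans (mul_le_mul_of_nonneg_left ?_ (norm_nonneg prP))
      rw [mul_comm]
      exact HS.norm_compRight_le _ _)

theorem toCLM_offDiag (B : HS Hilb Hilb) (u : Hminus) :
    HS.toCLM (offDiag B) u = (-Complex.I / 2) • prP (HS.toCLM B u) := by
  change HS.toCLM ((-Complex.I / 2) • HS.compLeft prP (HS.compRight B incM)) u = _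
  rw [map_smul]
  rfl

/-- On `𝓗₋` followed by `p₊`, the commutator with `d` multiplies by `i - (-i) = 2i`, undone by the
factor `-i/2`. Thus `h` is Hilbert-Schmidt and depends linearly and continuously on `[d, a]`. -/
theorem toCLM_offDiag_lie (a : SpRes) : HS.toCLM (offDiag a.lie) = a.h := by
  ext1 u
  rw [toCLM_offDiag, toCLM_lie]
  change (-Complex.I / 2) • prP (dOp (a.op u) - a.op (dOp u)) = prP (a.op u)
  rw [dOp_incM, map_sub, prP_dOp, map_smul, map_smul, neg_smul, sub_neg_eq_add, ← two_smul ℂ,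
    smul_smul, smul_smul]
  have : -Complex.I / 2 * (2 * Complex.I) = 1 := by
    linear_combination -Complex.I_mul_I
  rw [mul_assoc, this, one_smul]

/-- The Moebius transformation `(g Z + h) (h̄ Z + ḡ)⁻¹`. -/
def moebius (a : SpRes) (Z : HS Hminus Hplus) : HS Hminus Hplus :=
  HS.compRight (HS.compLeft a.g Z + offDiag a.lie) (Ring.inverse (a.den (HS.toCLM Z)))

theorem toCLM_moebius (a : SpRes) (Z : HS Hminus Hplus) :
    HS.toCLM (a.moebius Z) = a.num (HS.toCLM Z) ∘L Ring.inverse (a.den (HS.toCLM Z)) := by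
  rw [moebius, HS.toCLM_compRight, map_add, HS.toCLM_compLeft, toCLM_offDiag_lie, num_eq]

theorem moebius_den (a : SpRes) {Z : HS Hminus Hplus} (hZ : ‖HS.toCLM Z‖ < 1) (u : Hminus) :
    HS.toCLM (a.moebius Z) (a.den (HS.toCLM Z) u) = a.num (HS.toCLM Z) u := by
  rw [toCLM_moebius]
  change a.num (HS.toCLM Z) ((Ring.inverse (a.den (HS.toCLM Z)) * a.den (HS.toCLM Z)) u) = _
  rw [Ring.inverse_mul_cancel _ (a.isUnit_den hZ)]
  rfl

theorem den_surjective (a : SpRes) {Z : HS Hminus Hplus} (hZ : ‖HS.toCLM Z‖ < 1) :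
    Function.Surjective (a.den (HS.toCLM Z)) :=
  ((ContinuousLinearMap.isUnit_iff_bijective).1 (a.isUnit_den hZ)).2

theorem op_graph_moebius (a : SpRes) {Z : HS Hminus Hplus} (hZ : ‖HS.toCLM Z‖ < 1) (u : Hminus) :
    a.op (graph (HS.toCLM Z) u)
      = graph (HS.toCLM (a.moebius Z)) (a.den (HS.toCLM Z) u) := by
  rw [op_graph, graph_apply, moebius_den a hZ]

theorem moebius_mem_symHS (a : SpRes) {Z : HS Hminus Hplus} (hZ : ‖HS.toCLM Z‖ < 1)
    (h : Z ∈ symHS) : a.moebius Z ∈ symHS := by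
  rw [mem_symHS_iff_bil] at h ⊢
  intro u v
  obtain ⟨u, rfl⟩ := a.den_surjective hZ u
  obtain ⟨v, rfl⟩ := a.den_surjective hZ v
  rw [← op_graph_moebius a hZ, ← op_graph_moebius a hZ, bil_op, h]

/-- By `norm_sq_den` the image graph is still strictly positive for the indefinite form; compactness
turns this pointwise bound into a bound on the norm. -/
theorem norm_moebius_lt_one (a : SpRes) {Z : HS Hminus Hplus} (hZ : ‖HS.toCLM Z‖ < 1) :
    ‖HS.toCLM (a.moebius Z)‖ < 1 := by
  refine opNorm_lt_one_of_isCompactOperator (HS.isCompactOperator _) fun v hv => ?_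
  obtain ⟨u, rfl⟩ := a.den_surjective hZ v
  rw [moebius_den a hZ]
  have hu : 0 < ‖u‖ := norm_pos_iff.2 fun h => hv (by rw [h, map_zero])
  have h1 := a.norm_sq_den (HS.toCLM Z) u
  have h2 := (HS.toCLM Z).le_opNorm u
  have h3 : ‖HS.toCLM Z u‖ < ‖u‖ := by nlinarith
  have h4 := pow_lt_pow_left₀ h3 (norm_nonneg _) two_ne_zero
  exact lt_of_pow_lt_pow_left₀ 2 (norm_nonneg _) (by linarith)

/-- Every vector of `𝓗₋` is a value of the denominator, so the image of the graph determines `W`.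
This replaces all block computations, both in the axioms of the action and for `transvection Z •
origin = Z`. -/
theorem eq_moebius (a : SpRes) {Z : HS Hminus Hplus} (hZ : ‖HS.toCLM Z‖ < 1)
    {W : HS Hminus Hplus} {C : Hminus → Hminus}
    (h : ∀ u, a.op (graph (HS.toCLM Z) u) = graph (HS.toCLM W) (C u)) : W = a.moebius Z := by
  apply HS.toCLM_injective
  ext1 v
  obtain ⟨u, rfl⟩ := a.den_surjective hZ v
  have h1 := h u
  rw [op_graph_moebius a hZ] at h1
  have h2 := congrArg prM h1
  have h3 := congrArg prP h1
  rw [prM_graph, prM_graph] at h2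
  rw [prP_graph, prP_graph] at h3
  rw [h3, h2]

end SpRes

theorem norm_lt_one (Z : restrictedSiegelDisc) : ‖HS.toCLM (Z.1 : HS Hminus Hplus)‖ < 1 :=
  (mem_restrictedSiegelDisc_iff _).1 Z.2

/-- The action of `Sp_res(𝓥, Ω)` on the restricted Siegel disc by Moebius transformations. -/
instance moebiusAction : MulAction SpRes restrictedSiegelDisc where
  smul a Z := ⟨⟨a.moebius Z.1, a.moebius_mem_symHS (norm_lt_one Z) Z.1.2⟩,
    (mem_restrictedSiegelDisc_iff _).2 (a.norm_moebius_lt_one (norm_lt_one Z))⟩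
  one_smul Z := by
    apply Subtype.ext
    apply Subtype.ext
    exact ((1 : SpRes).eq_moebius (norm_lt_one Z) (C := id) fun u => by
      rw [SpRes.op_one]; rfl).symm
  mul_smul a b Z := by
    apply Subtype.ext
    apply Subtype.ext
    have hb := b.norm_moebius_lt_one (norm_lt_one Z)
    exact ((a * b).eq_moebius (norm_lt_one Z)
      (C := fun u => a.den (HS.toCLM (b.moebius Z.1)) (b.den (HS.toCLM (Z.1 : HS Hminus Hplus)) u))
      fun u => by
        rw [SpRes.op_mul, mul_apply_eq_comp, SpRes.op_graph_moebius b (norm_lt_one Z),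
          SpRes.op_graph_moebius a hb]
        rfl).symm

theorem coe_smul (a : SpRes) (Z : restrictedSiegelDisc) :
    ((a • Z).1 : HS Hminus Hplus) = a.moebius Z.1 := rfl

/-! ### The Cayley transform linearizes the symplectic relation -/

section StarRing

variable {R : Type} [NormedRing R] [NormedAlgebra ℝ R] [StarRing R] {j x : R}

/-- Multiplying by `(1 + x)*` on the left and `1 + x` on the right clears the denominators and
leaves `2 (x* j x - j)`. -/
theorem star_cayleyFun_mul (h : star x * j * x = j) (hx : IsUnit (1 + x)) :
    star (cayleyFun x) * j + j * cayleyFun x = 0 := by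
  have h1 : cayleyFun x * (1 + x) = x - 1 := by
    rw [cayleyFun, mul_assoc, Ring.inverse_mul_cancel _ hx, mul_one]
  have h2 : star (1 + x) * star (cayleyFun x) = star x - 1 := by
    rw [← star_mul, h1, star_sub, star_one]
  have h3 : star (1 + x) * (star (cayleyFun x) * j + j * cayleyFun x) * (1 + x) = 0 := by
    calc _ = (star (1 + x) * star (cayleyFun x)) * j * (1 + x)
          + star (1 + x) * j * (cayleyFun x * (1 + x)) := by noncomm_ring
      _ = 2 * (star x * j * x) - 2 * j := by
        rw [h1, h2, star_add, star_one]
        noncomm_ring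
      _ = 0 := by rw [h, sub_self]
  rwa [hx.mul_left_eq_zero, hx.star.mul_right_eq_zero] at h3

/-- The converse passage: clearing the denominators `1 - x` leaves `2 (x* j + j x)`. -/
theorem star_cayleyInvFun_mul (h : star x * j + j * x = 0) (hx : IsUnit (1 - x)) :
    star (cayleyInvFun x) * j * cayleyInvFun x = j := by
  have h1 : cayleyInvFun x * (1 - x) = 1 + x := by
    rw [cayleyInvFun, mul_assoc, Ring.inverse_mul_cancel _ hx, mul_one]
  have h2 : star (1 - x) * star (cayleyInvFun x) = star (1 + x) := by
    rw [← star_mul, h1]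
  have h3 : star (1 - x) * (star (cayleyInvFun x) * j * cayleyInvFun x - j) * (1 - x) = 0 := by
    calc _ = (star (1 - x) * star (cayleyInvFun x)) * j * (cayleyInvFun x * (1 - x))
          - star (1 - x) * j * (1 - x) := by noncomm_ring
      _ = 2 * (star x * j + j * x) := by
        rw [h1, h2, star_add, star_one, star_sub, star_one]
        noncomm_ring
      _ = 0 := by rw [h, mul_zero]
  rw [hx.mul_left_eq_zero, hx.star.mul_right_eq_zero] at h3
  exact sub_eq_zero.1 h3

/-- Same computation with the adjoint on the other side; the denominator can be moved to the left
because it commutes with the numerator. -/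
theorem cayleyInvFun_mul_star (h : x * j + j * star x = 0) (hx : IsUnit (1 - x)) :
    cayleyInvFun x * j * star (cayleyInvFun x) = j := by
  have hc : Commute (1 + x) (Ring.inverse (1 - x)) := by
    have h0 : Commute (1 + x) (1 - x) :=
      (Commute.one_left _).add_left ((Commute.one_right x).sub_right (Commute.refl x))
    obtain ⟨u, hu⟩ := hx
    rw [← hu, Ring.inverse_unit]
    rw [← hu] at h0
    exact h0.units_inv_right
  have h1 : (1 - x) * cayleyInvFun x = 1 + x := by
    rw [cayleyInvFun, hc.eq, ← mul_assoc, Ring.mul_inverse_cancel _ hx, one_mul]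
  have h2 : star (cayleyInvFun x) * star (1 - x) = star (1 + x) := by
    rw [← star_mul, h1]
  have h3 : (1 - x) * (cayleyInvFun x * j * star (cayleyInvFun x) - j) * star (1 - x) = 0 := by
    calc _ = ((1 - x) * cayleyInvFun x) * j * (star (cayleyInvFun x) * star (1 - x))
          - (1 - x) * j * star (1 - x) := by noncomm_ring
      _ = 2 * (x * j + j * star x) := by
        rw [h1, h2, star_add, star_one, star_sub, star_one]
        noncomm_ring
      _ = 0 := by rw [h, mul_zero]
  rw [hx.star.mul_left_eq_zero, hx.mul_right_eq_zero] at h3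
  exact sub_eq_zero.1 h3

end StarRing

/-! ### The ambient Banach algebra and the embedding of the group -/

/-- The Banach algebra `B(𝓗) ⊕ L²(𝓗)`, in which `a ↦ (a, [d, a])` is multiplicative. -/
abbrev Amb : Type := TrivSqZeroExt (Hilb →L[ℂ] Hilb) (HS Hilb Hilb)

namespace Amb

open TrivSqZeroExt

/-- The elements `(a, [d, a])`. -/
def HasComm (x : Amb) : Prop := HS.toCLM x.snd = dOp * x.fst - x.fst * dOp

theorem HasComm.ext {x y : Amb} (hx : HasComm x) (hy : HasComm y) (h : x.fst = y.fst) : x = y :=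
  TrivSqZeroExt.ext h (HS.toCLM_injective (by rw [hx, hy, h]))

theorem HasComm.one : HasComm 1 := by
  rw [HasComm, snd_one, fst_one, map_zero, mul_one, one_mul, sub_self]

theorem HasComm.add {x y : Amb} (hx : HasComm x) (hy : HasComm y) : HasComm (x + y) := by
  rw [HasComm] at *
  rw [snd_add, fst_add, map_add, hx, hy]
  noncomm_ring

theorem HasComm.sub {x y : Amb} (hx : HasComm x) (hy : HasComm y) : HasComm (x - y) := by
  rw [HasComm] at *
  rw [snd_sub, fst_sub, map_sub, hx, hy]
  noncomm_ring

/-- The product of the square-zero extension is the Leibniz rule for `[d, ·]`. -/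
theorem HasComm.mul {x y : Amb} (hx : HasComm x) (hy : HasComm y) : HasComm (x * y) := by
  rw [HasComm] at *
  rw [snd_mul, fst_mul, map_add, HS.toCLM_smul', HS.toCLM_op_smul, hx, hy]
  noncomm_ring

theorem fst_inverse {x : Amb} (hx : IsUnit x) : (Ring.inverse x).fst = Ring.inverse x.fst := by
  have h : IsUnit x.fst := isUnit_iff_isUnit_fst.1 hx
  apply h.mul_left_cancel
  rw [Ring.mul_inverse_cancel _ h, ← fst_mul, Ring.mul_inverse_cancel _ hx, fst_one]

/-- The second component of `x x⁻¹ = 1` forces `[d, x⁻¹] = -x⁻¹ [d, x] x⁻¹`. Non-units are sent to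
0, for which the claim is trivial. Consequently both Cayley transforms preserve `HasComm`. -/
theorem HasComm.inverse {x : Amb} (hx : HasComm x) : HasComm (Ring.inverse x) := by
  by_cases h : IsUnit x
  · have h1 := Ring.mul_inverse_cancel _ h
    have hf : x.fst * (Ring.inverse x).fst = 1 := by rw [← fst_mul, h1, fst_one]
    have h2 := congrArg (fun z : Amb => HS.toCLM z.snd) h1
    simp only [snd_mul, snd_one, map_add, map_zero, HS.toCLM_smul', HS.toCLM_op_smul] at h2
    rw [HasComm] at hx ⊢
    have hu : IsUnit x.fst := isUnit_iff_isUnit_fst.1 h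
    apply hu.mul_left_cancel
    rw [eq_neg_of_add_eq_zero_left h2, hx, mul_sub, sub_mul, mul_assoc, hf, ← mul_assoc x.fst,
      ← mul_assoc x.fst, hf]
    simp
  · rw [Ring.inverse_non_unit _ h, HasComm, snd_zero, fst_zero, map_zero, mul_zero, zero_mul,
      sub_zero]

theorem HasComm.cayleyFun {x : Amb} (hx : HasComm x) : HasComm (cayleyFun x) :=
  (hx.sub .one).mul (HasComm.one.add hx).inverse

theorem HasComm.cayleyInvFun {x : Amb} (hx : HasComm x) : HasComm (cayleyInvFun x) :=
  (HasComm.one.add hx).mul (HasComm.one.sub hx).inverse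

theorem fst_cayleyFun {x : Amb} (hx : IsUnit (1 + x)) :
    (SiegelDisc.cayleyFun x).fst = SiegelDisc.cayleyFun x.fst := by
  rw [SiegelDisc.cayleyFun, SiegelDisc.cayleyFun, fst_mul, fst_inverse hx, fst_sub, fst_add,
    fst_one]

theorem fst_cayleyInvFun {x : Amb} (hx : IsUnit (1 - x)) :
    (SiegelDisc.cayleyInvFun x).fst = SiegelDisc.cayleyInvFun x.fst := by
  rw [SiegelDisc.cayleyInvFun, SiegelDisc.cayleyInvFun, fst_mul, fst_inverse hx, fst_sub, fst_add,
    fst_one]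

/-- The underlying Banach space of `Amb`. -/
def toProd : Amb ≃L[ℝ] (Hilb →L[ℂ] Hilb) × HS Hilb Hilb where
  toFun x := (x.fst, x.snd)
  invFun x := inl x.1 + inr x.2
  map_add' _ _ := rfl
  map_smul' _ _ := rfl
  left_inv x := inl_fst_add_inr_snd_eq x
  right_inv x := by ext <;> simp
  continuous_toFun := TrivSqZeroExt.continuous_fst.prodMk TrivSqZeroExt.continuous_snd
  continuous_invFun := (TrivSqZeroExt.continuous_inl.comp _root_.continuous_fst).add
    (TrivSqZeroExt.continuous_inr.comp _root_.continuous_snd)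

@[simp] theorem fst_toProd_symm (x : (Hilb →L[ℂ] Hilb) × HS Hilb Hilb) :
    (toProd.symm x).fst = x.1 := by
  change (inl x.1 + inr x.2 : Amb).fst = _
  simp

@[simp] theorem snd_toProd_symm (x : (Hilb →L[ℂ] Hilb) × HS Hilb Hilb) :
    (toProd.symm x).snd = x.2 := by
  change (inl x.1 + inr x.2 : Amb).snd = _
  simp

end Amb

namespace SpRes

/-- The multiplicative embedding `a ↦ (a, [d, a])`. -/
def toAmb : SpRes →* Amb where
  toFun a := Amb.toProd.symm a.incl
  map_one' := by
    refine Amb.HasComm.ext ?_ .one ?_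
    · rw [Amb.HasComm, Amb.snd_toProd_symm, Amb.fst_toProd_symm]; rfl
    · rw [Amb.fst_toProd_symm]; exact op_one
  map_mul' a b := by
    have h : ∀ a : SpRes, Amb.HasComm (Amb.toProd.symm a.incl) := fun a => by
      rw [Amb.HasComm, Amb.snd_toProd_symm, Amb.fst_toProd_symm]; rfl
    refine Amb.HasComm.ext (h _) ((h _).mul (h _)) ?_
    rw [TrivSqZeroExt.fst_mul, Amb.fst_toProd_symm, Amb.fst_toProd_symm, Amb.fst_toProd_symm]
    exact op_mul a b

@[simp] theorem fst_toAmb (a : SpRes) : (toAmb a).fst = a.op := Amb.fst_toProd_symm _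

@[simp] theorem snd_toAmb (a : SpRes) : (toAmb a).snd = a.lie := Amb.snd_toProd_symm _

theorem hasComm_toAmb (a : SpRes) : Amb.HasComm (toAmb a) := by
  rw [Amb.HasComm, snd_toAmb, fst_toAmb, toCLM_lie]

theorem toProd_toAmb (a : SpRes) : Amb.toProd (toAmb a) = a.incl :=
  Amb.toProd.apply_symm_apply _

theorem isEmbedding_incl : IsEmbedding incl :=
  ⟨⟨rfl⟩, fun _ _ h => ext_op (congrArg Prod.fst h)⟩

theorem isEmbedding_toAmb : IsEmbedding toAmb :=
  Amb.toProd.symm.toHomeomorph.isEmbedding.comp isEmbedding_incl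

end SpRes

/-! ### Block diagonal operators -/

section Diag

theorem diagFun_bound (α : Hplus →L[ℂ] Hplus) :
    ‖incP ∘L α ∘L prP + incM ∘L barPP α ∘L prM‖ ≤ ‖α‖ := by
  refine ContinuousLinearMap.opNorm_le_bound _ (norm_nonneg α) fun x => ?_
  have h1 : prP ((incP ∘L α ∘L prP + incM ∘L barPP α ∘L prM) x) = α (prP x) := by
    change prP ((α (prP x) : Hilb) + (barPP α (prM x) : Hminus)) = _
    rw [map_add, prP_incP, prP_incM, add_zero]
  have h2 : prM ((incP ∘L α ∘L prP + incM ∘L barPP α ∘L prM) x) = barPP α (prM x) := by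
    change prM ((α (prP x) : Hilb) + (barPP α (prM x) : Hminus)) = _
    rw [map_add, prM_incP, prM_incM, zero_add]
  apply le_of_sq_le_sq _ (by positivity)
  rw [norm_sq_eq_add, h1, h2, mul_pow, norm_sq_eq_add x, mul_add, ← mul_pow, ← mul_pow]
  have h3 : ‖barPP α (prM x)‖ ≤ ‖α‖ * ‖prM x‖ := by
    calc ‖barPP α (prM x)‖ = ‖α (conjMinus (prM x))‖ := norm_conjugation _
      _ ≤ ‖α‖ * ‖conjMinus (prM x)‖ := α.le_opNorm _
      _ = ‖α‖ * ‖prM x‖ := congrArg (‖α‖ * ·) (norm_conjugation _)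
  exact add_le_add (pow_le_pow_left₀ (norm_nonneg _) (α.le_opNorm _) 2)
    (pow_le_pow_left₀ (norm_nonneg _) h3 2)

/-- The real block diagonal operator `(α, 0; 0, ᾱ)`. -/
def diag : (Hplus →L[ℂ] Hplus) →L[ℝ] (Hilb →L[ℂ] Hilb) :=
  LinearMap.mkContinuous
    { toFun := fun α => incP ∘L α ∘L prP + incM ∘L barPP α ∘L prM
      map_add' := fun α β => by
        have : barPP (α + β) = barPP α + barPP β := by
          ext1 u
          exact map_add conjPlus (α (conjMinus u)) (β (conjMinus u))
        rw [this]
        simp only [ContinuousLinearMap.add_comp, ContinuousLinearMap.comp_add]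
        abel
      map_smul' := fun c α => by
        have : barPP (c • α) = c • barPP α := by
          ext1 u
          change conjPlus (c • α (conjMinus u)) = c • conjPlus (α (conjMinus u))
          rw [← Complex.coe_smul, map_smulₛₗ, Complex.conj_ofReal, Complex.coe_smul]
        rw [this]
        ext1 x
        change ((c • α (prP x) : Hplus) : Hilb) + ((c • barPP α (prM x) : Hminus) : Hilb)
          = c • ((α (prP x) : Hilb) + (barPP α (prM x) : Hilb))
        rw [smul_add]
        rfl } 1 (fun α => by
      rw [one_mul]
      exact diagFun_bound α)

theorem diag_incP (α : Hplus →L[ℂ] Hplus) (u : Hplus) : diag α u = (α u : Hilb) := by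
  change (α (prP (u : Hilb)) : Hilb) + (barPP α (prM (u : Hilb)) : Hminus) = _
  rw [prP_incP, prM_incP, map_zero, Submodule.coe_zero, add_zero]

theorem diag_incM (α : Hplus →L[ℂ] Hplus) (u : Hminus) : diag α u = (barPP α u : Hilb) := by
  change (α (prP (u : Hilb)) : Hilb) + (barPP α (prM (u : Hilb)) : Hminus) = _
  rw [prP_incM, prM_incM, map_zero, Submodule.coe_zero, zero_add]

/-- Conjugation is an involution exchanging `𝓗₊` and `𝓗₋`, so commutation with it on `𝓗₊` implies
the same on `𝓗₋`. -/
theorem isReal_of_incP {A : Hilb →L[ℂ] Hilb}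
    (h : ∀ u : Hplus, conjugation (A u) = A (conjPlus u : Hilb)) : IsReal A := by
  have h' : ∀ u : Hminus, conjugation (A u) = A (conjMinus u : Hilb) := fun u => by
    have := h (conjMinus u)
    rw [conjPlus_conjMinus] at this
    rw [← this, conjugation_conjugation]
  intro x
  conv_lhs => rw [← prP_add_prM x, map_add, map_add, h, h', ← map_add]
  conv_rhs => rw [← prP_add_prM x, map_add]
  rfl

theorem isReal_diag (α : Hplus →L[ℂ] Hplus) : IsReal (diag α) := by
  refine isReal_of_incP fun u => ?_
  rw [diag_incP, diag_incM]
  change _ = conjugation (α (conjMinus (conjPlus u)) : Hilb)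
  rw [conjMinus_conjPlus]

theorem diag_dOp (α : Hplus →L[ℂ] Hplus) : diag α * dOp = dOp * diag α := by
  apply clm_ext
  · intro u
    rw [mul_apply_eq_comp, mul_apply_eq_comp, dOp_incP, map_smul, diag_incP, dOp_incP]
  · intro u
    rw [mul_apply_eq_comp, mul_apply_eq_comp, dOp_incM, map_smul, diag_incM, dOp_incM]

theorem barPP_mul (α β : Hplus →L[ℂ] Hplus) : barPP (α * β) = barPP α * barPP β := by
  ext1 u
  change conjPlus (α (β (conjMinus u))) = conjPlus (α (conjMinus (conjPlus (β (conjMinus u)))))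
  rw [conjMinus_conjPlus]

theorem diag_mul (α β : Hplus →L[ℂ] Hplus) : diag (α * β) = diag α * diag β := by
  apply clm_ext
  · intro u
    rw [mul_apply_eq_comp, diag_incP, diag_incP, diag_incP]
    rfl
  · intro u
    rw [mul_apply_eq_comp, diag_incM, diag_incM, diag_incM, barPP_mul]
    rfl

theorem diag_one : diag 1 = 1 := by
  apply clm_ext
  · intro u
    rw [diag_incP]
    rfl
  · intro u
    rw [diag_incM]
    exact conjugation_conjugation _

theorem star_barPP (α : Hplus →L[ℂ] Hplus) : star (barPP α) = barPP (star α) := by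
  ext1 w
  refine ext_inner_right ℂ fun u => ?_
  rw [ContinuousLinearMap.star_eq_adjoint, ContinuousLinearMap.adjoint_inner_left,
    ContinuousLinearMap.star_eq_adjoint]
  change ⟪(w : Hilb), conjugation (α (conjMinus u) : Hilb)⟫_ℂ
    = ⟪conjugation (ContinuousLinearMap.adjoint α (conjMinus w) : Hilb), (u : Hilb)⟫_ℂ
  have h1 := inner_conjugation (conjugation (w : Hilb)) (α (conjMinus u) : Hilb)
  rw [conjugation_conjugation] at h1
  rw [h1, inner_conjugation_left, ← inner_conj_symm (conjugation (u : Hilb))]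
  have h2 : ⟪ContinuousLinearMap.adjoint α (conjMinus w), conjMinus u⟫_ℂ
      = ⟪conjMinus w, α (conjMinus u)⟫_ℂ := ContinuousLinearMap.adjoint_inner_left _ _ _
  exact ((congrArg conj h2).trans (inner_conj_symm (α (conjMinus u)) (conjMinus w))).symm

theorem star_diag (α : Hplus →L[ℂ] Hplus) : star (diag α) = diag (star α) := by
  change star (incP ∘L α ∘L prP + incM ∘L barPP α ∘L prM)
    = incP ∘L star α ∘L prP + incM ∘L barPP (star α) ∘L prM
  rw [star_add, ← star_barPP]
  simp only [ContinuousLinearMap.star_eq_adjoint, ContinuousLinearMap.adjoint_comp, adjoint_prP,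
    adjoint_prM, adjoint_incP, adjoint_incM]
  rfl

/-- The upper left block. -/
def blockPP : (Hilb →L[ℂ] Hilb) →L[ℝ] (Hplus →L[ℂ] Hplus) :=
  LinearMap.mkContinuous
    { toFun := fun A => prP ∘L A ∘L incP
      map_add' := fun A B => by
        simp only [ContinuousLinearMap.add_comp, ContinuousLinearMap.comp_add]
      map_smul' := fun c A => by
        ext1 u
        exact prP.map_smul_of_tower c (A u) } (‖prP‖ * ‖incP‖) (fun A => by
      refine (ContinuousLinearMap.opNorm_comp_le _ _).trans ?_
      rw [mul_assoc, mul_comm ‖incP‖]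
      exact mul_le_mul_of_nonneg_left (ContinuousLinearMap.opNorm_comp_le _ _) (norm_nonneg prP))

theorem blockPP_apply (A : Hilb →L[ℂ] Hilb) (u : Hplus) : blockPP A u = prP (A u) := rfl

theorem blockPP_diag (α : Hplus →L[ℂ] Hplus) : blockPP (diag α) = α := by
  ext1 u
  rw [blockPP_apply, diag_incP, prP_incP]

end Diag

/-! ### Off-diagonal operators -/

section OffDiag

/-- The operator `(0, Z; Z*, 0)`. -/
def offOp : symHS →L[ℝ] HS Hilb Hilb where
  toFun Z := HS.compLeft incP (HS.compRight Z.1 prM) + HS.compLeft incM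
    (HS.compRight (HS.adj Z.1) prP)
  map_add' Y Z := by
    apply HS.toCLM_injective
    simp only [map_add, Submodule.coe_add, HS.toCLM_compLeft, HS.toCLM_compRight, add_apply]
    abel
  map_smul' c Z := by
    apply HS.toCLM_injective
    have h : ContinuousLinearMap.adjoint (HS.toCLM (c • Z).1)
        = c • ContinuousLinearMap.adjoint (HS.toCLM Z.1) := by
      have h1 : HS.adj (c • Z.1) = c • HS.adj Z.1 := by
        rw [← Complex.coe_smul, map_smulₛₗ, Complex.conj_ofReal, Complex.coe_smul]
      have h2 := congrArg HS.toCLM h1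
      rwa [HS.toCLM_real_smul] at h2
    rw [RingHom.id_apply, HS.toCLM_real_smul]
    ext1 x
    change (HS.toCLM (c • Z).1 (prM x) : Hilb)
        + (ContinuousLinearMap.adjoint (HS.toCLM (c • Z).1) (prP x) : Hminus)
      = c • ((HS.toCLM Z.1 (prM x) : Hilb)
        + (ContinuousLinearMap.adjoint (HS.toCLM Z.1) (prP x) : Hminus))
    rw [h, smul_add, Submodule.coe_smul_of_tower, HS.toCLM_real_smul]
    rfl
  cont := by
    have h1 : Continuous fun Z : symHS => HS.compRight Z.1 prM :=
      (HS.compRight.continuous.comp continuous_subtype_val).clm_apply continuous_const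
    have h2 : Continuous fun Z : symHS => HS.compRight (HS.adj Z.1) prP :=
      (HS.compRight.continuous.comp (HS.adj.continuous.comp continuous_subtype_val)).clm_apply
        continuous_const
    exact ((HS.compLeft incP).continuous.comp h1).add ((HS.compLeft incM).continuous.comp h2)

theorem offOp_incP (Z : symHS) (u : Hplus) :
    HS.toCLM (offOp Z) u = (ContinuousLinearMap.adjoint (HS.toCLM Z.1) u : Hilb) := by
  change (HS.toCLM Z.1 (prM (u : Hilb)) : Hilb)
    + (ContinuousLinearMap.adjoint (HS.toCLM Z.1) (prP (u : Hilb)) : Hminus) = _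
  rw [prP_incP, prM_incP, map_zero, Submodule.coe_zero, zero_add]

theorem offOp_incM (Z : symHS) (u : Hminus) :
    HS.toCLM (offOp Z) u = (HS.toCLM Z.1 u : Hilb) := by
  change (HS.toCLM Z.1 (prM (u : Hilb)) : Hilb)
    + (ContinuousLinearMap.adjoint (HS.toCLM Z.1) (prP (u : Hilb)) : Hminus) = _
  rw [prP_incM, prM_incM, map_zero, Submodule.coe_zero, add_zero]

/-- Reality of `(0, Z; Z*, 0)` means `Z* = Z̄`; the symmetry of `Z` is used here. -/
theorem isReal_offOp (Z : symHS) : IsReal (HS.toCLM (offOp Z)) := by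
  refine isReal_of_incP fun u => ?_
  rw [offOp_incP, offOp_incM, conjugation_adjoint Z.2]

/-- The operator exchanges the eigenspaces of `d` for `i` and `-i`. Its commutator with `d` is
therefore `2 d X`, again Hilbert-Schmidt. -/
theorem offOp_dOp (Z : symHS) : HS.toCLM (offOp Z) * dOp = -(dOp * HS.toCLM (offOp Z)) := by
  apply clm_ext
  · intro u
    rw [neg_apply, mul_apply_eq_comp, mul_apply_eq_comp, dOp_incP, map_smul, offOp_incP, dOp_incM,
      neg_smul, neg_neg]
  · intro u
    rw [neg_apply, mul_apply_eq_comp, mul_apply_eq_comp, dOp_incM, map_smul, offOp_incM, dOp_incP,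
      neg_smul]

theorem star_offOp (Z : symHS) : star (HS.toCLM (offOp Z)) = HS.toCLM (offOp Z) := by
  change star (incP ∘L HS.toCLM Z.1 ∘L prM
      + incM ∘L ContinuousLinearMap.adjoint (HS.toCLM Z.1) ∘L prP)
    = incP ∘L HS.toCLM Z.1 ∘L prM + incM ∘L ContinuousLinearMap.adjoint (HS.toCLM Z.1) ∘L prP
  rw [star_add]
  simp only [ContinuousLinearMap.star_eq_adjoint, ContinuousLinearMap.adjoint_comp, adjoint_prP,
    adjoint_prM, adjoint_incP, adjoint_incM, ContinuousLinearMap.adjoint_adjoint]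
  rw [add_comm]
  rfl

theorem norm_offOp_le (Z : symHS) : ‖HS.toCLM (offOp Z)‖ ≤ ‖HS.toCLM Z.1‖ := by
  refine ContinuousLinearMap.opNorm_le_bound _ (norm_nonneg (HS.toCLM Z.1)) fun x => ?_
  have hx : HS.toCLM (offOp Z) x = (HS.toCLM Z.1 (prM x) : Hilb)
    + (ContinuousLinearMap.adjoint (HS.toCLM Z.1) (prP x) : Hminus) := rfl
  apply le_of_sq_le_sq _ (by positivity)
  rw [norm_sq_eq_add, hx, map_add, map_add, prP_incP, prP_incM, prM_incP, prM_incM, add_zero,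
    zero_add, mul_pow, norm_sq_eq_add x, mul_add, ← mul_pow, ← mul_pow, add_comm]
  have h1 := (ContinuousLinearMap.adjoint (HS.toCLM Z.1)).le_opNorm (prP x)
  rw [LinearIsometryEquiv.norm_map] at h1
  exact add_le_add (pow_le_pow_left₀ (norm_nonneg _) h1 2)
    (pow_le_pow_left₀ (norm_nonneg _) ((HS.toCLM Z.1).le_opNorm _) 2)

/-- The commutator of `d` and `offOp Z`. -/
def lieOffOp : symHS →L[ℝ] HS Hilb Hilb :=
  ((2 : ℝ) • (HS.compLeft dOp).restrictScalars ℝ) ∘L offOp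

theorem toCLM_lieOffOp (Z : symHS) :
    HS.toCLM (lieOffOp Z) = dOp * HS.toCLM (offOp Z) - HS.toCLM (offOp Z) * dOp := by
  change HS.toCLM ((2 : ℝ) • HS.compLeft dOp (offOp Z)) = _
  rw [HS.toCLM_real_smul, two_smul, HS.toCLM_compLeft, offOp_dOp, sub_neg_eq_add]
  rfl

theorem offDiag_lieOffOp (Z : symHS) : SpRes.offDiag (lieOffOp Z) = Z.1 := by
  apply HS.toCLM_injective
  ext1 u
  rw [SpRes.toCLM_offDiag, toCLM_lieOffOp, sub_apply, mul_apply_eq_comp, mul_apply_eq_comp,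
    dOp_incM, map_smul, offOp_incM, dOp_incP, map_sub, map_smul, map_smul, prP_incP, ← sub_smul,
    smul_smul]
  have : -Complex.I / 2 * (Complex.I - -Complex.I) = 1 := by
    linear_combination -Complex.I_mul_I
  rw [this, one_smul]

end OffDiag

/-! ### The Lie algebra as a complemented real subspace -/

section Skew

variable {E : Type} [NormedAddCommGroup E] [InnerProductSpace ℂ E] [CompleteSpace E]

theorem star_real_smul (c : ℝ) (A : E →L[ℂ] E) : star (c • A) = c • star A := by
  have h : ∀ B : E →L[ℂ] E, c • B = (c : ℂ) • B := fun B => by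
    ext1 x
    exact (Complex.coe_smul c (B x)).symm
  rw [h, h, star_smul, Complex.star_def, Complex.conj_ofReal]

variable (E) in
/-- The real subspace of skew adjoint operators. -/
def skew : Submodule ℝ (E →L[ℂ] E) where
  carrier := {A | star A = -A}
  add_mem' {A B} hA hB := by
    simp only [Set.mem_ofPred_eq] at *
    rw [star_add, hA, hB, neg_add]
  zero_mem' := by simp
  smul_mem' c A hA := by
    simp only [Set.mem_ofPred_eq] at *
    rw [star_real_smul, hA, smul_neg]

instance : CompleteSpace (skew E) :=
  IsClosed.completeSpace_coe (s := (skew E : Set (E →L[ℂ] E)))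
    (hs := isClosed_eq continuous_star continuous_neg)

instance skew.normedSpace : NormedSpace ℝ (skew E) := Submodule.normedSpace _

/-- The skew adjoint part. -/
def skewPart : (E →L[ℂ] E) →L[ℝ] skew E :=
  ContinuousLinearMap.codRestrict
    { toFun := fun A => (1 / 2 : ℝ) • (A - star A)
      map_add' := fun A B => by rw [star_add, ← smul_add]; congr 1; abel
      map_smul' := fun c A => by rw [star_real_smul, ← smul_sub, smul_comm, RingHom.id_apply]
      cont := by
        have h : Continuous fun A : E →L[ℂ] E => A - star A := continuous_id.sub continuous_star
        exact h.const_smul (1 / 2 : ℝ) }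
    (skew E) fun A => by
      change star ((1 / 2 : ℝ) • (A - star A)) = -((1 / 2 : ℝ) • (A - star A))
      rw [star_real_smul, star_sub, star_star, ← smul_neg, neg_sub]

theorem skewPart_coe (A : skew E) : skewPart A.1 = A := by
  apply Subtype.ext
  change (1 / 2 : ℝ) • (A.1 - star A.1) = A.1
  have h : star A.1 = -A.1 := A.2
  rw [h, sub_neg_eq_add, ← two_smul ℝ, smul_smul]
  norm_num

end Skew

/-- The Lie algebra of the unitary group of `𝓗₊`. -/
def LieU : Type := skew Hplus

namespace LieU

instance : NormedAddCommGroup LieU := inferInstanceAs (NormedAddCommGroup (skew Hplus))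
instance : NormedSpace ℝ LieU := skew.normedSpace
instance : CompleteSpace LieU := inferInstanceAs (CompleteSpace (skew Hplus))

/-- The underlying operator. -/
def val : LieU →L[ℝ] (Hplus →L[ℂ] Hplus) := (skew Hplus).subtypeL

/-- The skew adjoint part of an operator. -/
def part : (Hplus →L[ℂ] Hplus) →L[ℝ] LieU := skewPart

theorem star_val (Y : LieU) : star (val Y) = -val Y := Y.2

theorem part_val (Y : LieU) : part (val Y) = Y := skewPart_coe Y

theorem val_part {A : Hplus →L[ℂ] Hplus} (hA : star A = -A) : val (part A) = A :=
  congrArg Subtype.val (skewPart_coe (⟨A, hA⟩ : skew Hplus))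

end LieU

theorem prM_eq_conjugation (x : Hilb) : prM x = conjPlus (prP (conjugation x)) := by
  conv_lhs => rw [← conjugation_conjugation x, ← prP_add_prM (conjugation x), map_add, map_add]
  have h1 : prM (conjugation (prP (conjugation x) : Hilb)) = conjPlus (prP (conjugation x)) :=
    prM_incM (conjPlus (prP (conjugation x)))
  have h2 : prM (conjugation (prM (conjugation x) : Hilb)) = 0 :=
    prM_incP (conjMinus (prM (conjugation x)))
  rw [h1, h2, add_zero]

/-- Real operators are determined by their first block row. -/
theorem IsReal.ext {A B : Hilb →L[ℂ] Hilb} (hA : IsReal A) (hB : IsReal B)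
    (h : ∀ u : Hplus, prP (A u) = prP (B u)) (h' : ∀ u : Hminus, prP (A u) = prP (B u)) :
    A = B := by
  have hP : ∀ x, prP (A x) = prP (B x) := fun x => by
    rw [← prP_add_prM x, map_add, map_add, map_add, map_add, h, h']
  ext1 x
  refine hilb_ext (hP x) ?_
  rw [prM_eq_conjugation, prM_eq_conjugation, hA, hB, hP]

/-- The Lie algebra of `Sp_res(𝓥, Ω)`, in block form. -/
abbrev LieSp : Type := symHS × LieU

namespace LieSp

/-- The operator with blocks `(α, Z; Z*, ᾱ)` together with its commutator with `d`. -/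
def toAmb : LieSp →L[ℝ] Amb :=
  Amb.toProd.symm.toContinuousLinearMap ∘L
    ((HS.toCLML.restrictScalars ℝ ∘L offOp ∘L ContinuousLinearMap.fst ℝ symHS LieU
      + diag ∘L LieU.val ∘L ContinuousLinearMap.snd ℝ symHS LieU).prod
      (lieOffOp ∘L ContinuousLinearMap.fst ℝ symHS LieU))

theorem fst_toAmb (x : LieSp) : (toAmb x).fst = HS.toCLM (offOp x.1) + diag (LieU.val x.2) :=
  Amb.fst_toProd_symm _

theorem snd_toAmb (x : LieSp) : (toAmb x).snd = lieOffOp x.1 := Amb.snd_toProd_symm _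

/-- A continuous left inverse of `toAmb`. -/
def ofAmb : Amb →L[ℝ] LieSp :=
  ((symHS.orthogonalProjectionOnto.restrictScalars ℝ ∘L SpRes.offDiag.restrictScalars ℝ ∘L
      ContinuousLinearMap.snd ℝ (Hilb →L[ℂ] Hilb) (HS Hilb Hilb)).prod
    (LieU.part ∘L blockPP ∘L ContinuousLinearMap.fst ℝ (Hilb →L[ℂ] Hilb) (HS Hilb Hilb))) ∘L
  Amb.toProd.toContinuousLinearMap

theorem ofAmb_apply (x : Amb) :
    ofAmb x = (symHS.orthogonalProjectionOnto (SpRes.offDiag x.snd), LieU.part (blockPP x.fst)) :=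
  rfl

theorem ofAmb_toAmb (x : LieSp) : ofAmb (toAmb x) = x := by
  rw [ofAmb_apply, fst_toAmb, snd_toAmb, offDiag_lieOffOp,
    Submodule.orthogonalProjectionOnto_mem_subspace_eq_self, map_add, blockPP_diag]
  have h : blockPP (HS.toCLM (offOp x.1)) = 0 := by
    ext1 u
    rw [blockPP_apply, offOp_incP, prP_incM, zero_apply]
  rw [h, zero_add, LieU.part_val]

theorem hasComm_toAmb (x : LieSp) : Amb.HasComm (toAmb x) := by
  rw [Amb.HasComm, fst_toAmb, snd_toAmb, toCLM_lieOffOp, mul_add, add_mul, diag_dOp]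
  abel

theorem isReal_toAmb (x : LieSp) : IsReal (toAmb x).fst := by
  rw [fst_toAmb]
  exact (isReal_offOp _).add (isReal_diag _)

theorem star_toAmb_mul (x : LieSp) : star (toAmb x).fst * dOp + dOp * (toAmb x).fst = 0 := by
  rw [fst_toAmb, star_add, star_offOp, star_diag, LieU.star_val, map_neg, add_mul, mul_add, neg_mul, diag_dOp,
    offOp_dOp]
  abel

theorem toAmb_mul_star (x : LieSp) : (toAmb x).fst * dOp + dOp * star (toAmb x).fst = 0 := by
  rw [fst_toAmb, star_add, star_offOp, star_diag, LieU.star_val, map_neg, add_mul, mul_add, mul_neg, diag_dOp,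
    offOp_dOp]
  abel

/-- The Hamiltonian operators are the elements of the Lie algebra. -/
theorem toAmb_ofAmb {x : Amb} (hx : x.HasComm) (hr : IsReal x.fst)
    (hs : star x.fst * dOp + dOp * x.fst = 0) : toAmb (ofAmb x) = x := by
  have hinner : ∀ u v : Hilb, ⟪x.fst u, dOp v⟫_ℂ + ⟪u, dOp (x.fst v)⟫_ℂ = 0 := fun u v => by
    rw [← ContinuousLinearMap.adjoint_inner_right, ← ContinuousLinearMap.star_eq_adjoint,
      ← inner_add_right]
    change ⟪u, (star x.fst * dOp + dOp * x.fst) v⟫_ℂ = 0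
    rw [hs, zero_apply, inner_zero_right]
  have hoff : ∀ u : Hminus, HS.toCLM (SpRes.offDiag x.snd) u = prP (x.fst u) := fun u => by
    rw [SpRes.toCLM_offDiag, hx, sub_apply, mul_apply_eq_comp, mul_apply_eq_comp, dOp_incM,
      map_sub, prP_dOp, map_smul, map_smul, neg_smul, sub_neg_eq_add, ← two_smul ℂ,
      smul_smul, smul_smul]
    have : -Complex.I / 2 * (2 * Complex.I) = 1 := by
      linear_combination -Complex.I_mul_I
    rw [mul_assoc, this, one_smul]
  -- Evaluate the Hamiltonian identity on `v̄ ∈ 𝓗₊` and `u ∈ 𝓗₋`: `d` acts by scalars, reality turns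
  -- `x v̄` into the conjugate of `x v`, and what remains is the symmetry of the off-diagonal block.
  have hsym : SpRes.offDiag x.snd ∈ symHS := by
    refine mem_symHS_of_inner fun u v => ?_
    rw [hoff, hoff]
    have h1 : ∀ u v : Hminus, ⟪conjugation (v : Hilb), (prP (x.fst u) : Hilb)⟫_ℂ
        = ⟪conjugation (v : Hilb), x.fst u⟫_ℂ := fun u v => by
      conv_rhs => rw [← prP_add_prM (x.fst u), inner_add_right]
      have : ⟪conjugation (v : Hilb), (prM (x.fst u) : Hilb)⟫_ℂ = 0 :=
        inner_eq_zero_symm.1 (inner_eq_zero_of_mem (conjMinus v).2 (prM (x.fst u)).2)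
      rw [this, add_zero]
    rw [h1, h1]
    have h2 := hinner (conjugation (v : Hilb)) u
    have h3 : ⟪conjugation (v : Hilb), dOp (x.fst u)⟫_ℂ
        = Complex.I * ⟪conjugation (v : Hilb), x.fst u⟫_ℂ := by
      have h4 : dOp (conjugation (v : Hilb)) = Complex.I • conjugation (v : Hilb) :=
        dOp_incP (conjMinus v)
      rw [← ContinuousLinearMap.adjoint_inner_left, ← ContinuousLinearMap.star_eq_adjoint, star_dOp,
        neg_apply, h4, inner_neg_left, inner_smul_left, Complex.conj_I]
      ring
    rw [h3, ← hr, dOp_incM, inner_smul_right, inner_conjugation_left] at h2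
    have h5 : Complex.I * (⟪conjugation (v : Hilb), x.fst u⟫_ℂ
        - ⟪conjugation (u : Hilb), x.fst v⟫_ℂ) = 0 := by
      linear_combination h2
    exact sub_eq_zero.1 ((mul_eq_zero.1 h5).resolve_left Complex.I_ne_zero)
  -- Evaluated on two vectors of `𝓗₊`, where `d = i`, the same identity says that the diagonal block
  -- is skew.
  have hskew : star (blockPP x.fst) = -blockPP x.fst := by
    ext1 u
    refine ext_inner_right ℂ fun v => ?_
    rw [ContinuousLinearMap.star_eq_adjoint, ContinuousLinearMap.adjoint_inner_left, neg_apply,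
      inner_neg_left]
    have h1 : ∀ u v : Hplus, ⟪u, blockPP x.fst v⟫_ℂ = ⟪(u : Hilb), x.fst v⟫_ℂ := fun u v => by
      rw [inner_eq_add, prP_incP, prM_incP, inner_zero_left, add_zero]
      rfl
    have h2 := hinner u v
    rw [dOp_incP, inner_smul_right, ← ContinuousLinearMap.adjoint_inner_left dOp,
      ← ContinuousLinearMap.star_eq_adjoint, star_dOp, neg_apply, dOp_incP, inner_neg_left,
      inner_smul_left, Complex.conj_I] at h2
    have h5 : Complex.I * (⟪x.fst u, (v : Hilb)⟫_ℂ + ⟪(u : Hilb), x.fst v⟫_ℂ) = 0 := by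
      linear_combination h2
    have h6 := (mul_eq_zero.1 h5).resolve_left Complex.I_ne_zero
    rw [h1, ← inner_conj_symm (blockPP x.fst u) v, h1, inner_conj_symm]
    exact eq_neg_of_add_eq_zero_right h6
  refine Amb.HasComm.ext (hasComm_toAmb _) hx ?_
  rw [fst_toAmb]
  have h1 : (ofAmb x).1 = ⟨SpRes.offDiag x.snd, hsym⟩ :=
    Submodule.orthogonalProjectionOnto_mem_subspace_eq_self
      (⟨SpRes.offDiag x.snd, hsym⟩ : symHS)
  have h2 : LieU.val (ofAmb x).2 = blockPP x.fst := LieU.val_part hskew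
  have hP : ∀ u : Hminus, prP ((HS.toCLM (offOp (ofAmb x).1) + diag (LieU.val (ofAmb x).2)) u)
      = prP (x.fst u) := fun u => by
    rw [add_apply, offOp_incM, diag_incM, map_add, prP_incP, prP_incM, add_zero, h1, hoff]
  have hP' : ∀ u : Hplus, prP ((HS.toCLM (offOp (ofAmb x).1) + diag (LieU.val (ofAmb x).2)) u)
      = prP (x.fst u) := fun u => by
    rw [add_apply, offOp_incP, diag_incP, map_add, prP_incP, prP_incM, zero_add, h2]
    rfl
  exact ((isReal_offOp _).add (isReal_diag _)).ext hr hP' hP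

end LieSp

theorem Amb.HasComm.isHilbertSchmidt {x : Amb} (hx : x.HasComm) :
    IsHilbertSchmidt (⁅dOp, x.fst⁆ : Hilb →L[ℂ] Hilb) := by
  have h := HS.isHilbertSchmidt x.snd
  rwa [hx] at h

theorem IsReal.cayleyFun {A : Hilb →L[ℂ] Hilb} (hA : IsReal A) : IsReal (cayleyFun A) :=
  (hA.sub .one).mul (IsReal.one.add hA).inverse

theorem IsReal.cayleyInvFun {A : Hilb →L[ℂ] Hilb} (hA : IsReal A) : IsReal (cayleyInvFun A) :=
  (IsReal.one.add hA).mul (IsReal.one.sub hA).inverse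

/-! ### Cayley charts of the restricted symplectic group -/

namespace SpRes

/-- The element of `Sp_res(𝓥, Ω)` given by an element of `Amb`. -/
def ofAmb (x : Amb) (hx : x.HasComm) (hr : IsReal x.fst) (h1 : star x.fst * dOp * x.fst = dOp)
    (h2 : x.fst * dOp * star x.fst = dOp) : SpRes :=
  ofOp x.fst hr h1 h2 hx.isHilbertSchmidt

theorem toAmb_ofAmb (x : Amb) (hx : x.HasComm) (hr : IsReal x.fst)
    (h1 : star x.fst * dOp * x.fst = dOp) (h2 : x.fst * dOp * star x.fst = dOp) :
    toAmb (ofAmb x hx hr h1 h2) = x :=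
  (hasComm_toAmb _).ext hx ((fst_toAmb _).trans (op_ofOp _ _ _ _ _))

/-- The Cayley charts of `Sp_res(𝓥, Ω)`. -/
def cayleyModel : CayleyModel SpRes Amb LieSp where
  toHom := toAmb
  isEmbedding := isEmbedding_toAmb
  lie := LieSp.toAmb
  proj := LieSp.ofAmb
  proj_lie := LieSp.ofAmb_toAmb
  cayley_mem a ha := by
    have hf : IsUnit (1 + a.op) := by
      have := TrivSqZeroExt.isUnit_iff_isUnit_fst.1 ha
      rwa [TrivSqZeroExt.fst_add, TrivSqZeroExt.fst_one, fst_toAmb] at this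
    refine LieSp.toAmb_ofAmb (hasComm_toAmb a).cayleyFun ?_ ?_
    · rw [Amb.fst_cayleyFun ha, fst_toAmb]
      exact a.isReal_op.cayleyFun
    · rw [Amb.fst_cayleyFun ha, fst_toAmb]
      exact star_cayleyFun_mul a.star_op_mul hf
  cayleyInv_mem x hx := by
    have hf : IsUnit (1 - (LieSp.toAmb x).fst) := by
      have := TrivSqZeroExt.isUnit_iff_isUnit_fst.1 hx
      rwa [TrivSqZeroExt.fst_sub, TrivSqZeroExt.fst_one] at this
    refine ⟨ofAmb (cayleyInvFun (LieSp.toAmb x)) (LieSp.hasComm_toAmb x).cayleyInvFun ?_ ?_ ?_,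
      toAmb_ofAmb _ _ _ _ _⟩
    · rw [Amb.fst_cayleyInvFun hx]
      exact (LieSp.isReal_toAmb x).cayleyInvFun
    · rw [Amb.fst_cayleyInvFun hx]
      exact star_cayleyInvFun_mul (LieSp.star_toAmb_mul x) hf
    · rw [Amb.fst_cayleyInvFun hx]
      exact cayleyInvFun_mul_star (LieSp.toAmb_mul_star x) hf

end SpRes

/-! ### Transvections: an explicit smooth section of the orbit map -/

section Section

/-- The argument `-X²` of the inverse square root, for `X = (0, Z; Z*, 0)`. -/
def negSq (Z : symHS) : Hilb →L[ℂ] Hilb := -(HS.toCLM (offOp Z) * HS.toCLM (offOp Z))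

theorem norm_negSq_lt_one {Z : symHS} (hZ : Z ∈ restrictedSiegelDisc) : ‖negSq Z‖ < 1 := by
  have h1 : ‖HS.toCLM (offOp Z)‖ < 1 :=
    (norm_offOp_le Z).trans_lt ((mem_restrictedSiegelDisc_iff Z).1 hZ)
  rw [negSq, norm_neg]
  refine (norm_mul_le _ _).trans_lt ?_
  nlinarith [norm_nonneg (HS.toCLM (offOp Z))]

theorem IsReal.pow {A : Hilb →L[ℂ] Hilb} (hA : IsReal A) (n : ℕ) : IsReal (A ^ n) := by
  induction n with
  | zero => exact .one
  | succ n ih => rw [pow_succ]; exact ih.mul hA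

theorem IsReal.invSqrt {A : Hilb →L[ℂ] Hilb} (hA : IsReal A) (h : ‖A‖ < 1) :
    IsReal (invSqrt A) := fun x => by
  have hc : ∀ (c : ℝ) (y : Hilb), conjugation (c • y) = c • conjugation y := fun c y => by
    rw [← Complex.coe_smul, map_smulₛₗ, Complex.conj_ofReal, Complex.coe_smul]
  let f : (Hilb →L[ℂ] Hilb) →L[ℝ] Hilb :=
    { toFun := fun B => conjugation (B x)
      map_add' := fun B C => by rw [add_apply, map_add]
      map_smul' := fun c B => hc c (B x)
      cont := conjugation.continuous.comp (continuous_eval_const x) }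
  let g : (Hilb →L[ℂ] Hilb) →L[ℝ] Hilb :=
    { toFun := fun B => B (conjugation x)
      map_add' := fun B C => by rw [add_apply]
      map_smul' := fun c B => rfl
      cont := continuous_eval_const _ }
  exact map_invSqrt_eq f g h fun n => hA.pow n x

theorem star_invSqrt {A : Hilb →L[ℂ] Hilb} (hA : star A = A) (h : ‖A‖ < 1) :
    star (invSqrt A) = invSqrt A := by
  let f : (Hilb →L[ℂ] Hilb) →L[ℝ] (Hilb →L[ℂ] Hilb) :=
    { toFun := star
      map_add' := star_add
      map_smul' := star_real_smul
      cont := continuous_star }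
  exact map_invSqrt_eq f (.id ℝ _) h fun n => by
    change star (A ^ n) = A ^ n
    rw [star_pow, hA]

variable {Z : symHS} (hZ : Z ∈ restrictedSiegelDisc)
include hZ

theorem commute_offOp : Commute (invSqrt (negSq Z)) (HS.toCLM (offOp Z)) :=
  commute_invSqrt (norm_negSq_lt_one hZ)
    (((Commute.refl _).mul_left (Commute.refl _)).neg_left)

/-- As `d` anticommutes with `X`, it commutes with `X²` and with every power series in it. -/
theorem commute_dOp : Commute (invSqrt (negSq Z)) dOp := by
  refine commute_invSqrt (norm_negSq_lt_one hZ) (Commute.neg_left ?_)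
  change HS.toCLM (offOp Z) * HS.toCLM (offOp Z) * dOp = _
  rw [mul_assoc, offOp_dOp, mul_neg, ← mul_assoc, offOp_dOp, neg_mul, neg_neg, mul_assoc]

end Section

/-- The positive real symplectic operator that takes the origin to `Z`, and its commutator with
`d`. -/
def transvectionAmb (Z : symHS) : Amb :=
  Amb.toProd.symm ((1 + HS.toCLM (offOp Z)) * invSqrt (negSq Z),
    HS.compRight (lieOffOp Z) (invSqrt (negSq Z)))

theorem fst_transvectionAmb (Z : symHS) :
    (transvectionAmb Z).fst = (1 + HS.toCLM (offOp Z)) * invSqrt (negSq Z) := Amb.fst_toProd_symm _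

/-- Writing `R` for the inverse square root, which commutes with `d`, one has `[d, (1 + X) R] = [d,
X] R`. -/
theorem hasComm_transvectionAmb {Z : symHS} (hZ : Z ∈ restrictedSiegelDisc) :
    (transvectionAmb Z).HasComm := by
  rw [Amb.HasComm, transvectionAmb, Amb.fst_toProd_symm, Amb.snd_toProd_symm, HS.toCLM_compRight,
    toCLM_lieOffOp]
  change (dOp * HS.toCLM (offOp Z) - HS.toCLM (offOp Z) * dOp) * invSqrt (negSq Z) = _
  rw [mul_assoc (1 + _), (commute_dOp hZ).eq]
  noncomm_ring

theorem star_transvection {Z : symHS} (hZ : Z ∈ restrictedSiegelDisc) :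
    star (transvectionAmb Z).fst = (transvectionAmb Z).fst := by
  have h : star (negSq Z) = negSq Z := by rw [negSq, star_neg, star_mul, star_offOp]
  rw [fst_transvectionAmb, star_mul, star_add, star_one, star_offOp,
    star_invSqrt h (norm_negSq_lt_one hZ), mul_add, add_mul, (commute_offOp hZ).eq, mul_one,
    one_mul]

/-- With `R = (1 - X²)^(-1/2)` commuting with `X` and `d`, and `(1 + X) d = d (1 - X)`, the product
collapses to `d R (1 - X²) R = d`. The operator is self-adjoint, so this one identity yields both
symplectic relations. -/
theorem transvection_mul {Z : symHS} (hZ : Z ∈ restrictedSiegelDisc) :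
    (transvectionAmb Z).fst * dOp * (transvectionAmb Z).fst = dOp := by
  have h1 : (1 + HS.toCLM (offOp Z)) * invSqrt (negSq Z)
      = invSqrt (negSq Z) * (1 + HS.toCLM (offOp Z)) := by
    rw [mul_add, add_mul, (commute_offOp hZ).eq, mul_one, one_mul]
  have h2 := invSqrt_mul_self (norm_negSq_lt_one hZ)
  have h3 : (1 + HS.toCLM (offOp Z)) * dOp = dOp * (1 - HS.toCLM (offOp Z)) := by
    rw [add_mul, offOp_dOp, mul_sub, one_mul, mul_one, sub_eq_add_neg]
  rw [fst_transvectionAmb]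
  nth_rw 1 [h1]
  calc _ = invSqrt (negSq Z) * ((1 + HS.toCLM (offOp Z)) * dOp) * (1 + HS.toCLM (offOp Z))
        * invSqrt (negSq Z) := by simp only [mul_assoc]
    _ = invSqrt (negSq Z) * dOp * ((1 - HS.toCLM (offOp Z)) * (1 + HS.toCLM (offOp Z)))
        * invSqrt (negSq Z) := by rw [h3]; simp only [mul_assoc]
    _ = dOp * (invSqrt (negSq Z) * (1 + negSq Z) * invSqrt (negSq Z)) := by
      rw [(commute_dOp hZ).eq, negSq]
      noncomm_ring
    _ = dOp := by
      have h4 : Commute (invSqrt (negSq Z)) (1 + negSq Z) :=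
        (Commute.one_right _).add_right (((commute_offOp hZ).mul_right (commute_offOp hZ)).neg_right)
      rw [h4.eq, mul_assoc, h2, mul_one]

theorem isReal_transvection {Z : symHS} (hZ : Z ∈ restrictedSiegelDisc) :
    IsReal (transvectionAmb Z).fst := by
  rw [fst_transvectionAmb]
  exact (IsReal.one.add (isReal_offOp Z)).mul
    (((isReal_offOp Z).mul (isReal_offOp Z)).neg.invSqrt (norm_negSq_lt_one hZ))

/-- The positive element of `Sp_res(𝓥, Ω)` that takes the origin to `Z`. -/
def transvection (Z : restrictedSiegelDisc) : SpRes :=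
  SpRes.ofAmb (transvectionAmb Z) (hasComm_transvectionAmb Z.2) (isReal_transvection Z.2)
    (by rw [star_transvection Z.2, transvection_mul Z.2])
    (by rw [star_transvection Z.2, transvection_mul Z.2])

theorem toAmb_transvection (Z : restrictedSiegelDisc) :
    SpRes.toAmb (transvection Z) = transvectionAmb Z := SpRes.toAmb_ofAmb _ _ _ _ _

/-- The graph of `0` is `𝓗₋`. The inverse square root `R` commutes with `d` and so preserves `𝓗₋`;
then `(1 + X) R u = R u + Z (R u)` lies on the graph of `Z`, and `eq_moebius` concludes. -/
theorem transvection_smul_origin (Z : restrictedSiegelDisc) : transvection Z • origin = Z := by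
  apply Subtype.ext
  apply Subtype.ext
  refine ((transvection Z).eq_moebius (norm_lt_one origin)
    (C := fun u => prM (invSqrt (negSq Z) u)) fun u => ?_).symm
  have h1 : (transvection Z).op = (1 + HS.toCLM (offOp Z)) * invSqrt (negSq Z) := by
    rw [← fst_transvectionAmb, ← toAmb_transvection, SpRes.fst_toAmb]
  -- `R u` is an eigenvector of `d` for `-i`, whereas `p₊ d = i p₊`; hence `2i` annihilates `p₊ R
  -- u`.
  have h2 : prP (invSqrt (negSq Z) (u : Hilb)) = 0 := by
    have h3 : invSqrt (negSq Z) (dOp u) = dOp (invSqrt (negSq Z) u) :=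
      congrArg (fun A : Hilb →L[ℂ] Hilb => A u) (commute_dOp Z.2).eq
    have h4 := congrArg prP h3
    rw [dOp_incM, map_smul, map_smul, prP_dOp, neg_smul, neg_eq_iff_add_eq_zero, ← two_smul ℂ,
      smul_smul] at h4
    exact (smul_eq_zero.1 h4).resolve_left (by simp)
  have h3 : invSqrt (negSq Z) (u : Hilb) = (prM (invSqrt (negSq Z) (u : Hilb)) : Hilb) := by
    conv_lhs => rw [← prP_add_prM (invSqrt (negSq Z) (u : Hilb)), h2, Submodule.coe_zero, zero_add]
  have h4 : graph (HS.toCLM (origin.1 : HS Hminus Hplus)) u = u := by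
    rw [graph_apply]
    change ((HS.toCLM (0 : HS Hminus Hplus) u : Hplus) : Hilb) + u = u
    rw [map_zero, zero_apply, Submodule.coe_zero, zero_add]
  rw [h4, h1, mul_apply_eq_comp, h3, prM_incM, graph_apply, add_apply, offOp_incM, add_comm]
  rfl

theorem isPretransitive : MulAction.IsPretransitive SpRes restrictedSiegelDisc :=
  ⟨fun Y Z => ⟨transvection Z * (transvection Y)⁻¹, by
    rw [mul_smul]
    nth_rw 2 [← transvection_smul_origin Y]
    rw [inv_smul_smul, transvection_smul_origin]⟩⟩

theorem contDiff_compRight {E F G : Type} [NormedAddCommGroup E] [InnerProductSpace ℂ E]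
    [CompleteSpace E] [NormedAddCommGroup F] [InnerProductSpace ℂ F] [CompleteSpace F]
    [NormedAddCommGroup G] [InnerProductSpace ℂ G] [CompleteSpace G] :
    ContDiff ℝ ∞ fun p : HS F G × (E →L[ℂ] F) => HS.compRight p.1 p.2 := by
  apply IsBoundedBilinearMap.contDiff
  exact
    { add_left := fun x y z => by rw [map_add]; rfl
      smul_left := fun c x y => HS.toCLM_injective (by
        rw [HS.toCLM_real_smul, HS.toCLM_compRight, HS.toCLM_real_smul]; rfl)
      add_right := fun x y z => by rw [map_add]
      smul_right := fun c x y => HS.toCLM_injective (by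
        ext1 u
        rw [HS.toCLM_real_smul]
        exact (HS.toCLM x).map_smul_of_tower c (y u))
      bound := ⟨1, one_pos, fun x y => by rw [one_mul]; exact HS.norm_compRight_le x y⟩ }

/-- Smoothness of the section in the ambient algebra, commutator included. The inverse of the orbit
map and the local trivializations inherit their smoothness from it. -/
theorem contDiffOn_transvectionAmb : ContDiffOn ℝ ∞ transvectionAmb restrictedSiegelDisc := by
  have h1 : ContDiff ℝ ∞ fun Z : symHS => HS.toCLM (offOp Z) :=
    ((HS.toCLML (E := Hilb) (F := Hilb)).restrictScalars ℝ ∘L offOp).contDiff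
  have h2 : ContDiffOn ℝ ∞ (fun Z : symHS => invSqrt (negSq Z)) restrictedSiegelDisc :=
    contDiffOn_invSqrt.comp (h1.mul h1).neg.contDiffOn fun Z hZ => by
      simpa using norm_negSq_lt_one hZ
  have h3 : ContDiff ℝ ∞ fun p : HS Hilb Hilb × (Hilb →L[ℂ] Hilb) => HS.compRight p.1 p.2 :=
    contDiff_compRight
  refine Amb.toProd.symm.contDiff.comp_contDiffOn ?_
  exact ((contDiffOn_const.add h1.contDiffOn).mul h2).prodMk
    (h3.comp_contDiffOn (lieOffOp.contDiff.contDiffOn.prodMk h2))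

/-! ### The unitary group as isotropy group -/

/-- The diagonal operator `(u, 0; 0, ū)` with its commutator with `d`. -/
def diagAmb (α : Hplus →L[ℂ] Hplus) : Amb := Amb.toProd.symm (diag α, 0)

theorem fst_diagAmb (α : Hplus →L[ℂ] Hplus) : (diagAmb α).fst = diag α := Amb.fst_toProd_symm _

theorem hasComm_diagAmb (α : Hplus →L[ℂ] Hplus) : (diagAmb α).HasComm := by
  rw [Amb.HasComm, fst_diagAmb, diagAmb, Amb.snd_toProd_symm, diag_dOp, sub_self, map_zero]

theorem star_diagAmb_mul {u : Hplus →L[ℂ] Hplus} (h : star u * u = 1) :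
    star (diagAmb u).fst * dOp * (diagAmb u).fst = dOp := by
  rw [fst_diagAmb, star_diag, diag_dOp, mul_assoc, ← diag_mul, h, diag_one, mul_one]

theorem diagAmb_mul_star {u : Hplus →L[ℂ] Hplus} (h : u * star u = 1) :
    (diagAmb u).fst * dOp * star (diagAmb u).fst = dOp := by
  rw [fst_diagAmb, star_diag, diag_dOp, mul_assoc, ← diag_mul, h, diag_one, mul_one]

/-- The embedding of the unitary group of `𝓗₊`. -/
def unitaryHom : unitary (Hplus →L[ℂ] Hplus) →* SpRes where
  toFun u := SpRes.ofAmb (diagAmb u) (hasComm_diagAmb _)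
    (by rw [fst_diagAmb]; exact isReal_diag _) (star_diagAmb_mul u.2.1) (diagAmb_mul_star u.2.2)
  map_one' := SpRes.ext_op (by
    rw [SpRes.ofAmb, SpRes.op_ofOp, fst_diagAmb, SpRes.op_one]
    exact diag_one)
  map_mul' u v := SpRes.ext_op (by
    rw [SpRes.op_mul, SpRes.ofAmb, SpRes.ofAmb, SpRes.ofAmb, SpRes.op_ofOp, SpRes.op_ofOp,
      SpRes.op_ofOp, fst_diagAmb, fst_diagAmb, fst_diagAmb]
    exact diag_mul _ _)

theorem toAmb_unitaryHom (u : unitary (Hplus →L[ℂ] Hplus)) :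
    SpRes.toAmb (unitaryHom u) = diagAmb u :=
  SpRes.toAmb_ofAmb _ (hasComm_diagAmb _) _ (star_diagAmb_mul u.2.1) (diagAmb_mul_star u.2.2)

theorem op_unitaryHom (u : unitary (Hplus →L[ℂ] Hplus)) : (unitaryHom u).op = diag u := by
  rw [← SpRes.fst_toAmb, toAmb_unitaryHom, fst_diagAmb]

theorem SpRes.g_eq (a : SpRes) : a.g = blockPP a.op := rfl

theorem g_unitaryHom (u : unitary (Hplus →L[ℂ] Hplus)) : (unitaryHom u).g = u := by
  rw [SpRes.g_eq, op_unitaryHom, blockPP_diag]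

theorem h_unitaryHom (u : unitary (Hplus →L[ℂ] Hplus)) : (unitaryHom u).h = 0 := by
  ext1 v
  change prP ((unitaryHom u).op v) = 0
  rw [op_unitaryHom, diag_incM, prP_incM]

theorem SpRes.continuous_op : Continuous SpRes.op :=
  continuous_fst.comp SpRes.isEmbedding_incl.continuous

/-- Diagonal operators commute with `d`, so the Hilbert-Schmidt part of the topology is invisible on
them, and `a ↦ g` is a continuous map recovering `u` in norm. -/
theorem isEmbedding_unitaryHom : IsEmbedding unitaryHom := by
  refine IsEmbedding.of_comp (g := SpRes.g) ?_ (blockPP.continuous.comp SpRes.continuous_op) ?_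
  · rw [SpRes.isEmbedding_toAmb.continuous_iff]
    have : SpRes.toAmb ∘ unitaryHom = fun u => diagAmb u.1 := funext toAmb_unitaryHom
    rw [this]
    exact Amb.toProd.symm.continuous.comp
      ((diag.continuous.comp continuous_subtype_val).prodMk continuous_const)
  · have : SpRes.g ∘ unitaryHom = Subtype.val := funext g_unitaryHom
    rw [this]
    exact IsEmbedding.subtypeVal

/-- The image of `0` is `h ḡ⁻¹`, which vanishes together with `h`. -/
theorem SpRes.smul_origin_eq_iff (a : SpRes) : a • origin = origin ↔ a.h = 0 := by
  have h0 : HS.toCLM (origin.1 : HS Hminus Hplus) = 0 := map_zero _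
  have h1 : a.num (HS.toCLM (origin.1 : HS Hminus Hplus)) = a.h := by
    rw [num_eq, h0, ContinuousLinearMap.comp_zero, zero_add]
  constructor
  · intro h
    have h2 : a.moebius origin.1 = 0 := by
      rw [← coe_smul, h]
      rfl
    ext1 u
    rw [← h1, ← a.moebius_den (norm_lt_one origin), h2, map_zero]
    rfl
  · intro h
    apply Subtype.ext
    apply Subtype.ext
    apply HS.toCLM_injective
    rw [coe_smul, toCLM_moebius, h1, h, ContinuousLinearMap.zero_comp, h0]

/-- If `h = 0`, reality forces `a = diag g`; since this commutes with `d`, the two symplectic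
relations become `g* g = 1` and `g g* = 1`. -/
theorem range_unitaryHom : unitaryHom.range = MulAction.stabilizer SpRes origin := by
  ext a
  rw [MulAction.mem_stabilizer_iff, SpRes.smul_origin_eq_iff]
  constructor
  · rintro ⟨u, rfl⟩
    exact h_unitaryHom u
  · intro h
    have ha : a.op = diag a.g := by
      refine a.isReal_op.ext (isReal_diag _) (fun u => ?_) fun u => ?_
      · rw [diag_incP, prP_incP]
        rfl
      · rw [diag_incM, prP_incM]
        exact congrArg (fun A : Hminus →L[ℂ] Hplus => A u) h
    have hd : ∀ {x : Hplus →L[ℂ] Hplus}, dOp * diag x = dOp → x = 1 := fun {x} hx => by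
      have h1 := congrArg (fun A => -dOp * A) hx
      simp only [← mul_assoc, neg_mul, dOp_mul_dOp, neg_neg, one_mul] at h1
      rw [← blockPP_diag x, h1, ← diag_one, blockPP_diag]
    have h1 := a.star_op_mul
    have h2 := a.op_mul_star
    rw [ha, star_diag, diag_dOp, mul_assoc, ← diag_mul] at h1 h2
    exact ⟨⟨a.g, hd h1, hd h2⟩, SpRes.ext_op ((op_unitaryHom _).trans ha.symm)⟩

/-! ### The orbit map of the origin -/

/-- The lower right block. -/
def blockMM : (Hilb →L[ℂ] Hilb) →L[ℝ] (Hminus →L[ℂ] Hminus) :=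
  LinearMap.mkContinuous
    { toFun := fun A => prM ∘L A ∘L incM
      map_add' := fun A B => by
        simp only [ContinuousLinearMap.add_comp, ContinuousLinearMap.comp_add]
      map_smul' := fun c A => by
        ext1 u
        exact prM.map_smul_of_tower c (A u) } (‖prM‖ * ‖incM‖) (fun A => by
      refine (ContinuousLinearMap.opNorm_comp_le _ _).trans ?_
      rw [mul_assoc, mul_comm ‖incM‖]
      exact mul_le_mul_of_nonneg_left (ContinuousLinearMap.opNorm_comp_le _ _) (norm_nonneg prM))

/-- The orbit map of the origin, extended to `Amb`. -/
def orbitAmb (x : Amb) : symHS :=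
  symHS.orthogonalProjectionOnto
    (HS.compRight (SpRes.offDiag x.snd) (Ring.inverse (blockMM x.fst)))

theorem SpRes.den_origin (a : SpRes) : a.den (HS.toCLM (origin.1 : HS Hminus Hplus))
    = blockMM a.op := by
  have h0 : HS.toCLM (origin.1 : HS Hminus Hplus) = 0 := map_zero _
  rw [h0]
  ext1 u
  change prM (a.op ((0 : Hminus →L[ℂ] Hplus) u + u)) = prM (a.op u)
  rw [zero_apply, Submodule.coe_zero, zero_add]

theorem SpRes.isUnit_blockMM (a : SpRes) : IsUnit (blockMM a.op) := by
  rw [← den_origin]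
  exact a.isUnit_den (norm_lt_one origin)

/-- On the group `h ḡ⁻¹` is already symmetric, so the orthogonal projection, present only to give
values in `symHS` on all of `Amb`, does nothing. -/
theorem orbitAmb_toAmb (a : SpRes) : orbitAmb (SpRes.toAmb a) = (a • origin).1 := by
  have h : HS.compRight (SpRes.offDiag a.lie) (Ring.inverse (blockMM a.op)) = (a • origin).1 := by
    have h0 : HS.compLeft a.g (origin.1 : HS Hminus Hplus) = 0 := map_zero _
    rw [coe_smul, SpRes.moebius, SpRes.den_origin, h0, zero_add]
  rw [orbitAmb, SpRes.snd_toAmb, SpRes.fst_toAmb, h,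
    Submodule.orthogonalProjectionOnto_mem_subspace_eq_self]

theorem contDiffAt_inverse_clm {E F : Type} [NormedAddCommGroup E] [InnerProductSpace ℂ E]
    [CompleteSpace E] [NormedAddCommGroup F] [NormedSpace ℝ F] (f : F →L[ℝ] (E →L[ℂ] E)) {x : F}
    (h : IsUnit (f x)) : ContDiffAt ℝ ∞ (fun y => Ring.inverse (f y)) x :=
  ContDiffAt.comp x (contDiffAt_inverse h) f.contDiff.contDiffAt

theorem contDiffAt_orbitAmb (a : SpRes) : ContDiffAt ℝ ∞ orbitAmb (SpRes.toAmb a) := by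
  have h1 : ContDiff ℝ ∞ fun x : Amb => SpRes.offDiag x.snd :=
    (SpRes.offDiag.restrictScalars ℝ).contDiff.comp (contDiff_snd.comp Amb.toProd.contDiff)
  have h2 : ContDiffAt ℝ ∞ (fun x : Amb => Ring.inverse (blockMM x.fst)) (SpRes.toAmb a) := by
    refine contDiffAt_inverse_clm (E := Hminus)
      (blockMM ∘L ContinuousLinearMap.fst ℝ _ _ ∘L Amb.toProd.toContinuousLinearMap) ?_
    change IsUnit (blockMM (SpRes.toAmb a).fst)
    rw [SpRes.fst_toAmb]
    exact a.isUnit_blockMM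
  exact (symHS.orthogonalProjectionOnto.restrictScalars ℝ).contDiff.contDiffAt.comp _
    ((contDiff_compRight (E := Hminus) (F := Hminus) (G := Hplus)).contDiffAt.comp _
      (h1.contDiffAt.prodMk h2))

theorem continuous_smul_origin : Continuous fun a : SpRes => a • origin := by
  rw [continuous_induced_rng]
  have : (Subtype.val ∘ fun a : SpRes => a • origin) = fun a => orbitAmb (SpRes.toAmb a) :=
    funext fun a => (orbitAmb_toAmb a).symm
  rw [this, continuous_iff_continuousAt]
  intro a
  exact ContinuousAt.comp (f := SpRes.toAmb) (contDiffAt_orbitAmb a).continuousAt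
    SpRes.isEmbedding_toAmb.continuous.continuousAt

theorem continuous_transvection : Continuous transvection := by
  rw [SpRes.isEmbedding_toAmb.continuous_iff]
  have : SpRes.toAmb ∘ transvection = fun Z => transvectionAmb Z.1 := funext toAmb_transvection
  rw [this]
  exact continuousOn_iff_continuous_domRestrict.1 contDiffOn_transvectionAmb.continuousOn

theorem mem_range_unitaryHom {a : SpRes} : a ∈ unitaryHom.range ↔ a • origin = origin := by
  rw [range_unitaryHom, MulAction.mem_stabilizer_iff]

/-- The orbit map of the origin is a homeomorphism. -/
def quotientHomeomorph : (SpRes ⧸ unitaryHom.range) ≃ₜ restrictedSiegelDisc where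
  toFun := Quotient.lift (fun a : SpRes => a • origin) fun a b h => by
    have h1 := mem_range_unitaryHom.1 (QuotientGroup.leftRel_apply.1 h)
    rw [mul_smul, inv_smul_eq_iff] at h1
    exact h1.symm
  invFun Z := QuotientGroup.mk (transvection Z)
  left_inv := by
    rintro ⟨a⟩
    refine QuotientGroup.eq.2 (mem_range_unitaryHom.2 ?_)
    change ((transvection (a • origin))⁻¹ * a) • origin = origin
    rw [mul_smul, inv_smul_eq_iff, transvection_smul_origin]
  right_inv := transvection_smul_origin
  continuous_toFun := continuous_smul_origin.quotient_lift _
  continuous_invFun := continuous_quotient_mk'.comp continuous_transvection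

/-! ### The orbit map is a diffeomorphism for every admissible structure -/

section Smooth

variable {B : Type} [NormedAddCommGroup B] [NormedSpace ℝ B] [ChartedSpace B SpRes]
  (hi : Manifold.IsSmoothEmbedding 𝓘(ℝ, B) 𝓘(ℝ, (Hilb →L[ℂ] Hilb) × HS Hilb Hilb) ∞ SpRes.incl)

include hi

theorem contMDiff_toAmb : ContMDiff 𝓘(ℝ, B) 𝓘(ℝ, Amb) ∞ SpRes.toAmb :=
  Amb.toProd.symm.contDiff.contMDiff.comp hi.contMDiff

theorem contMDiff_smul_origin :
    ContMDiff 𝓘(ℝ, B) 𝓘(ℝ, symHS) ∞ fun a : SpRes => (a • origin).1 := by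
  have h : (fun a : SpRes => (a • origin).1) = orbitAmb ∘ SpRes.toAmb :=
    funext fun a => (orbitAmb_toAmb a).symm
  rw [h]
  exact fun a => (contDiffAt_orbitAmb a).contMDiffAt.comp a (contMDiff_toAmb hi a)

/-- Smoothness of maps into `Sp_res(𝓥, Ω)`. -/
theorem contMDiffAt_of_toAmb [IsManifold 𝓘(ℝ, B) ∞ SpRes] {E M : Type} [NormedAddCommGroup E]
    [NormedSpace ℝ E] [TopologicalSpace M] [ChartedSpace E M] [IsManifold 𝓘(ℝ, E) ∞ M]
    {f : M → SpRes} {x : M} (hc : ContinuousAt f x)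
    (h : ContMDiffAt 𝓘(ℝ, E) 𝓘(ℝ, Amb) ∞ (fun y => SpRes.toAmb (f y)) x) :
    ContMDiffAt 𝓘(ℝ, E) 𝓘(ℝ, B) ∞ f x := by
  rw [ContMDiffAt.iff_comp_isImmersionAt (hi.isImmersion.isImmersionAt (f x))]
  refine ⟨hc, ?_⟩
  have : SpRes.incl ∘ f = Amb.toProd ∘ fun y => SpRes.toAmb (f y) :=
    funext fun y => (SpRes.toProd_toAmb _).symm
  rw [this]
  exact Amb.toProd.contDiff.contMDiff.contMDiffAt.comp x h

/-- Any structure of homogeneous space makes the orbit map a diffeomorphism. -/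
theorem exists_diffeomorph [IsManifold 𝓘(ℝ, B) ∞ SpRes] {E : Type} [NormedAddCommGroup E]
    [NormedSpace ℝ E] [ChartedSpace E (SpRes ⧸ unitaryHom.range)]
    [IsManifold 𝓘(ℝ, E) ∞ (SpRes ⧸ unitaryHom.range)]
    (hs : Manifold.IsSubmersion 𝓘(ℝ, B) 𝓘(ℝ, E) ∞
      (QuotientGroup.mk : SpRes → SpRes ⧸ unitaryHom.range)) (hD : IsOpen restrictedSiegelDisc) :
    ∃ Φ : (SpRes ⧸ unitaryHom.range) ≃ₘ⟮𝓘(ℝ, E), 𝓘(ℝ, symHS)⟯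
        (⟨restrictedSiegelDisc, hD⟩ : TopologicalSpace.Opens symHS),
      ∀ a : SpRes, (Φ (QuotientGroup.mk a) : symHS) = (a • origin).1 := by
  let f : (SpRes ⧸ unitaryHom.range) → (⟨restrictedSiegelDisc, hD⟩ : TopologicalSpace.Opens symHS) :=
    quotientHomeomorph
  let t : (⟨restrictedSiegelDisc, hD⟩ : TopologicalSpace.Opens symHS) → SpRes := transvection
  -- Smoothness descends along the submersion from `a ↦ a • origin`, which factors through the
  -- ambient algebra.
  have h1 : ContMDiff 𝓘(ℝ, E) 𝓘(ℝ, symHS) ∞ f := by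
    refine contMDiff_of_comp_isSubmersion hs QuotientGroup.mk_surjective ?_
    rw [← ContMDiff.subtypeVal_comp_iff]
    exact contMDiff_smul_origin hi
  -- Continuity together with smoothness of the composite with the embedding gives smoothness into
  -- the group; projecting to the quotient then gives the inverse.
  have h2 : ContMDiff 𝓘(ℝ, symHS) 𝓘(ℝ, B) ∞ t := fun Z => by
    refine contMDiffAt_of_toAmb hi continuous_transvection.continuousAt ?_
    have : (fun Z => SpRes.toAmb (t Z)) = fun Z => transvectionAmb Z.1 :=
      funext fun Z => toAmb_transvection Z
    rw [this]
    exact ((contDiffOn_transvectionAmb.contDiffAt (hD.mem_nhds Z.2)).contMDiffAt).comp Z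
      (contMDiff_subtype_val Z)
  exact ⟨⟨quotientHomeomorph.toEquiv, h1, hs.contMDiff.comp h2⟩, fun a => rfl⟩

end Smooth

/-! ### The manifold structure of the quotient and local trivializations -/

theorem isOpenEmbedding_quotient :
    IsOpenEmbedding fun q : SpRes ⧸ unitaryHom.range => (quotientHomeomorph q).1 :=
  (isOpen_restrictedSiegelDisc.isOpenEmbedding_subtypeVal).comp quotientHomeomorph.isOpenEmbedding

namespace Amb

open TrivSqZeroExt

/-- The unitary subgroup is the part of the group with zero commutator. Stability of this condition
under products and inverses lets the Cayley chart of the group restrict to it, with values in `0 ×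
LieU`. -/
theorem snd_mul_eq_zero {x y : Amb} (hx : x.snd = 0) (hy : y.snd = 0) : (x * y).snd = 0 := by
  rw [snd_mul, hx, hy, smul_zero, smul_zero, add_zero]

theorem snd_inverse_eq_zero {x : Amb} (hx : x.snd = 0) : (Ring.inverse x).snd = 0 := by
  by_cases h : IsUnit x
  · have h2 := congrArg TrivSqZeroExt.snd (Ring.mul_inverse_cancel _ h)
    rw [snd_mul, hx, smul_zero, add_zero, snd_one] at h2
    exact (isUnit_iff_isUnit_fst.1 h).smul_eq_zero.1 h2
  · rw [Ring.inverse_non_unit _ h, snd_zero]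

theorem snd_cayleyFun_eq_zero {x : Amb} (hx : x.snd = 0) : (cayleyFun x).snd = 0 :=
  snd_mul_eq_zero (by rw [snd_sub, hx, snd_one, sub_zero])
    (snd_inverse_eq_zero (by rw [snd_add, hx, snd_one, add_zero]))

theorem snd_cayleyInvFun_eq_zero {x : Amb} (hx : x.snd = 0) : (cayleyInvFun x).snd = 0 :=
  snd_mul_eq_zero (by rw [snd_add, hx, snd_one, add_zero])
    (snd_inverse_eq_zero (by rw [snd_sub, hx, snd_one, sub_zero]))

end Amb

theorem snd_toAmb_of_mem {k : SpRes} (hk : k ∈ unitaryHom.range) : (SpRes.toAmb k).snd = 0 := by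
  obtain ⟨u, rfl⟩ := hk
  rw [toAmb_unitaryHom, diagAmb, Amb.snd_toProd_symm]

theorem mem_of_snd_toAmb {k : SpRes} (hk : (SpRes.toAmb k).snd = 0) : k ∈ unitaryHom.range := by
  rw [mem_range_unitaryHom, SpRes.smul_origin_eq_iff, ← SpRes.toCLM_offDiag_lie, ← SpRes.snd_toAmb,
    hk, map_zero, map_zero]

/-- The inverse Cayley chart of the unitary group. -/
def unitaryLift (Y : LieU) : SpRes := SpRes.cayleyModel.lift (0, Y)

/-- The Cayley chart of the unitary group. -/
def unitaryCayley (k : SpRes) : LieU := (LieSp.ofAmb (cayleyFun (SpRes.toAmb k))).2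

theorem toAmb_unitaryLift {Y : LieU} (hY : IsUnit (1 - LieSp.toAmb (0, Y))) :
    SpRes.toAmb (unitaryLift Y) = cayleyInvFun (LieSp.toAmb (0, Y)) :=
  SpRes.cayleyModel.toHom_lift hY

theorem unitaryLift_mem {Y : LieU} (hY : IsUnit (1 - LieSp.toAmb (0, Y))) :
    unitaryLift Y ∈ unitaryHom.range := by
  apply mem_of_snd_toAmb
  rw [toAmb_unitaryLift hY]
  apply Amb.snd_cayleyInvFun_eq_zero
  rw [LieSp.snd_toAmb, map_zero]

theorem toAmb_unitaryCayley {k : SpRes} (hk : k ∈ unitaryHom.range)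
    (h : IsUnit (1 + SpRes.toAmb k)) :
    LieSp.toAmb (0, unitaryCayley k) = cayleyFun (SpRes.toAmb k) := by
  have h1 : (0, unitaryCayley k) = LieSp.ofAmb (cayleyFun (SpRes.toAmb k)) := by
    refine Prod.ext ?_ rfl
    rw [LieSp.ofAmb_apply, Amb.snd_cayleyFun_eq_zero (snd_toAmb_of_mem hk), map_zero, map_zero]
  rw [h1]
  exact SpRes.cayleyModel.cayley_mem k h

theorem unitaryLift_unitaryCayley {k : SpRes} (hk : k ∈ unitaryHom.range)
    (h : IsUnit (1 + SpRes.toAmb k)) : unitaryLift (unitaryCayley k) = k := by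
  have h1 : IsUnit (1 - LieSp.toAmb (0, unitaryCayley k)) := by
    rw [toAmb_unitaryCayley hk h]
    exact isUnit_one_sub_cayleyFun h
  apply SpRes.isEmbedding_toAmb.injective
  rw [toAmb_unitaryLift h1, toAmb_unitaryCayley hk h, cayleyInvFun_cayleyFun h]

theorem unitaryCayley_unitaryLift {Y : LieU} (hY : IsUnit (1 - LieSp.toAmb (0, Y))) :
    unitaryCayley (unitaryLift Y) = Y := by
  rw [unitaryCayley, toAmb_unitaryLift hY, cayleyFun_cayleyInvFun hY, LieSp.ofAmb_toAmb]

/-- `T_{a·0}⁻¹ a` fixes the origin: it is the unitary factor of `a`. Right multiplication by `b`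
serves to recentre the Cayley chart of the fibre. -/
theorem continuous_fiber (b : SpRes) :
    Continuous fun a : SpRes => (transvection (a • origin))⁻¹ * a * b := by
  have := SpRes.cayleyModel.isTopologicalGroup
  exact ((continuous_transvection.comp continuous_smul_origin).inv.mul continuous_id).mul
    continuous_const

theorem fiber_mem {b : SpRes} (hb : b ∈ unitaryHom.range) (a : SpRes) :
    (transvection (a • origin))⁻¹ * a * b ∈ unitaryHom.range := by
  rw [mem_range_unitaryHom] at hb ⊢
  rw [mul_smul, hb, mul_smul, inv_smul_eq_iff, transvection_smul_origin]

/-- The inverse of a local trivialization of `Sp_res(𝓥, Ω)` over the disc. -/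
def trivInv (b : SpRes) (p : LieSp) : SpRes := open scoped Classical in
  (if h : p.1 ∈ restrictedSiegelDisc then transvection ⟨p.1, h⟩ else 1) * unitaryLift p.2 * b

theorem trivInv_of_mem (b : SpRes) {p : LieSp} (h : p.1 ∈ restrictedSiegelDisc) :
    trivInv b p = transvection ⟨p.1, h⟩ * unitaryLift p.2 * b := by
  rw [trivInv, dif_pos h]

theorem trivInv_smul_origin {b : SpRes} (hb : b ∈ unitaryHom.range) {p : LieSp}
    (h : p.1 ∈ restrictedSiegelDisc) (h' : IsUnit (1 - LieSp.toAmb (0, p.2))) :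
    trivInv b p • origin = ⟨p.1, h⟩ := by
  rw [trivInv_of_mem b h, mul_smul, mem_range_unitaryHom.1 hb, mul_smul,
    mem_range_unitaryHom.1 (unitaryLift_mem h'), transvection_smul_origin]

/-- The domain of `trivInv` is open. -/
theorem isOpen_trivTarget : IsOpen
    {p : LieSp | p.1 ∈ restrictedSiegelDisc ∧ IsUnit (1 - LieSp.toAmb (0, p.2))} :=
  (isOpen_restrictedSiegelDisc.preimage continuous_fst).inter
    (isOpen_isUnit.preimage (continuous_const.sub
      (LieSp.toAmb.continuous.comp (continuous_const.prodMk continuous_snd))))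

theorem contDiffOn_toAmb_trivInv (b : SpRes) : ContDiffOn ℝ ∞ (fun p => SpRes.toAmb (trivInv b p))
    {p : LieSp | p.1 ∈ restrictedSiegelDisc ∧ IsUnit (1 - LieSp.toAmb (0, p.2))} := by
  have h1 : ContDiffOn ℝ ∞ (fun p : LieSp => transvectionAmb p.1 *
      cayleyInvFun (LieSp.toAmb (0, p.2)) * SpRes.toAmb b)
      {p : LieSp | p.1 ∈ restrictedSiegelDisc ∧ IsUnit (1 - LieSp.toAmb (0, p.2))} := by
    refine ContDiffOn.mul (ContDiffOn.mul ?_ ?_) contDiffOn_const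
    · exact contDiffOn_transvectionAmb.comp contDiff_fst.contDiffOn fun p hp => hp.1
    · intro p hp
      have h2 : ContDiff ℝ ∞ fun p : LieSp => LieSp.toAmb ((0, p.2) : LieSp) :=
        LieSp.toAmb.contDiff.comp (contDiff_const.prodMk contDiff_snd)
      exact ((contDiffAt_cayleyInvFun hp.2).comp p h2.contDiffAt).contDiffWithinAt
  refine h1.congr fun p hp => ?_
  rw [trivInv_of_mem b hp.1, map_mul, map_mul, toAmb_transvection, toAmb_unitaryLift hp.2]

theorem fiber_trivInv {b : SpRes} (hb : b ∈ unitaryHom.range) {p : LieSp}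
    (h : p.1 ∈ restrictedSiegelDisc) (h' : IsUnit (1 - LieSp.toAmb (0, p.2))) :
    (transvection (trivInv b p • origin))⁻¹ * trivInv b p * b⁻¹ = unitaryLift p.2 := by
  rw [trivInv_smul_origin hb h h', trivInv_of_mem b h]
  group

theorem trivInv_fiber {b : SpRes} (hb : b ∈ unitaryHom.range) {a : SpRes}
    (ha : IsUnit (1 + SpRes.toAmb ((transvection (a • origin))⁻¹ * a * b⁻¹))) :
    trivInv b ((a • origin).1, unitaryCayley ((transvection (a • origin))⁻¹ * a * b⁻¹)) = a := by
  rw [trivInv_of_mem b (p := ((a • origin).1, _)) (a • origin).2,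
    unitaryLift_unitaryCayley (fiber_mem (inv_mem hb) a) ha]
  group

theorem isUnit_fiber {b : SpRes} (hb : b ∈ unitaryHom.range) {a : SpRes}
    (ha : IsUnit (1 + SpRes.toAmb ((transvection (a • origin))⁻¹ * a * b⁻¹))) :
    IsUnit (1 - LieSp.toAmb
      (0, unitaryCayley ((transvection (a • origin))⁻¹ * a * b⁻¹))) := by
  rw [toAmb_unitaryCayley (fiber_mem (inv_mem hb) a) ha]
  exact isUnit_one_sub_cayleyFun ha

theorem isUnit_one_add_fiber {b : SpRes} (hb : b ∈ unitaryHom.range) {p : LieSp}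
    (h : p.1 ∈ restrictedSiegelDisc) (h' : IsUnit (1 - LieSp.toAmb (0, p.2))) :
    IsUnit (1 + SpRes.toAmb ((transvection (trivInv b p • origin))⁻¹ * trivInv b p * b⁻¹)) := by
  rw [fiber_trivInv hb h h', toAmb_unitaryLift h']
  exact isUnit_one_add_cayleyInvFun h'

theorem continuousAt_fiber {b a : SpRes}
    (ha : IsUnit (1 + SpRes.toAmb ((transvection (a • origin))⁻¹ * a * b⁻¹))) :
    ContinuousAt (fun a => unitaryCayley ((transvection (a • origin))⁻¹ * a * b⁻¹)) a := by
  have h1 : ContinuousAt (fun a => SpRes.toAmb ((transvection (a • origin))⁻¹ * a * b⁻¹)) a :=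
    (SpRes.isEmbedding_toAmb.continuous.comp (continuous_fiber b⁻¹)).continuousAt
  have h2 : ContinuousAt cayleyFun (SpRes.toAmb ((transvection (a • origin))⁻¹ * a * b⁻¹)) :=
    (contDiffAt_cayleyFun ha).continuousAt
  have h3 : Continuous fun x : Amb => (LieSp.ofAmb x).2 :=
    continuous_snd.comp LieSp.ofAmb.continuous
  exact h3.continuousAt.comp
    (ContinuousAt.comp (f := fun a => SpRes.toAmb ((transvection (a • origin))⁻¹ * a * b⁻¹)) h2 h1)

/-- A local trivialization of `Sp_res(𝓥, Ω)` over the disc. -/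
def trivialization (b : SpRes) (hb : b ∈ unitaryHom.range) : OpenPartialHomeomorph SpRes LieSp where
  toFun a := ((a • origin).1, unitaryCayley ((transvection (a • origin))⁻¹ * a * b⁻¹))
  invFun := trivInv b
  source := {a | IsUnit (1 + SpRes.toAmb ((transvection (a • origin))⁻¹ * a * b⁻¹))}
  target := {p | p.1 ∈ restrictedSiegelDisc ∧ IsUnit (1 - LieSp.toAmb (0, p.2))}
  map_source' a ha := ⟨(a • origin).2, isUnit_fiber hb ha⟩
  map_target' p hp := isUnit_one_add_fiber hb hp.1 hp.2
  left_inv' a ha := trivInv_fiber hb ha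
  right_inv' p hp := by
    rw [trivInv_smul_origin hb hp.1 hp.2]
    refine Prod.ext rfl ?_
    have h := fiber_trivInv hb hp.1 hp.2
    rw [trivInv_smul_origin hb hp.1 hp.2] at h
    exact (congrArg unitaryCayley h).trans (unitaryCayley_unitaryLift hp.2)
  open_source := isOpen_isUnit.preimage (continuous_const.add
    (SpRes.isEmbedding_toAmb.continuous.comp (continuous_fiber b⁻¹)))
  open_target := isOpen_trivTarget
  continuousOn_toFun a ha := ((continuous_subtype_val.comp
    continuous_smul_origin).continuousAt.prodMk (continuousAt_fiber ha)).continuousWithinAt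
  continuousOn_invFun := SpRes.isEmbedding_toAmb.isInducing.continuousOn_iff.2
    (contDiffOn_toAmb_trivInv b).continuousOn

/-! ### The projection to the quotient is a submersion -/

section Submersion

theorem isSmoothEmbedding_incl : @Manifold.IsSmoothEmbedding ℝ _ LieSp
    ((Hilb →L[ℂ] Hilb) × HS Hilb Hilb) _ _ _ _ LieSp ((Hilb →L[ℂ] Hilb) × HS Hilb Hilb) _ _
    𝓘(ℝ, LieSp) 𝓘(ℝ, (Hilb →L[ℂ] Hilb) × HS Hilb Hilb) SpRes
    ((Hilb →L[ℂ] Hilb) × HS Hilb Hilb) _ SpRes.cayleyModel.chartedSpace _ _ ∞ SpRes.incl :=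
  SpRes.cayleyModel.isSmoothEmbedding Amb.toProd SpRes.incl fun a => (SpRes.toProd_toAmb a).symm

/-- The forward map combines the orbit map, the smooth section and the group operations; the inverse
has an explicit smooth formula in `Amb`, and smoothness into the group is tested there. -/
theorem trivialization_mem_maximalAtlas {b : SpRes} (hb : b ∈ unitaryHom.range) :
    let _ := SpRes.cayleyModel.chartedSpace
    trivialization b hb ∈ IsManifold.maximalAtlas 𝓘(ℝ, LieSp) ∞ SpRes := by
  let _ := SpRes.cayleyModel.chartedSpace
  have := SpRes.cayleyModel.isManifold
  have := SpRes.cayleyModel.lieGroup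
  have hi := isSmoothEmbedding_incl
  refine OpenPartialHomeomorph.mem_maximalAtlas_of_contMDiffOn _ ?_ ?_
  · intro a ha
    have h1 : ContMDiffAt 𝓘(ℝ, LieSp) 𝓘(ℝ, LieSp) ∞
        (fun a : SpRes => transvection (a • origin)) a := by
      refine contMDiffAt_of_toAmb hi
        (continuous_transvection.comp continuous_smul_origin).continuousAt ?_
      simp_rw [toAmb_transvection]
      have h2 := contDiffOn_transvectionAmb.contDiffAt
        (isOpen_restrictedSiegelDisc.mem_nhds (a • origin).2)
      exact h2.contMDiffAt.comp (f := fun a : SpRes => (a • origin).1) a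
        (contMDiff_smul_origin hi a)
    have h2 : ContMDiffAt 𝓘(ℝ, LieSp) 𝓘(ℝ, LieSp) ∞
        (fun a : SpRes => (transvection (a • origin))⁻¹ * a * b⁻¹) a :=
      (h1.inv.mul contMDiffAt_id).mul contMDiffAt_const
    have h3 := (contMDiff_toAmb hi _).comp a h2
    have h4 : ContMDiffAt 𝓘(ℝ, LieSp) 𝓘(ℝ, LieU) ∞
        (fun a : SpRes => unitaryCayley ((transvection (a • origin))⁻¹ * a * b⁻¹)) a := by
      have h5 := (contDiffAt_cayleyFun ha).contMDiffAt.comp a h3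
      have h6 : ContDiff ℝ ∞ fun x : Amb => (LieSp.ofAmb x).2 :=
        contDiff_snd.comp LieSp.ofAmb.contDiff
      exact h6.contMDiff.contMDiffAt.comp a h5
    exact ((contMDiff_smul_origin hi a).prodMk_space h4).contMDiffWithinAt
  · intro p hp
    have hp' : p ∈ {p : LieSp | p.1 ∈ restrictedSiegelDisc ∧ IsUnit (1 - LieSp.toAmb (0, p.2))} := hp
    refine (contMDiffAt_of_toAmb hi ?_ ?_).contMDiffWithinAt
    · exact ((trivialization b hb).continuousOn_symm).continuousAt
        ((trivialization b hb).open_target.mem_nhds hp)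
    · exact ((contDiffOn_toAmb_trivInv b).contDiffAt (isOpen_trivTarget.mem_nhds hp')).contMDiffAt

/-- The chart of the quotient is the orbit map, and the orbit map is the first coordinate of a
trivialization, so in these charts the projection reads `(Z, Y) ↦ Z`. -/
theorem isSubmersion_mk :
    let _ := SpRes.cayleyModel.chartedSpace
    let _ := isOpenEmbedding_quotient.singletonChartedSpace
    Manifold.IsSubmersion 𝓘(ℝ, LieSp) 𝓘(ℝ, symHS) ∞
      (QuotientGroup.mk : SpRes → SpRes ⧸ unitaryHom.range) := by
  let _ := SpRes.cayleyModel.chartedSpace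
  let _ := isOpenEmbedding_quotient.singletonChartedSpace
  have := SpRes.cayleyModel.isManifold
  have hm : IsManifold 𝓘(ℝ, symHS) ∞ (SpRes ⧸ unitaryHom.range) :=
    isOpenEmbedding_quotient.isManifold_singleton
  refine Manifold.IsSubmersionOfComplement.isSubmersion (F := LieU) fun a => ?_
  -- The fibre chart is centred at the unitary factor of `a`; at `a` its Cayley argument is then 1,
  -- and `1 + 1` is a unit.
  have hb : (transvection (a • origin))⁻¹ * a ∈ unitaryHom.range := by
    rw [mem_range_unitaryHom, mul_smul, inv_smul_eq_iff, transvection_smul_origin]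
  refine Manifold.IsSubmersionAtOfComplement.mk_of_charts (.refl ℝ LieSp) (trivialization _ hb)
    (isOpenEmbedding_quotient.toOpenPartialHomeomorph _) ?_ ?_
    (trivialization_mem_maximalAtlas hb) (IsManifold.subset_maximalAtlas rfl) ?_ ?_
  · change IsUnit _
    rw [mul_inv_cancel, map_one, one_add_one_eq_two]
    exact isUnit_two'
  · simp
  · intro x _
    simp
  · intro p hp
    have hp' : p ∈ (trivialization _ hb).target := by simpa using hp
    change (trivInv _ p • origin).1 = p.1
    rw [trivInv_smul_origin hb hp'.1 hp'.2]

theorem isHomogeneousSpace :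
    let _ := SpRes.cayleyModel.chartedSpace
    let _ := isOpenEmbedding_quotient.singletonChartedSpace
    IsHomogeneousSpace unitaryHom.range LieSp symHS := by
  let _ := SpRes.cayleyModel.chartedSpace
  let _ := isOpenEmbedding_quotient.singletonChartedSpace
  exact
    { isManifold := SpRes.cayleyModel.isManifold
      isSmoothEmbedding := isSmoothEmbedding_incl
      lieGroup := SpRes.cayleyModel.lieGroup
      isManifold_quotient := isOpenEmbedding_quotient.isManifold_singleton
      isSubmersion := isSubmersion_mk }

end Submersion

end SiegelDisc

end

theorem proposition3p1 :
    ∃ _ : MulAction SpRes restrictedSiegelDisc,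
      -- the action is given by the Moebius formula, the inverse being a true inverse
      (∀ (a : SpRes) (Z : restrictedSiegelDisc),
        IsUnit (barMP a.h ∘L HS.toCLM Z.1.1 + barPP a.g) ∧
        HS.toCLM (a • Z).1.1 = (a.g ∘L HS.toCLM Z.1.1 + a.h) ∘L
          Ring.inverse (barMP a.h ∘L HS.toCLM Z.1.1 + barPP a.g)) ∧
      MulAction.IsPretransitive SpRes restrictedSiegelDisc ∧
      -- the isotropy group of `0` is the unitary group of `𝓗₊`
      ∃ U : unitary (Hplus →L[ℂ] Hplus) →* SpRes,
        (∀ u, (U u).g = u ∧ (U u).h = 0) ∧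
        Topology.IsEmbedding U ∧
        U.range = MulAction.stabilizer SpRes origin ∧
        -- the disc is an open subset of a Hilbert space, the homogeneous space exists, and
        -- the orbit map of `0` is a diffeomorphism between them
        ∃ hD : IsOpen restrictedSiegelDisc,
          (∃ (B : Type) (_ : NormedAddCommGroup B) (_ : NormedSpace ℝ B) (_ : CompleteSpace B)
            (_ : ChartedSpace B SpRes) (_ : ChartedSpace symHS (SpRes ⧸ U.range)),
            IsHomogeneousSpace U.range B symHS) ∧
          ∀ (B E : Type) [NormedAddCommGroup B] [NormedSpace ℝ B]
            [NormedAddCommGroup E] [NormedSpace ℝ E]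
            [ChartedSpace B SpRes] [ChartedSpace E (SpRes ⧸ U.range)],
            IsHomogeneousSpace U.range B E →
            ∃ Φ : (SpRes ⧸ U.range) ≃ₘ⟮𝓘(ℝ, E), 𝓘(ℝ, symHS)⟯
                (⟨restrictedSiegelDisc, hD⟩ : TopologicalSpace.Opens symHS),
              ∀ a : SpRes, (Φ (QuotientGroup.mk a) : symHS) = (a • origin).1 := by
  refine ⟨moebiusAction, fun a Z => ?_, isPretransitive, unitaryHom,
    fun u => ⟨g_unitaryHom u, h_unitaryHom u⟩, isEmbedding_unitaryHom, range_unitaryHom,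
    isOpen_restrictedSiegelDisc, ?_, ?_⟩
  · rw [← SpRes.den_eq, ← SpRes.num_eq]
    exact ⟨a.isUnit_den (norm_lt_one Z), a.toCLM_moebius Z.1⟩
  · exact ⟨LieSp, inferInstance, inferInstance, inferInstance, SpRes.cayleyModel.chartedSpace,
      isOpenEmbedding_quotient.singletonChartedSpace, isHomogeneousSpace⟩
  · intro B E _ _ _ _ _ _ H
    have := H.isManifold
    have := H.isManifold_quotient
    exact exists_diffeomorph H.isSmoothEmbedding H.isSubmersion isOpen_restrictedSiegelDisc
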